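/- For $f:[0,\infty)\to\mathbb R$ consider the equation $$ i u_t-(u_{xx}+u_{yy})-f(|u|^2)u=0,\qquad u(t,x+K_1,y)=u(t,x,y)=u(t,x,y+K_2),\tag{NLS}$$ and standing waves $u=e^{-i\omega t}\varphi(x)$ with $\varphi$ real-valued and $K_1$-periodic. Linearizing at $e^{-i\omega t}(\varphi+v)$ with $v=v_1+iv_2$ gives $$\partial_t v_1=-(\mathcal L_+-\partial_y^2)v_2,\qquad \partial_t v_2=(\mathcal L_--\partial_y^2)v_1,\tag{LIN}$$ $$\mathcal L_+=-\partial_x^2+\omega-f(\varphi^2),\qquad \mathcal L_-=-\partial_x^2+\omega-f(\varphi^2)-2f'(\varphi^2)\varphi^2 .$$ Let $\mathcal A$ be the operator given by the right-hand side of (LIN) on the (complexified) space $L^2\times L^2$ over the torus with periods $K_1,K_2$, with domain $H^2\times H^2$ (periodic). The wave is called spectrally unstable if $\mathcal A$ generates a $C_0$ semigroup and $\sigma(\mathcal A)\not\subset\{\operatorname{Re}\lambda\le 0\}$, and linearly unstable if $\mathcal A$ generates a $C_0$ semigroup $e^{t\mathcal A}$ whose growth bound is positive. Below, $\mathrm{cn},\mathrm{dn}$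 are the Jacobi elliptic functions and $K(\kappa)$ is the complete elliptic integral of the first kind, of modulus $\kappa$. **Theorem.** (1) Quadratic equation, $f(z)=\sqrt z$. Let $\omega>0$, $c\in(-\omega^3/3,0)$, let $\varphi_0>\varphi_1>0$ be the positive roots of $\frac23\rho^3-\omega\rho^2-c=0$, and let $\alpha>0$ and $\kappa$ be given by $$\alpha^2=\frac{4\varphi_0+2\varphi_1-3\omega}{12},\qquad \kappa^2=\frac{2\varphi_0-2\varphi_1}{4\varphi_0+2\varphi_1-3\omega},\qquad \kappa\in(0,1).$$ Such $\varphi_0,\varphi_1,\alpha,\kappa$ exist for all these $\omega,c$, and for each $\omega>0$ every $\kappa\in(0,1)$ occurs for some $c$. Each of the two functions $\varphi$ of constant sign with $$|\varphi(x)|=\varphi_1+(\varphi_0-\varphi_1)\,\mathrm{cn}^2(\alpha x;\kappa)$$ gives a standing wave $e^{-i\omega t}\varphi(x)$ of (NLS) with $K_1=2K(\kappa)/\alpha$ (and any $K_2>0$), and there is $K_2>0$, depending on the specific solution, for which this wave is spectrally and linearly unstable. (2) Cubic equation, $f(z)=z$. Let $\omega>0$, $c\in(-\omega^2/2,0)$,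 let $\varphi_0>\varphi_1>0$ be the positive roots of $\frac12\rho^4-\omega\rho^2-c=0$, and let $\alpha=\varphi_0/\sqrt2$, $\kappa^2=(\varphi_0^2-\varphi_1^2)/\varphi_0^2$, $\kappa\in(0,1)$. Such $\varphi_0,\varphi_1,\alpha,\kappa$ exist for all these $\omega,c$, and for each $\omega>0$ every $\kappa\in(0,1)$ occurs for some $c$. Each of the two functions $$\varphi(x)=\mp\varphi_0\,\mathrm{dn}(\alpha x;\kappa)$$ gives a standing wave $e^{-i\omega t}\varphi(x)$ of (NLS) with $K_1=2K(\kappa)/\alpha$ (and any $K_2>0$), and there is $K_2>0$, depending on the specific solution, for which this wave is spectrally and linearly unstable. -/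

import Mathlib

open Real Set Filter Topology MeasureTheory

noncomputable section

/-! ### Jacobi elliptic functions of modulus `k` -/

/-- Incomplete elliptic integral of the first kind, in Legendre form, with modulus `k`. -/
def ellipticF (k θ : ℝ) : ℝ := ∫ s in (0 : ℝ)..θ, 1 / √(1 - k ^ 2 * sin s ^ 2)

/-- Complete elliptic integral of the first kind `K(k)`. -/
def ellipticK (k : ℝ) : ℝ := ellipticF k (π / 2)

/-- Jacobi amplitude: the inverse function of `θ ↦ F(θ; k)`, which is a bijection of `ℝ`
whenever `k ^ 2 < 1`. -/
def jacobiAm (k x : ℝ) : ℝ := Function.invFun (ellipticF k) x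

/-- The Jacobi function `sn(x; k)`. -/
def jacobiSn (k x : ℝ) : ℝ := sin (jacobiAm k x)

/-- The Jacobi function `cn(x; k)`. -/
def jacobiCn (k x : ℝ) : ℝ := cos (jacobiAm k x)

/-- The Jacobi function `dn(x; k)`. -/
def jacobiDn (k x : ℝ) : ℝ := √(1 - k ^ 2 * jacobiSn k x ^ 2)

/-! ### The nonlinear Schrödinger equation and its standing waves -/

/-- `u = u(t, x, y)` is a (classical) solution of
`i u_t - (u_xx + u_yy) - f(|u|²) u = 0`, with period `K₁` in `x` and `K₂` in `y`. -/
structure SolvesNLS (f : ℝ → ℝ) (K₁ K₂ : ℝ) (u : ℝ → ℝ → ℝ → ℂ) : Prop where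
  contDiff : ContDiff ℝ 2 (fun p : ℝ × ℝ × ℝ => u p.1 p.2.1 p.2.2)
  periodic_x : ∀ t x y, u t (x + K₁) y = u t x y
  periodic_y : ∀ t x y, u t x (y + K₂) = u t x y
  equation : ∀ t x y,
    Complex.I * deriv (fun s => u s x y) t
      - (iteratedDeriv 2 (fun r => u t r y) x + iteratedDeriv 2 (fun r => u t x r) y)
      - (f (‖u t x y‖ ^ 2) : ℂ) * u t x y = 0

/-- The standing wave `u(t, x, y) = e^{-iωt} φ(x)`. -/
def standingWave (ω : ℝ) (φ : ℝ → ℝ) : ℝ → ℝ → ℝ → ℂ :=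
  fun t x _ => Complex.exp (-Complex.I * ω * t) * (φ x : ℂ)

/-- Parameters of the cnoidal standing waves of the quadratic equation: `φ₀ > φ₁ > 0` are the
positive solutions of `(2/3) ρ³ - ω ρ² - c = 0`, where `ω > 0` and `-ω³/3 < c < 0`. -/
structure CnoidalParams (ω c φ₀ φ₁ α κ : ℝ) : Prop where
  omega_pos : 0 < ω
  c_mem : c ∈ Ioo (-(ω ^ 3) / 3) 0
  phi_one_pos : 0 < φ₁
  phi_one_lt : φ₁ < φ₀
  root_zero : 2 / 3 * φ₀ ^ 3 - ω * φ₀ ^ 2 - c = 0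
  root_one : 2 / 3 * φ₁ ^ 3 - ω * φ₁ ^ 2 - c = 0
  alpha_pos : 0 < α
  alpha_sq : α ^ 2 = (4 * φ₀ + 2 * φ₁ - 3 * ω) / 12
  kappa_mem : κ ∈ Ioo (0 : ℝ) 1
  kappa_sq : κ ^ 2 = (2 * φ₀ - 2 * φ₁) / (4 * φ₀ + 2 * φ₁ - 3 * ω)

/-- The profile `φ₁ + (φ₀ - φ₁) cn²(α x; κ)`. -/
def cnoidal (φ₀ φ₁ α κ : ℝ) : ℝ → ℝ :=
  fun x => φ₁ + (φ₀ - φ₁) * jacobiCn κ (α * x) ^ 2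

/-- Parameters of the dnoidal standing waves of the cubic equation: `φ₀ > φ₁ > 0` are the
positive solutions of `(1/2) ρ⁴ - ω ρ² - c = 0`, where `ω > 0` and `-ω²/2 < c < 0`. -/
structure DnoidalParams (ω c φ₀ φ₁ α κ : ℝ) : Prop where
  omega_pos : 0 < ω
  c_mem : c ∈ Ioo (-(ω ^ 2) / 2) 0
  phi_one_pos : 0 < φ₁
  phi_one_lt : φ₁ < φ₀
  root_zero : 1 / 2 * φ₀ ^ 4 - ω * φ₀ ^ 2 - c = 0
  root_one : 1 / 2 * φ₁ ^ 4 - ω * φ₁ ^ 2 - c = 0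
  alpha_eq : α = φ₀ / √2
  kappa_mem : κ ∈ Ioo (0 : ℝ) 1
  kappa_sq : κ ^ 2 = (φ₀ ^ 2 - φ₁ ^ 2) / φ₀ ^ 2

/-- The profile `φ₀ dn(α x; κ)`. -/
def dnoidal (φ₀ α κ : ℝ) : ℝ → ℝ := fun x => φ₀ * jacobiDn κ (α * x)

/-! ### Semigroups, spectrum, stability

An unbounded operator `A` on `X` is given by its graph, a subset of `X × X`. -/

section Stability

variable {X : Type*} [NormedAddCommGroup X] [NormedSpace ℂ X]

/-- A `C₀` semigroup of bounded operators on `X` (values at negative times are irrelevant). -/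
structure C0Semigroup (X : Type*) [NormedAddCommGroup X] [NormedSpace ℂ X] where
  toFun : ℝ → X →L[ℂ] X
  map_zero : toFun 0 = ContinuousLinearMap.id ℂ X
  map_add : ∀ s t : ℝ, 0 ≤ s → 0 ≤ t → toFun (s + t) = (toFun s).comp (toFun t)
  tendsto_zero : ∀ v : X, Tendsto (fun t => toFun t v) (𝓝[>] 0) (𝓝 v)

/-- `A` (given by its graph) is the infinitesimal generator of the semigroup `S`. -/
def C0Semigroup.HasGenerator (S : C0Semigroup X) (A : Set (X × X)) : Prop :=
  ∀ v w : X, (v, w) ∈ A ↔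
    Tendsto (fun h : ℝ => ((h⁻¹ : ℝ) : ℂ) • (S.toFun h v - v)) (𝓝[>] 0) (𝓝 w)

/-- The growth bound of a semigroup: the infimum of all real `a` such that
`‖S(t)‖ ≤ M e^{a t}` for some `M` and all `t ≥ 0`. -/
def C0Semigroup.growthBound (S : C0Semigroup X) : EReal :=
  sInf ((fun a : ℝ => (a : EReal)) ''
    {a : ℝ | ∃ M : ℝ, ∀ t : ℝ, 0 ≤ t → ‖S.toFun t‖ ≤ M * exp (a * t)})

/-- The resolvent set: all `z` for which `z - A` is a bijection from the domain of `A` onto `X`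
with bounded inverse `R`. -/
def operatorResolventSet (A : Set (X × X)) : Set ℂ :=
  {z | ∃ R : X →L[ℂ] X, ∀ g v : X, R g = v ↔ (v, z • v - g) ∈ A}

/-- The spectrum of the operator with graph `A`. -/
def operatorSpectrum (A : Set (X × X)) : Set ℂ := (operatorResolventSet A)ᶜ

/-- Spectral stability: `σ(A) ⊆ {Re z ≤ 0}`. -/
def SpectrallyStable (A : Set (X × X)) : Prop :=
  operatorSpectrum A ⊆ {z : ℂ | z.re ≤ 0}

/-- Linear stability: the growth bound of `e^{tA}` is non-positive. -/
def C0Semigroup.LinearlyStable (S : C0Semigroup X) : Prop := S.growthBound ≤ 0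

end Stability

/-! ### The linearization about a standing wave, on the periodic cell -/

/-- Lebesgue measure on the cell `(0, K₁] × (0, K₂]`. -/
def cellMeasure (K₁ K₂ : ℝ) : Measure (ℝ × ℝ) :=
  volume.restrict (Ioc 0 K₁ ×ˢ Ioc 0 K₂)

/-- Complex `L²` on the periodic cell. -/
abbrev CellL2 (K₁ K₂ : ℝ) : Type := Lp ℂ 2 (cellMeasure K₁ K₂)

/-- Smooth doubly periodic functions. -/
structure IsPeriodicTest (K₁ K₂ : ℝ) (ψ : ℝ × ℝ → ℂ) : Prop where
  contDiff : ContDiff ℝ ((⊤ : ℕ∞) : WithTop ℕ∞) ψ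
  periodic_x : ∀ x y, ψ (x + K₁, y) = ψ (x, y)
  periodic_y : ∀ x y, ψ (x, y + K₂) = ψ (x, y)

/-- `w` is the weak derivative of `v` along `e`, as periodic functions. -/
def HasWeakDeriv {K₁ K₂ : ℝ} (e : ℝ × ℝ) (v w : CellL2 K₁ K₂) : Prop :=
  ∀ ψ : ℝ × ℝ → ℂ, IsPeriodicTest K₁ K₂ ψ →
    ∫ p, v p * fderiv ℝ ψ p e ∂(cellMeasure K₁ K₂)
      = -∫ p, w p * ψ p ∂(cellMeasure K₁ K₂)

/-- `v` belongs to the periodic Sobolev space `H²` (all weak partial derivatives of order at most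
two are in `L²`) and `w = v_xx + v_yy`. -/
def HasLaplacian {K₁ K₂ : ℝ} (v w : CellL2 K₁ K₂) : Prop :=
  ∃ vx vy vxx vxy vyy : CellL2 K₁ K₂,
    HasWeakDeriv (1, 0) v vx ∧ HasWeakDeriv (0, 1) v vy ∧
    HasWeakDeriv (1, 0) vx vxx ∧ HasWeakDeriv (0, 1) vx vxy ∧ HasWeakDeriv (0, 1) vy vyy ∧
    w = vxx + vyy

/-- The potential `ω - f(φ²)` of `ℒ₊ = -∂_x² + ω - f(φ²)`. -/
def potentialPlus (f : ℝ → ℝ) (ω : ℝ) (φ : ℝ → ℝ) (x : ℝ) : ℝ := ω - f (φ x ^ 2)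

/-- The potential `ω - f(φ²) - 2 f'(φ²) φ²` of `ℒ₋ = -∂_x² + ω - f(φ²) - 2 f'(φ²) φ²`. -/
def potentialMinus (f : ℝ → ℝ) (ω : ℝ) (φ : ℝ → ℝ) (x : ℝ) : ℝ :=
  ω - f (φ x ^ 2) - 2 * deriv f (φ x ^ 2) * φ x ^ 2

/-- Linearizing at `u = e^{-iωt} (φ + v)` gives
`i v_t + ω v - Δ v - f(φ²) v - 2 f'(φ²) φ² Re v = 0`. With `v = v₁ + i v₂` this is the system
`∂_t v₁ = -(ℒ₊ - ∂_y²) v₂`, `∂_t v₂ = (ℒ₋ - ∂_y²) v₁`. This is the graph of its generator,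
complexified, i.e. for complex valued `v₁`, `v₂`, with domain `H² × H²` in `L² × L²`. -/
def linearizedNLS (f : ℝ → ℝ) (ω : ℝ) (φ : ℝ → ℝ) (K₁ K₂ : ℝ) :
    Set ((CellL2 K₁ K₂ × CellL2 K₁ K₂) × (CellL2 K₁ K₂ × CellL2 K₁ K₂)) :=
  {q | ∃ d₁ d₂ : CellL2 K₁ K₂, HasLaplacian q.1.1 d₁ ∧ HasLaplacian q.1.2 d₂ ∧
    (∀ᵐ p ∂(cellMeasure K₁ K₂),
      q.2.1 p = -(-d₂ p + (potentialPlus f ω φ p.1 : ℂ) * q.1.2 p)) ∧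
    (∀ᵐ p ∂(cellMeasure K₁ K₂),
      q.2.2 p = -d₁ p + (potentialMinus f ω φ p.1 : ℂ) * q.1.1 p)}

/-- The linearization about `e^{-iωt} φ(x)`, on functions with periods `K₁` in `x` and `K₂` in `y`,
generates a `C₀` semigroup, and the wave is neither spectrally nor linearly stable. -/
def SpectrallyAndLinearlyUnstable (f : ℝ → ℝ) (ω : ℝ) (φ : ℝ → ℝ) (K₁ K₂ : ℝ) : Prop :=
  ∃ S : C0Semigroup (CellL2 K₁ K₂ × CellL2 K₁ K₂),
    S.HasGenerator (linearizedNLS f ω φ K₁ K₂) ∧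
    ¬ SpectrallyStable (linearizedNLS f ω φ K₁ K₂) ∧
    ¬ S.LinearlyStable

end

noncomputable section

/-! ### Operators which are diagonal in a Hilbert basis -/

section Diagonal

variable {ι H : Type*} [NormedAddCommGroup H] [InnerProductSpace ℂ H]

/-! Both waves have the form ±ψ with ψ > 0 periodic and ψ'' = (ω - f(ψ²))ψ, so ψ is a positive zero
mode of ℒ₊ and hence ℒ₊ ≥ 0. Moreover ℒ₋ = ℒ₊ - W with W = 2f'(ψ²)ψ² > 0: W = ψ in the quadratic
case and W = 2ψ² in the cubic case. Everything after this uses only these two facts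
(`IsGroundState.exists_unstable_period`).

On functions v(x)exp(2πiy/K₂) the operator -∂_y² is the constant k = (2π/K₂)². There D = ℒ₊ + k ≥ k
has a compact positive inverse P (`HilbertBasis.exists_compact_inverse`); on y-independent functions
this would fail, as ℒ₊ has a kernel. An eigenvalue l of the linearization means Dv₂ = -l v₁ and (D -
W)v₁ = l v₂. Eliminating v₂ = -lPv₁ gives (P⁻¹ + l²P)v₁ = Wv₁. With S = √W, R(l) = P(1 + l²P²)⁻¹ and
w = Sv₁, this becomes S R(l) S w = w.

The operator S R(l) S is compact and nonnegative, so it has eigenvalue 1 as soon as its norm is 1.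
The norm is continuous in l and at most ‖S‖²/(2l). For l → 0 the trial vector ψ/√W (times the
y-exponential) shows that it exceeds 1 if k < min W, because P acts on the ψ-mode as 1/k. The
intermediate value theorem yields l > 0 (`exists_eigenpair_of_compact`). The choice k = (min W)/2
fixes K₂.

The generator property is perturbative: the Laplacian part generates a bounded group that rotates
each pair of Fourier coefficients (`HilbertBasis.tendsto_rotation_iff`), and the potentials are
bounded (`exists_perturbed_semigroup`). The semigroup multiplies the eigenvector by exp(lt), so its
growth bound is at least l (`unstable_of_eigenvector`).

What remains is to check that the Jacobi profiles are ground states (`CnoidalParams.isGroundState`,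
`DnoidalParams.isGroundState`) and that the parameters exist. -/

theorem HilbertBasis.ext_repr (b : HilbertBasis ι ℂ H) {x y : H}
    (h : ∀ i, b.repr x i = b.repr y i) : x = y :=
  b.repr.injective (lp.ext (funext h))

theorem HilbertBasis.exists_repr_eq (b : HilbertBasis ι ℂ H) {c : ι → ℂ} {C : ℝ} {x : H}
    (h : ∀ i, ‖c i‖ ≤ C * ‖b.repr x i‖) :
    ∃ y : H, ‖y‖ ≤ |C| * ‖x‖ ∧ ∀ i, b.repr y i = c i := by
  have h' : ∀ i, ‖c i‖ ≤ ‖(((|C| : ℝ) : ℂ) • b.repr x : lp (fun _ : ι => ℂ) 2) i‖ := fun i => by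
    rw [lp.coeFn_smul, Pi.smul_apply, norm_smul, Complex.norm_real, norm_abs_eq_norm]
    exact (h i).trans (mul_le_mul_of_nonneg_right (le_abs_self C) (norm_nonneg _))
  have hc : Memℓp c 2 :=
    (lp.memℓp (((|C| : ℝ) : ℂ) • b.repr x : lp (fun _ : ι => ℂ) 2)).mono' h'
  refine ⟨b.repr.symm ⟨c, hc⟩, ?_, fun i => by simp⟩
  rw [LinearIsometryEquiv.norm_map, ← b.repr.norm_map x]
  refine (lp.norm_mono (p := 2) (by norm_num) (y := (((|C| : ℝ) : ℂ) • b.repr x : lp (fun _ : ι => ℂ) 2))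
    h').trans (le_of_eq ?_)
  rw [norm_smul, Complex.norm_real, norm_abs_eq_norm, Real.norm_eq_abs]

theorem HilbertBasis.exists_diagonal (b : HilbertBasis ι ℂ H) {m : ι → ℂ} {C : ℝ}
    (hm : ∀ i, ‖m i‖ ≤ C) :
    ∃ T : H →L[ℂ] H, ‖T‖ ≤ |C| ∧ ∀ x i, b.repr (T x) i = m i * b.repr x i := by
  have h : ∀ x : H, ∃ y : H, ‖y‖ ≤ |C| * ‖x‖ ∧ ∀ i, b.repr y i = m i * b.repr x i := fun x =>
    b.exists_repr_eq fun i => by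
      rw [norm_mul]
      exact mul_le_mul_of_nonneg_right (hm i) (norm_nonneg _)
  choose T hT hTr using h
  let L : H →ₗ[ℂ] H :=
    { toFun := T
      map_add' := fun x y => b.ext_repr fun i => by
        simp only [map_add, lp.coeFn_add, Pi.add_apply, hTr, mul_add]
      map_smul' := fun c x => b.ext_repr fun i => by
        simp only [map_smul, lp.coeFn_smul, Pi.smul_apply, hTr, smul_eq_mul, RingHom.id_apply]
        ring }
  exact ⟨L.mkContinuous |C| hT, L.mkContinuous_norm_le (abs_nonneg _) hT, hTr⟩

/-- The diagonal operator with the bounded diagonal `m`; zero if `m` is unbounded. -/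
def HilbertBasis.diagonal (b : HilbertBasis ι ℂ H) (m : ι → ℂ) : H →L[ℂ] H :=
  open Classical in
  if h : ∃ C : ℝ, ∀ i, ‖m i‖ ≤ C then (b.exists_diagonal h.choose_spec).choose else 0

theorem HilbertBasis.repr_diagonal (b : HilbertBasis ι ℂ H) {m : ι → ℂ} {C : ℝ}
    (hm : ∀ i, ‖m i‖ ≤ C) (x : H) (i : ι) :
    b.repr (b.diagonal m x) i = m i * b.repr x i := by
  have h : ∃ C : ℝ, ∀ i, ‖m i‖ ≤ C := ⟨C, hm⟩
  rw [HilbertBasis.diagonal, dif_pos h]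
  exact (b.exists_diagonal h.choose_spec).choose_spec.2 x i

theorem HilbertBasis.norm_diagonal_le (b : HilbertBasis ι ℂ H) {m : ι → ℂ} {C : ℝ} (hC : 0 ≤ C)
    (hm : ∀ i, ‖m i‖ ≤ C) : ‖b.diagonal m‖ ≤ C := by
  obtain ⟨T, hT, hTr⟩ := b.exists_diagonal hm
  have : b.diagonal m = T := by
    ext x
    exact b.ext_repr fun i => by rw [b.repr_diagonal hm, hTr]
  rw [this]
  exact hT.trans_eq (abs_of_nonneg hC)

theorem HilbertBasis.inner_eq_tsum (b : HilbertBasis ι ℂ H) (x y : H) :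
    inner ℂ x y = ∑' i, inner ℂ (b.repr x i) (b.repr y i) := by
  rw [← b.repr.inner_map_map, lp.inner_eq_tsum]

theorem HilbertBasis.isSelfAdjoint_diagonal [CompleteSpace H] (b : HilbertBasis ι ℂ H) {m : ι → ℝ}
    {C : ℝ} (hm : ∀ i, ‖(m i : ℂ)‖ ≤ C) : IsSelfAdjoint (b.diagonal fun i => (m i : ℂ)) := by
  rw [ContinuousLinearMap.isSelfAdjoint_iff_isSymmetric]
  intro x y
  change inner ℂ (b.diagonal _ x) y = inner ℂ x (b.diagonal _ y)
  rw [b.inner_eq_tsum, b.inner_eq_tsum]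
  refine tsum_congr fun i => ?_
  rw [b.repr_diagonal hm, b.repr_diagonal hm]
  simp only [RCLike.inner_apply, map_mul, Complex.conj_ofReal]
  ring

theorem HilbertBasis.isCompactOperator_diagonal_of_finite [CompleteSpace H]
    (b : HilbertBasis ι ℂ H) {m : ι → ℂ} {C : ℝ} (hm : ∀ i, ‖m i‖ ≤ C)
    (s : Finset ι) (hs : ∀ i ∉ s, m i = 0) : IsCompactOperator (b.diagonal m) := by
  classical
  have h1 : b.diagonal m
      = ∑ i ∈ s, (ContinuousLinearMap.toSpanSingleton ℂ (m i • b i)).comp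
          (innerSL ℂ (b i)) := by
    ext x
    refine b.ext_repr fun j => ?_
    rw [b.repr_diagonal hm]
    simp only [sum_apply, ContinuousLinearMap.comp_apply, innerSL_apply_apply,
      ContinuousLinearMap.toSpanSingleton_apply, map_sum, map_smul, b.repr_self, lp.coeFn_sum,
      Finset.sum_apply, lp.coeFn_smul, Pi.smul_apply, lp.coeFn_single, smul_eq_mul,
      Pi.single_apply, mul_ite, mul_one, mul_zero, Finset.sum_ite_eq]
    split_ifs with hj
    · rw [b.repr_apply_apply, mul_comm]
    · rw [hs j hj, zero_mul]
  rw [h1]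
  have h2 : ∀ t : Finset ι, IsCompactOperator (∑ i ∈ t,
      (ContinuousLinearMap.toSpanSingleton ℂ (m i • b i)).comp (innerSL ℂ (b i)) : H →L[ℂ] H) := by
    intro t
    induction t using Finset.induction_on with
    | empty => simpa using isCompactOperator_zero
    | insert i t hi ih =>
      rw [Finset.sum_insert hi]
      refine IsCompactOperator.add ?_ ih
      have : IsCompactOperator (ContinuousLinearMap.toSpanSingleton ℂ (m i • b i)) :=
        isCompactOperator_of_locallyCompactSpace_rng (ContinuousLinearMap.toSpanSingleton ℂ _)
      exact this.comp_clm (innerSL ℂ (b i))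
  exact h2 s

/-- Only finitely many entries have size at least 1/(n + 1). Keeping just these gives finite rank
operators within norm distance 1/(n + 1), and norm limits of compact operators are compact. -/
theorem HilbertBasis.isCompactOperator_diagonal [CompleteSpace H] (b : HilbertBasis ι ℂ H)
    {m : ι → ℂ} {C : ℝ} (hm : ∀ i, ‖m i‖ ≤ C) (h0 : Tendsto m cofinite (𝓝 0)) :
    IsCompactOperator (b.diagonal m) := by
  classical
  have hfin : ∀ n : ℕ, {i | ¬ ‖m i‖ < 1 / ((n : ℝ) + 1)}.Finite := fun n => by
    have := (Metric.tendsto_nhds.1 h0) (1 / ((n : ℝ) + 1)) (by positivity)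
    simpa [Filter.eventually_cofinite] using this
  let mn : ℕ → ι → ℂ := fun n i => if i ∈ (hfin n).toFinset then m i else 0
  have hmn : ∀ n i, ‖mn n i‖ ≤ C := fun n i => by
    by_cases h : i ∈ (hfin n).toFinset
    · simpa only [mn, if_pos h] using hm i
    · simpa only [mn, if_neg h, norm_zero] using (norm_nonneg _).trans (hm i)
  have hT : Tendsto (fun n => b.diagonal (mn n)) atTop (𝓝 (b.diagonal m)) := by
    rw [tendsto_iff_norm_sub_tendsto_zero]
    refine squeeze_zero (fun _ => norm_nonneg _) (fun n => ?_)
      tendsto_one_div_add_atTop_nhds_zero_nat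
    refine ContinuousLinearMap.opNorm_le_bound _ (by positivity) fun x => ?_
    have hb : ∀ i, ‖mn n i - m i‖ ≤ 1 / ((n : ℝ) + 1) := fun i => by
      by_cases h : i ∈ (hfin n).toFinset
      · simp only [mn, if_pos h, sub_self, norm_zero]; positivity
      · simp only [mn, if_neg h, zero_sub, norm_neg]
        simp only [Set.Finite.mem_toFinset, mem_ofPred_eq, not_not] at h
        exact h.le
    have : (b.diagonal (mn n) - b.diagonal m) x = b.diagonal (fun i => mn n i - m i) x :=
      b.ext_repr fun i => by
        rw [b.repr_diagonal hb, sub_apply, map_sub, lp.coeFn_sub, Pi.sub_apply,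
          b.repr_diagonal (hmn n), b.repr_diagonal hm]
        ring
    rw [this]
    exact ContinuousLinearMap.le_of_opNorm_le _ (b.norm_diagonal_le (by positivity) hb) x
  exact isCompactOperator_of_tendsto hT <| Eventually.of_forall fun n =>
    b.isCompactOperator_diagonal_of_finite (hmn n) (hfin n).toFinset fun i hi => by
      simp only [mn, if_neg hi]

end Diagonal

/-! ### A positive eigenvalue of a Hamiltonian pair -/

section Eigenvalue

variable {ι H : Type*} [NormedAddCommGroup H] [InnerProductSpace ℂ H] [CompleteSpace H]

/-- A nonnegative compact operator of norm one has the eigenvalue one. -/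
theorem exists_eq_self_of_norm_eq_one [Nontrivial H] {C : H →L[ℂ] H} (hC : 0 ≤ C)
    (hc : IsCompactOperator C) (h1 : ‖C‖ = 1) : ∃ g : H, g ≠ 0 ∧ C g = g := by
  -- The norm of a nonnegative element of a C⋆-algebra lies in its spectrum; for a compact operator
  -- a nonzero spectral value is an eigenvalue.
  have h := CStarAlgebra.norm_mem_spectrum_of_nonneg hC
  rw [h1] at h
  have h' : (1 : ℂ) ∈ spectrum ℂ C := by
    simpa using spectrum.algebraMap_mem ℂ h
  obtain ⟨g, hg⟩ := ((hc.hasEigenvalue_iff_mem_spectrum one_ne_zero).2 h').exists_hasEigenvector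
  exact ⟨g, hg.2, by simpa using hg.apply_eq_smul⟩

/-- `x ↦ x / (1 + l ^ 2 x ^ 2)` applied to `P`. -/
def regularize (P : H →L[ℂ] H) (l : ℝ) : H →L[ℂ] H :=
  cfc (fun x : ℝ => x / (1 + l ^ 2 * x ^ 2)) P

theorem continuous_regularizer (l : ℝ) : Continuous fun x : ℝ => x / (1 + l ^ 2 * x ^ 2) :=
  continuous_id.div (by fun_prop) fun x => by positivity

theorem regularize_nonneg {P : H →L[ℂ] H} (hP : 0 ≤ P) (l : ℝ) : 0 ≤ regularize P l :=
  cfc_nonneg fun x hx => by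
    have := spectrum_nonneg_of_nonneg hP hx
    positivity

/-- This and its mirror image `mul_regularize` identify the regularization as P(1 + l²P²)⁻¹,
formally (P⁻¹ + l²P)⁻¹, the operator left after one component of the Hamiltonian system is
eliminated. -/
theorem regularize_mul {P : H →L[ℂ] H} (hP : 0 ≤ P) (l : ℝ) :
    regularize P l * (1 + (l ^ 2) • (P * P)) = P := by
  have hsa : IsSelfAdjoint P := hP.isSelfAdjoint
  have h1 : (1 + (l ^ 2) • (P * P)) = cfc (fun x : ℝ => 1 + l ^ 2 * x ^ 2) P := by
    rw [cfc_add (a := P) (fun _ => (1 : ℝ)) (fun x : ℝ => l ^ 2 * x ^ 2),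
      cfc_const_mul (l ^ 2) (fun x : ℝ => x ^ 2) P, cfc_pow_id P 2, cfc_const_one ℝ P, pow_two P]
  rw [h1, regularize, ← cfc_mul _ _ P (continuous_regularizer l).continuousOn]
  conv_rhs => rw [← cfc_id ℝ P]
  refine cfc_congr fun x _ => ?_
  have : 1 + l ^ 2 * x ^ 2 ≠ 0 := by positivity
  simp only [id]
  field_simp

theorem mul_regularize {P : H →L[ℂ] H} (hP : 0 ≤ P) (l : ℝ) :
    (1 + (l ^ 2) • (P * P)) * regularize P l = P := by
  have hsa : IsSelfAdjoint P := hP.isSelfAdjoint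
  have h1 : Commute P (regularize P l) := (Commute.refl P).cfc_real _ |>.symm
  have h2 : Commute (1 + (l ^ 2) • (P * P)) (regularize P l) :=
    (Commute.one_left _).add_left ((h1.mul_left h1).smul_left _)
  rw [h2.eq, regularize_mul hP]

/-- On the spectrum x/(1 + l²x²) ≤ 1/(2l), which is (lx - 1)² ≥ 0. The bound does not involve P and
makes the norm small for large l. -/
theorem norm_regularize_le {P : H →L[ℂ] H} (hP : 0 ≤ P) {l : ℝ} (hl : 0 < l) :
    ‖regularize P l‖ ≤ 1 / (2 * l) := by
  refine norm_cfc_le (by positivity) fun x hx => ?_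
  have hx := spectrum_nonneg_of_nonneg hP hx
  rw [Real.norm_of_nonneg (by positivity), div_le_div_iff₀ (by positivity) (by positivity)]
  nlinarith [sq_nonneg (l * x - 1)]

/-- The functional calculus reduces this to scalars: the difference of two regularizers is at most
x³|m² - l²| for x in the spectrum, and there x ≤ ‖P‖. -/
theorem continuous_regularize [Nontrivial H] {P : H →L[ℂ] H} (hP : 0 ≤ P) : Continuous (regularize P) := by
  refine continuous_iff_continuousAt.2 fun l => ?_
  rw [ContinuousAt, tendsto_iff_norm_sub_tendsto_zero]
  have hlim : Tendsto (fun m : ℝ => ‖P‖ ^ 3 * |m ^ 2 - l ^ 2|) (𝓝 l) (𝓝 0) := by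
    have : Continuous fun m : ℝ => ‖P‖ ^ 3 * |m ^ 2 - l ^ 2| := by fun_prop
    simpa using this.tendsto l
  refine squeeze_zero (fun _ => norm_nonneg _) (fun m => ?_) hlim
  rw [regularize, regularize, ← cfc_sub _ _ P (continuous_regularizer m).continuousOn
    (continuous_regularizer l).continuousOn]
  refine norm_cfc_le (by positivity) fun x hx => ?_
  have hx0 := spectrum_nonneg_of_nonneg hP hx
  have hxP : x ≤ ‖P‖ := (le_abs_self x).trans (spectrum.norm_le_norm_of_mem hx)
  have h1 : x / (1 + m ^ 2 * x ^ 2) - x / (1 + l ^ 2 * x ^ 2)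
      = -(x ^ 3 * (m ^ 2 - l ^ 2)) / ((1 + m ^ 2 * x ^ 2) * (1 + l ^ 2 * x ^ 2)) := by
    field_simp
    ring
  have h2 : 1 ≤ (1 + m ^ 2 * x ^ 2) * (1 + l ^ 2 * x ^ 2) := by
    nlinarith [mul_nonneg (sq_nonneg m) (sq_nonneg x), mul_nonneg (sq_nonneg l) (sq_nonneg x),
      mul_nonneg (mul_nonneg (sq_nonneg m) (sq_nonneg x)) (mul_nonneg (sq_nonneg l) (sq_nonneg x))]
  rw [h1, norm_div, norm_neg, norm_mul, Real.norm_eq_abs (m ^ 2 - l ^ 2),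
    Real.norm_of_nonneg (by positivity : 0 ≤ x ^ 3), Real.norm_of_nonneg (by positivity)]
  refine (div_le_self (by positivity) h2).trans ?_
  gcongr

/-- If `P ≥ 0` is compact, `S` is self-adjoint and `P (S g) = k⁻¹ S g` with `k ‖g‖² < ‖S g‖²`, then
`(P⁻¹ - S²) v₁ = l v₂`, `P⁻¹ v₂ = -l v₁` has a solution with `l > 0` and `v₁ ≠ 0`. -/
theorem exists_eigenpair_of_compact {P S : H →L[ℂ] H} (hP : 0 ≤ P) (hPc : IsCompactOperator P)
    (hS : IsSelfAdjoint S) {g : H} {k : ℝ} (hk : 0 < k)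
    (hg : P (S g) = ((k⁻¹ : ℝ) : ℂ) • S g) (hlt : k * ‖g‖ ^ 2 < ‖S g‖ ^ 2) :
    ∃ l : ℝ, 0 < l ∧ ∃ v : H, v ≠ 0 ∧ v = P (S (S v) - ((l ^ 2 : ℝ) : ℂ) • P v) := by
  have hg0 : g ≠ 0 := by
    rintro rfl
    simp at hlt
  have : Nontrivial H := ⟨⟨g, 0, hg0⟩⟩
  have hgn : 0 < ‖g‖ := norm_pos_iff.2 hg0
  -- The aim is a fixed vector w of S R(l) S with l > 0, where R(l) denotes the regularization; then
  -- v = R(l)Sw solves the equation. It suffices that the norm of S R(l) S equals one.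
  have hcont : Continuous fun l => ‖S * regularize P l * S‖ :=
    ((continuous_const.mul (continuous_regularize hP)).mul continuous_const).norm
  -- a small value of `l` at which the norm exceeds one
  have hbig : ∀ l : ℝ, k⁻¹ / (1 + l ^ 2 * k⁻¹ ^ 2) * ‖S g‖ ^ 2
      ≤ ‖S * regularize P l * S‖ * ‖g‖ ^ 2 := fun l => by
    -- As S g is an eigenvector of P, it is one of R(l), with the scalar regularizer evaluated at
    -- k⁻¹. The quadratic form of S R(l) S at g is therefore explicit.
    have h1 : regularize P l (S g) = ((k⁻¹ / (1 + l ^ 2 * k⁻¹ ^ 2) : ℝ) : ℂ) • S g := by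
      have h2 := congrArg (fun T : H →L[ℂ] H => T (S g)) (regularize_mul hP l)
      have h3 : (1 + (l ^ 2) • (P * P)) (S g) = ((1 + l ^ 2 * k⁻¹ ^ 2 : ℝ) : ℂ) • S g := by
        change S g + (l ^ 2) • P (P (S g)) = _
        rw [hg, map_smul, hg, ← Complex.coe_smul]
        push_cast
        module
      change regularize P l ((1 + (l ^ 2) • (P * P)) (S g)) = P (S g) at h2
      rw [h3, map_smul, hg] at h2
      have h4 : ((1 + l ^ 2 * k⁻¹ ^ 2 : ℝ) : ℂ) ≠ 0 := by
        exact_mod_cast (by positivity : (1 + l ^ 2 * k⁻¹ ^ 2 : ℝ) ≠ 0)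
      rw [Complex.ofReal_div, div_eq_inv_mul, mul_smul, ← h2, smul_smul, inv_mul_cancel₀ h4,
        one_smul]
    have h5 : ‖inner ℂ ((S * regularize P l * S) g) g‖
        = k⁻¹ / (1 + l ^ 2 * k⁻¹ ^ 2) * ‖S g‖ ^ 2 := by
      have h6 : inner ℂ ((S * regularize P l * S) g) g = inner ℂ (regularize P l (S g)) (S g) :=
        (ContinuousLinearMap.isSelfAdjoint_iff_isSymmetric.1 hS) _ _
      rw [h6, h1, inner_smul_left, inner_self_eq_norm_sq_to_K, norm_mul, RCLike.norm_conj,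
        Complex.norm_real, Real.norm_of_nonneg (by positivity)]
      simp
    rw [← h5]
    calc _ ≤ ‖(S * regularize P l * S) g‖ * ‖g‖ := norm_inner_le_norm _ _
      _ ≤ ‖S * regularize P l * S‖ * ‖g‖ * ‖g‖ := by
        gcongr
        exact ContinuousLinearMap.le_opNorm _ _
      _ = _ := by ring
  obtain ⟨l₀, hl₀, hl₀'⟩ : ∃ l₀ : ℝ, 0 < l₀ ∧ 1 ≤ ‖S * regularize P l₀ * S‖ := by
    have hc : Continuous fun l : ℝ => k⁻¹ / (1 + l ^ 2 * k⁻¹ ^ 2) * ‖S g‖ ^ 2 :=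
      (continuous_const.div (by fun_prop) fun l => by positivity).mul continuous_const
    have h0 : ‖g‖ ^ 2 < k⁻¹ / (1 + (0 : ℝ) ^ 2 * k⁻¹ ^ 2) * ‖S g‖ ^ 2 := by
      have : ‖g‖ ^ 2 < k⁻¹ * ‖S g‖ ^ 2 := by
        rw [inv_mul_eq_div, lt_div_iff₀ hk]
        linarith
      simpa using this
    have hev : ∀ᶠ l in 𝓝[>] (0 : ℝ), ‖g‖ ^ 2 < k⁻¹ / (1 + l ^ 2 * k⁻¹ ^ 2) * ‖S g‖ ^ 2 :=
      nhdsWithin_le_nhds ((hc.tendsto 0).eventually (lt_mem_nhds h0))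
    obtain ⟨l, hl, hl0⟩ := (hev.and self_mem_nhdsWithin).exists
    refine ⟨l, hl0, ?_⟩
    have := hl.le.trans (hbig l)
    by_contra hcon
    push Not at hcon
    nlinarith [mul_lt_mul_of_pos_right hcon (pow_pos hgn 2)]
  -- The bound ‖S‖²/(2l) is at most 1/2 once l ≥ ‖S‖²; the maximum with l₀ gives an interval for the
  -- intermediate value theorem.
  obtain ⟨l₁, hl₁, hl₁'⟩ : ∃ l₁ : ℝ, l₀ ≤ l₁ ∧ ‖S * regularize P l₁ * S‖ ≤ 1 := by
    refine ⟨max l₀ (‖S‖ * ‖S‖), le_max_left _ _, ?_⟩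
    have hm : 0 < max l₀ (‖S‖ * ‖S‖) := lt_max_of_lt_left hl₀
    calc _ ≤ ‖S‖ * ‖regularize P (max l₀ (‖S‖ * ‖S‖))‖ * ‖S‖ :=
          (norm_mul_le _ _).trans (mul_le_mul_of_nonneg_right (norm_mul_le _ _) (norm_nonneg _))
      _ ≤ ‖S‖ * (1 / (2 * max l₀ (‖S‖ * ‖S‖))) * ‖S‖ := by
          gcongr
          exact norm_regularize_le hP hm
      _ = (‖S‖ * ‖S‖) / (2 * max l₀ (‖S‖ * ‖S‖)) := by ring
      _ ≤ 1 := by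
          rw [div_le_one (by positivity)]
          linarith [le_max_right l₀ (‖S‖ * ‖S‖)]
  obtain ⟨l, ⟨hl, -⟩, hl1⟩ := intermediate_value_Icc' hl₁ hcont.continuousOn ⟨hl₁', hl₀'⟩
  have hlpos : 0 < l := hl₀.trans_le hl
  -- R(l) = P - l²P(P R(l)) is a combination of compact operators.
  have hRc : IsCompactOperator (regularize P l) := by
    have h : regularize P l = P - (l ^ 2) • (P * (P * regularize P l)) := by
      have := mul_regularize hP l
      rw [add_mul, one_mul, smul_mul_assoc, mul_assoc] at this
      exact eq_sub_of_add_eq this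
    rw [h]
    exact hPc.sub ((hPc.comp_clm (P * regularize P l)).smul (l ^ 2))
  have hCc : IsCompactOperator (S * regularize P l * S : H →L[ℂ] H) :=
    (hRc.clm_comp S).comp_clm S
  have hCn : 0 ≤ S * regularize P l * S :=
    hS.conjugate_nonneg (regularize_nonneg hP l)
  obtain ⟨w, hw, hCw⟩ := exists_eq_self_of_norm_eq_one hCn hCc hl1
  refine ⟨l, hlpos, regularize P l (S w), ?_, ?_⟩
  · intro h0
    apply hw
    rw [← hCw]
    change S (regularize P l (S w)) = 0
    rw [h0, map_zero]
  -- With v = R(l)Sw one has Sv = w, so (1 + l²P²)v = PSw = PS²v, which is the claim.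
  · have hSv : S (regularize P l (S w)) = w := hCw
    have h := congrArg (fun T : H →L[ℂ] H => T (S w)) (mul_regularize hP l)
    change regularize P l (S w) + (l ^ 2) • P (P (regularize P l (S w))) = P (S w) at h
    rw [hSv, map_sub, map_smul, ← h, Complex.coe_smul, add_sub_cancel_right]

end Eigenvalue

/-! ### Compact inverse of a diagonal operator plus a bounded perturbation, and the unstable pair -/

section Resolvent

variable {ι H : Type*} [NormedAddCommGroup H] [InnerProductSpace ℂ H] [CompleteSpace H]

omit [CompleteSpace H] in
-- Here T is D^(-1/2). Putting x = Ty turns the lower bound for D + V into coercivity of 1 + TVT in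
-- y itself, not merely in Ty; the latter would not give invertibility, since T may be compact.
theorem HilbertBasis.coercive_of_form (b : HilbertBasis ι ℂ H) {ν τ : ι → ℝ} {k : ℝ}
    (hk : 0 < k) (hτpos : ∀ i, 0 < τ i) (hτν : ∀ i, ν i * (τ i * τ i) = 1) {V T : H →L[ℂ] H}
    (hTr : ∀ x i, b.repr (T x) i = τ i * b.repr x i)
    (hpos : ∀ (s : Finset ι) (c : ι → ℂ), k * ∑ i ∈ s, ‖c i‖ ^ 2 ≤ ∑ i ∈ s, ν i * ‖c i‖ ^ 2
      + (inner ℂ (V (∑ i ∈ s, c i • b i)) (∑ i ∈ s, c i • b i)).re) (y : H) :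
    k / (k + ‖V‖) * ‖y‖ ^ 2 ≤ ‖y‖ ^ 2 + (inner ℂ (V (T y)) (T y)).re := by
  classical
  have hkV : 0 < k + ‖V‖ := by positivity
  -- Both sides are continuous in y, so the partial sums of the basis expansion suffice. This is why
  -- the form hypothesis is needed only for finite sums.
  have hclosed : IsClosed {y : H | k / (k + ‖V‖) * ‖y‖ ^ 2 ≤ ‖y‖ ^ 2 + (inner ℂ (V (T y)) (T y)).re} :=
    isClosed_le (by fun_prop) (.add (by fun_prop) (Complex.continuous_re.comp (by fun_prop)))
  refine hclosed.mem_of_tendsto (b.hasSum_repr y) (Eventually.of_forall fun s => ?_)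
  set z := ∑ i ∈ s, b.repr y i • b i with hz
  have hTb : ∀ i, T (b i) = (τ i : ℂ) • b i := fun i => b.ext_repr fun j => by
    rw [hTr, map_smul, b.repr_self, lp.coeFn_smul, Pi.smul_apply, lp.single_apply, smul_eq_mul]
    by_cases h : i = j
    · subst h; simp
    · simp [Pi.single_eq_of_ne (Ne.symm h)]
  have hTz : T z = ∑ i ∈ s, (τ i * b.repr y i) • b i := by
    rw [hz, map_sum]
    refine Finset.sum_congr rfl fun i _ => ?_
    rw [map_smul, hTb, smul_smul, mul_comm]
  have hnorm : ∀ c : ι → ℂ, ‖∑ i ∈ s, c i • b i‖ ^ 2 = ∑ i ∈ s, ‖c i‖ ^ 2 := fun c => by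
    have h1 := b.orthonormal.inner_sum c c s
    rw [inner_self_eq_norm_sq_to_K] at h1
    have h2 : ∀ i, starRingEnd ℂ (c i) * c i = ((‖c i‖ ^ 2 : ℝ) : ℂ) := fun i => by
      rw [mul_comm, Complex.mul_conj, Complex.normSq_eq_norm_sq]
    simp only [h2] at h1
    rw [← Complex.ofReal_inj]
    push_cast at h1 ⊢
    exact h1
  have h1 := hpos s fun i => τ i * b.repr y i
  rw [← hTz] at h1
  have h2 : ∑ i ∈ s, ν i * ‖(τ i : ℂ) * b.repr y i‖ ^ 2 = ‖z‖ ^ 2 := by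
    rw [hz, hnorm]
    refine Finset.sum_congr rfl fun i _ => ?_
    rw [norm_mul, Complex.norm_real, Real.norm_of_nonneg (hτpos i).le, mul_pow, ← mul_assoc, sq,
      hτν, one_mul]
  have h3 : ∑ i ∈ s, ‖(τ i : ℂ) * b.repr y i‖ ^ 2 = ‖T z‖ ^ 2 := by rw [hTz, hnorm]
  rw [h2, h3] at h1
  have h4 : -(‖V‖ * ‖T z‖ ^ 2) ≤ (inner ℂ (V (T z)) (T z)).re := by
    have h5 := (Complex.abs_re_le_norm (inner ℂ (V (T z)) (T z))).trans (norm_inner_le_norm _ _)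
    have h6 := mul_le_mul_of_nonneg_right (V.le_opNorm (T z)) (norm_nonneg (T z))
    have := neg_abs_le (inner ℂ (V (T z)) (T z)).re
    nlinarith
  change k / (k + ‖V‖) * ‖z‖ ^ 2 ≤ ‖z‖ ^ 2 + (inner ℂ (V (T z)) (T z)).re
  -- Let q be the form on the right. Then q ≥ k‖Tz‖² by hypothesis and q ≥ ‖z‖² - ‖V‖‖Tz‖²
  -- trivially; adding ‖V‖ times the first to k times the second cancels ‖Tz‖².
  rw [div_mul_eq_mul_div, div_le_iff₀ hkV]
  nlinarith [mul_le_mul_of_nonneg_left h1 (norm_nonneg V), mul_le_mul_of_nonneg_left h4 hk.le]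

/-- Coercivity makes N a unit, as in the Lax–Milgram theorem. The inverse M is nonnegative since ⟨x,
Mx⟩ equals the form of N at Mx. -/
theorem exists_inverse_of_coercive {N : H →L[ℂ] H} (hNsa : IsSelfAdjoint N) {δ : ℝ}
    (hδpos : 0 < δ) (hcoer : ∀ y, δ * ‖y‖ ^ 2 ≤ (inner ℂ (N y) y).re) :
    ∃ M : H →L[ℂ] H, 0 ≤ M ∧ (∀ x, N (M x) = x) ∧ ∀ x, M (N x) = x := by
  have hNu : IsUnit N :=
    ContinuousLinearMap.isUnit_of_forall_le_norm_inner_map N (c := ⟨δ, hδpos.le⟩) hδpos fun x => by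
      rw [mul_comm]
      exact (hcoer x).trans (Complex.re_le_norm _)
  obtain ⟨M, hNM, hMN⟩ := isUnit_iff_exists.1 hNu
  have hNMa : ∀ x, N (M x) = x := fun x => congrArg (fun A : H →L[ℂ] H => A x) hNM
  have hMNa : ∀ x, M (N x) = x := fun x => congrArg (fun A : H →L[ℂ] H => A x) hMN
  refine ⟨M, ?_, hNMa, hMNa⟩
  rw [ContinuousLinearMap.nonneg_iff_isPositive, ContinuousLinearMap.isPositive_def]
  have hsym := ContinuousLinearMap.isSelfAdjoint_iff_isSymmetric.1 hNsa
  refine ⟨fun x y => ?_, fun x => ?_⟩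
  · have := hsym (M x) (M y)
    change inner ℂ (N (M x)) (M y) = inner ℂ (M x) (N (M y)) at this
    rw [hNMa, hNMa] at this
    exact this.symm
  · have h1 := hcoer (M x)
    rw [hNMa] at h1
    have h2 : 0 ≤ RCLike.re (inner ℂ x (M x)) := le_trans (by positivity) h1
    rwa [← inner_re_symm] at h2

/-- If `D` is the diagonal operator with entries `ν i → ∞`, `V` is bounded and self-adjoint and
`D + V ≥ k > 0`, then `D + V` has a nonnegative compact inverse. -/
theorem HilbertBasis.exists_compact_inverse (b : HilbertBasis ι ℂ H) {ν : ι → ℝ} {k : ℝ}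
    (hk : 0 < k) (hν : ∀ i, k ≤ ν i) (hν' : Tendsto ν cofinite atTop) {V : H →L[ℂ] H}
    (hV : IsSelfAdjoint V)
    (hpos : ∀ (s : Finset ι) (c : ι → ℂ), k * ∑ i ∈ s, ‖c i‖ ^ 2 ≤ ∑ i ∈ s, ν i * ‖c i‖ ^ 2
      + (inner ℂ (V (∑ i ∈ s, c i • b i)) (∑ i ∈ s, c i • b i)).re) :
    ∃ P : H →L[ℂ] H, 0 ≤ P ∧ IsCompactOperator P ∧
      ∀ f v, v = P f ↔ ∀ i, (ν i : ℂ) * b.repr v i + b.repr (V v) i = b.repr f i := by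
  have hν0 : ∀ i, 0 < ν i := fun i => hk.trans_le (hν i)
  have hsq : ∀ i, 0 < √(ν i) := fun i => Real.sqrt_pos.2 (hν0 i)
  set τ : ι → ℝ := fun i => (√(ν i))⁻¹ with hτ
  have hτpos : ∀ i, 0 < τ i := fun i => inv_pos.2 (hsq i)
  have hτν : ∀ i, ν i * (τ i * τ i) = 1 := fun i => by
    have := Real.mul_self_sqrt (hν0 i).le
    have h := (hsq i).ne'
    simp only [hτ]
    field_simp
    rw [sq, this]
  have hτb : ∀ i, ‖((τ i : ℝ) : ℂ)‖ ≤ (√k)⁻¹ := fun i => by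
    rw [Complex.norm_real, Real.norm_of_nonneg (hτpos i).le]
    exact inv_anti₀ (Real.sqrt_pos.2 hk) (Real.sqrt_le_sqrt (hν i))
  have hτ0 : Tendsto (fun i => ((τ i : ℝ) : ℂ)) cofinite (𝓝 0) := by
    have h1 : Tendsto τ cofinite (𝓝 0) :=
      tendsto_inv_atTop_zero.comp (Real.tendsto_sqrt_atTop.comp hν')
    exact_mod_cast (Complex.continuous_ofReal.tendsto 0).comp h1
  obtain ⟨T, hTr, hTsa, hTc⟩ : ∃ T : H →L[ℂ] H, (∀ x i, b.repr (T x) i = τ i * b.repr x i) ∧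
      IsSelfAdjoint T ∧ IsCompactOperator T :=
    ⟨b.diagonal fun i => (τ i : ℂ), b.repr_diagonal hτb, b.isSelfAdjoint_diagonal hτb,
      b.isCompactOperator_diagonal hτb hτ0⟩
  obtain ⟨N, hNsa, hNap⟩ : ∃ N : H →L[ℂ] H, IsSelfAdjoint N ∧ ∀ y, N y = y + T (V (T y)) :=
    ⟨1 + T * V * T, (IsSelfAdjoint.one _).add (hV.conjugate_self hTsa), fun _ => rfl⟩
  have hinner : ∀ y, (inner ℂ (N y) y).re = ‖y‖ ^ 2 + (inner ℂ (V (T y)) (T y)).re := fun y => by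
    have h1 : inner ℂ (T (V (T y))) y = inner ℂ (V (T y)) (T y) :=
      (ContinuousLinearMap.isSelfAdjoint_iff_isSymmetric.1 hTsa) _ _
    rw [hNap, inner_add_left, Complex.add_re, h1, inner_self_eq_norm_sq_to_K]
    norm_cast
  have hδpos : 0 < k / (k + ‖V‖) := by positivity
  have hcoer : ∀ y, k / (k + ‖V‖) * ‖y‖ ^ 2 ≤ (inner ℂ (N y) y).re := fun y => by
    rw [hinner]
    exact b.coercive_of_form hk hτpos hτν hTr hpos y
  obtain ⟨M, hMpos, hNMa, hMNa⟩ := exists_inverse_of_coercive hNsa hδpos hcoer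
  refine ⟨T * M * T, hTsa.conjugate_nonneg hMpos, hTc.comp_clm (M * T), fun f v => ⟨?_, fun h => ?_⟩⟩
  · rintro rfl i
    set y := M (T f) with hy
    have hv : (T * M * T) f = T y := rfl
    have h1 : y + T (V (T y)) = T f := by rw [← hNap, hy, hNMa]
    have h2 := congrArg (fun w => b.repr w i) h1
    simp only [map_add, lp.coeFn_add, Pi.add_apply, hTr] at h2
    rw [hv, hTr]
    have h3 : (ν i : ℂ) * (τ i * τ i) = 1 := by exact_mod_cast hτν i
    have h4 : (τ i : ℂ) ≠ 0 := by exact_mod_cast (hτpos i).ne'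
    apply mul_left_cancel₀ h4
    rw [← h2]
    linear_combination (b.repr y i) * h3
  -- The coefficient equation says Dv = f - Vv = u, hence T²u = v. Then (1 + TVT)Tu = Tf determines
  -- Tu, and with it v.
  · set u := f - V v with hu
    have h1 : T (T u) = v := b.ext_repr fun i => by
      have h3 : (ν i : ℂ) * (τ i * τ i) = 1 := by exact_mod_cast hτν i
      rw [hTr, hTr, hu, map_sub, lp.coeFn_sub, Pi.sub_apply, ← h i]
      linear_combination (b.repr v i) * h3
    have h2 : N (T u) = T f := by
      rw [hNap, h1, ← map_add, hu, sub_add_cancel]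
    change v = T (M (T f))
    rw [← h2, hMNa, h1]

/-- Existence of an unstable eigenvalue for the Hamiltonian system with the two operators `D + V`
and `D + V - S²`, where `D` is diagonal. -/
theorem HilbertBasis.exists_unstable_pair (b : HilbertBasis ι ℂ H) {ν : ι → ℝ} {k : ℝ}
    (hk : 0 < k) (hν : ∀ i, k ≤ ν i) (hν' : Tendsto ν cofinite atTop) {V S : H →L[ℂ] H}
    (hV : IsSelfAdjoint V) (hS : IsSelfAdjoint S)
    (hpos : ∀ (s : Finset ι) (c : ι → ℂ), k * ∑ i ∈ s, ‖c i‖ ^ 2 ≤ ∑ i ∈ s, ν i * ‖c i‖ ^ 2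
      + (inner ℂ (V (∑ i ∈ s, c i • b i)) (∑ i ∈ s, c i • b i)).re)
    {g : H} (hg : ∀ i, (ν i : ℂ) * b.repr (S g) i + b.repr (V (S g)) i = k * b.repr (S g) i)
    (hlt : k * ‖g‖ ^ 2 < ‖S g‖ ^ 2) :
    ∃ l : ℝ, 0 < l ∧ ∃ v₁ v₂ : H, v₁ ≠ 0 ∧
      (∀ i, (ν i : ℂ) * b.repr v₂ i + b.repr (V v₂) i = -l * b.repr v₁ i) ∧
      ∀ i, (ν i : ℂ) * b.repr v₁ i + b.repr (V v₁) i - b.repr (S (S v₁)) i = l * b.repr v₂ i := by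
  obtain ⟨P, hP, hPc, hPi⟩ := b.exists_compact_inverse hk hν hν' hV hpos
  have hk0 : (k : ℂ) ≠ 0 := by exact_mod_cast hk.ne'
  have hPg : P (S g) = ((k⁻¹ : ℝ) : ℂ) • S g := by
    have h1 : S g = P ((k : ℂ) • S g) := (hPi _ _).2 fun i => by
      rw [hg, map_smul, lp.coeFn_smul, Pi.smul_apply, smul_eq_mul]
    rw [map_smul] at h1
    conv_rhs => rw [h1]
    rw [smul_smul, Complex.ofReal_inv, inv_mul_cancel₀ hk0, one_smul]
  obtain ⟨l, hl, v, hv, hvP⟩ := exists_eigenpair_of_compact hP hPc hS hk hPg hlt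
  -- The first equation (D + V)v₂ = -l v₁ forces v₂ = -lPv₁; the second is then the fixed point
  -- equation for v₁.
  refine ⟨l, hl, v, -(l : ℂ) • P v, hv, fun i => ?_, fun i => ?_⟩
  · have h1 : -(l : ℂ) • P v = P (-(l : ℂ) • v) := by rw [map_smul]
    rw [(hPi _ _).1 h1 i, map_smul, lp.coeFn_smul, Pi.smul_apply, smul_eq_mul]
  · rw [(hPi _ _).1 hvP i, map_sub, map_smul, map_smul, lp.coeFn_sub, lp.coeFn_smul, lp.coeFn_smul,
      Pi.sub_apply, Pi.smul_apply, Pi.smul_apply, smul_eq_mul, smul_eq_mul]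
    push_cast
    ring

end Resolvent

/-! ### Bounded perturbations of bounded groups -/

section Perturbation

variable {X : Type*} [NormedAddCommGroup X] [NormedSpace ℂ X]

/-- Strong continuity alone does not allow a moving argument; the uniform bound controls the change
of u. It is what makes the Dyson integrands continuous although F need not be norm continuous. -/
theorem continuous_apply_of_strongly_continuous {F : ℝ → X →L[ℂ] X} {K : ℝ}
    (hF : ∀ x, Continuous fun t => F t x) (hK : ∀ t, ‖F t‖ ≤ K) {u : ℝ → X} (hu : Continuous u) :
    Continuous fun t => F t (u t) := by
  refine continuous_iff_continuousAt.2 fun t₀ => ?_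
  rw [ContinuousAt, tendsto_iff_norm_sub_tendsto_zero]
  have h1 : Tendsto (fun t => K * ‖u t - u t₀‖ + ‖F t (u t₀) - F t₀ (u t₀)‖) (𝓝 t₀) (𝓝 0) := by
    have : Continuous fun t => K * ‖u t - u t₀‖ + ‖F t (u t₀) - F t₀ (u t₀)‖ := by
      have := hF (u t₀)
      fun_prop
    simpa using this.tendsto t₀
  refine squeeze_zero (fun _ => norm_nonneg _) (fun t => ?_) h1
  calc ‖F t (u t) - F t₀ (u t₀)‖ = ‖F t (u t - u t₀) + (F t (u t₀) - F t₀ (u t₀))‖ := by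
        rw [map_sub]; congr 1; abel
    _ ≤ ‖F t (u t - u t₀)‖ + ‖F t (u t₀) - F t₀ (u t₀)‖ := norm_add_le _ _
    _ ≤ _ := by
        gcongr
        exact (F t).le_of_opNorm_le (hK t) _

/-- Successive terms of the Dyson series. -/
def dysonTerm (F : ℝ → X →L[ℂ] X) (x : X) : ℕ → ℝ → X
  | 0 => fun _ => x
  | n + 1 => fun t => ∫ s in (0 : ℝ)..t, F s (dysonTerm F x n s)

variable {F : ℝ → X →L[ℂ] X} {K : ℝ}

/-- Each integration raises the power of |t| by one and supplies the next factor of the factorial,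
so the Dyson series is dominated by the exponential series at every time. -/
theorem norm_dysonTerm_le (hK : ∀ t, ‖F t‖ ≤ K)
    (x : X) (n : ℕ) (t : ℝ) : ‖dysonTerm F x n t‖ ≤ (K * |t|) ^ n / n.factorial * ‖x‖ := by
  have hK0 : 0 ≤ K := (norm_nonneg _).trans (hK 0)
  induction n generalizing t with
  | zero => simp [dysonTerm]
  | succ n ih =>
    have h1 : ∀ s, ‖F s (dysonTerm F x n s)‖ ≤ K ^ (n + 1) / n.factorial * ‖x‖ * |s - 0| ^ n :=
      fun s => by
        refine ((F s).le_of_opNorm_le_of_le (hK s) (ih s)).trans (le_of_eq ?_)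
        rw [mul_pow, sub_zero, pow_succ]
        ring
    calc ‖dysonTerm F x (n + 1) t‖ ≤ ∫ s in uIoc 0 t, ‖F s (dysonTerm F x n s)‖ :=
          intervalIntegral.norm_integral_le_integral_norm_uIoc
      _ ≤ ∫ s in uIoc 0 t, K ^ (n + 1) / n.factorial * ‖x‖ * |s - 0| ^ n := by
          refine integral_mono_of_nonneg (Eventually.of_forall fun s => norm_nonneg _) ?_
            (Eventually.of_forall h1)
          exact (Continuous.integrableOn_uIcc (by fun_prop)).mono_set uIoc_subset_uIcc
      _ = (K * |t|) ^ (n + 1) / (n + 1).factorial * ‖x‖ := by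
          rw [integral_const_mul, integral_pow_abs_sub_uIoc, sub_zero, Nat.factorial_succ, mul_pow]
          push_cast
          have : (n.factorial : ℝ) ≠ 0 := by positivity
          field_simp

variable [CompleteSpace X]

omit [CompleteSpace X] in
theorem continuous_dysonTerm (hF : ∀ x, Continuous fun t => F t x) (hK : ∀ t, ‖F t‖ ≤ K) (x : X)
    (n : ℕ) : Continuous (dysonTerm F x n) := by
  induction n with
  | zero => exact continuous_const
  | succ n ih =>
    exact intervalIntegral.continuous_primitive
      (fun a b => (continuous_apply_of_strongly_continuous hF hK ih).intervalIntegrable a b) 0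

theorem hasDerivAt_dysonTerm (hF : ∀ x, Continuous fun t => F t x) (hK : ∀ t, ‖F t‖ ≤ K) (x : X)
    (n : ℕ) (t : ℝ) : HasDerivAt (dysonTerm F x (n + 1)) (F t (dysonTerm F x n t)) t :=
  (continuous_apply_of_strongly_continuous hF hK
    (continuous_dysonTerm hF hK x n)).integral_hasStrictDerivAt 0 t |>.hasDerivAt

/-- Global solvability of `u' = F(t) u` for bounded, strongly continuous `F`. -/
theorem exists_linear_ode_solution (hF : ∀ x, Continuous fun t => F t x) (hK : ∀ t, ‖F t‖ ≤ K)
    (x : X) : ∃ u : ℝ → X, u 0 = x ∧ (∀ t, HasDerivAt u (F t (u t)) t) ∧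
      ∀ t, ‖u t‖ ≤ exp (K * |t|) * ‖x‖ := by
  have hK0 : 0 ≤ K := (norm_nonneg _).trans (hK 0)
  have hexp : ∀ r : ℝ, HasSum (fun n : ℕ => r ^ n / n.factorial * ‖x‖) (exp r * ‖x‖) := fun r => by
    have := NormedSpace.expSeries_div_hasSum_exp (𝔸 := ℝ) r
    rw [← Real.exp_eq_exp_ℝ] at this
    exact this.mul_right _
  have hsum : ∀ t, Summable fun n => dysonTerm F x n t := fun t =>
    Summable.of_norm_bounded (hexp (K * |t|)).summable fun n => norm_dysonTerm_le hK x n t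
  refine ⟨fun t => ∑' n, dysonTerm F x n t, ?_, fun t => ?_, fun t => ?_⟩
  · simp only
    rw [(hsum 0).tsum_eq_zero_add]
    simp [dysonTerm]
  · have hder : HasDerivAt (fun t => ∑' n, dysonTerm F x (n + 1) t)
        (∑' n, F t (dysonTerm F x n t)) t := by
      have hball : t ∈ Metric.ball (0 : ℝ) (|t| + 1) := by
        rw [mem_ball_zero_iff, Real.norm_eq_abs]; linarith
      refine hasDerivAt_tsum_of_isPreconnected
        (u := fun n : ℕ => K * ((K * (|t| + 1)) ^ n / n.factorial * ‖x‖))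
        ((hexp _).summable.mul_left K) Metric.isOpen_ball
        (convex_ball _ _).isPreconnected (fun n y _ => hasDerivAt_dysonTerm hF hK x n y)
        (fun n y hy => ?_) hball ((summable_nat_add_iff 1).2 (hsum t)) hball
      rw [mem_ball_zero_iff, Real.norm_eq_abs] at hy
      refine ((F y).le_of_opNorm_le_of_le (hK y) (norm_dysonTerm_le hK x n y)).trans ?_
      gcongr
    have h2 : (fun t => ∑' n, dysonTerm F x n t) = fun t => x + ∑' n, dysonTerm F x (n + 1) t := by
      funext s
      rw [(hsum s).tsum_eq_zero_add]
      rfl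
    rw [h2]
    convert hder.const_add x using 1
    rw [← (F t).map_tsum (hsum t), (hsum t).tsum_eq_zero_add]
    rfl
  · exact tsum_of_norm_bounded (hexp (K * |t|)) fun n => norm_dysonTerm_le hK x n t

omit [CompleteSpace X] in
theorem linear_ode_unique (hK : ∀ t, ‖F t‖ ≤ K) {u v : ℝ → X}
    (hu : ∀ t, HasDerivAt u (F t (u t)) t) (hv : ∀ t, HasDerivAt v (F t (v t)) t)
    (h0 : u 0 = v 0) : u = v := by
  have hK0 : 0 ≤ K := (norm_nonneg _).trans (hK 0)
  refine ODE_solution_unique_univ (v := fun t x => F t x) (s := fun _ => univ) (K := ⟨K, hK0⟩)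
    (t₀ := 0) (fun t => ?_) (fun t => ⟨hu t, mem_univ _⟩) (fun t => ⟨hv t, mem_univ _⟩) h0
  exact ((F t).lipschitz.weaken (hK t)).lipschitzOnWith

/-- The evolution operators of `u' = F(t) u`. -/
theorem exists_evolution (hF : ∀ x, Continuous fun t => F t x) (hK : ∀ t, ‖F t‖ ≤ K) :
    ∃ U : ℝ → X →L[ℂ] X, (∀ x, U 0 x = x) ∧
      ∀ x t, HasDerivAt (fun s => U s x) (F t (U t x)) t := by
  choose u hu0 hu hub using exists_linear_ode_solution (X := X) hF hK
  -- Linearity in the initial value follows from uniqueness: sums and multiples of solutions are the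
  -- solutions with the corresponding initial values.
  let L : ℝ → X →ₗ[ℂ] X := fun t =>
    { toFun := fun x => u x t
      map_add' := fun x y => congrFun (linear_ode_unique hK (hu (x + y)) (v := fun t => u x t + u y t)
        (fun t => by rw [map_add]; exact (hu x t).add (hu y t)) (by simp only [hu0])) t
      map_smul' := fun c x => congrFun (linear_ode_unique hK (hu (c • x)) (v := fun t => c • u x t)
        (fun t => by rw [map_smul]; exact (hu x t).const_smul c) (by simp only [hu0])) t }
  exact ⟨fun t => (L t).mkContinuous _ fun x => hub x t, hu0, hu⟩

/-- A bounded perturbation of a bounded strongly continuous group generates a `C₀` semigroup. -/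
theorem exists_perturbed_semigroup {G : ℝ → X →L[ℂ] X} {M : ℝ} (hG0 : ∀ x, G 0 x = x)
    (hGadd : ∀ s t x, G (s + t) x = G s (G t x)) (hGM : ∀ t, ‖G t‖ ≤ M)
    (hGc : ∀ x, Continuous fun t => G t x) (B : X →L[ℂ] X) :
    ∃ S : C0Semigroup X, (∀ x, Continuous fun t => S.toFun t x) ∧ ∀ v w : X,
      Tendsto (fun h : ℝ => ((h⁻¹ : ℝ) : ℂ) • (S.toFun h v - v)) (𝓝[>] 0) (𝓝 w) ↔
      Tendsto (fun h : ℝ => ((h⁻¹ : ℝ) : ℂ) • (G h v - v)) (𝓝[>] 0) (𝓝 (w - B v)) := by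
  have hM0 : 0 ≤ M := (norm_nonneg _).trans (hGM 0)
  -- Interaction picture: with S(t) = G(t)U(t), the equation S' = (A₀ + B)S, where A₀ is the
  -- generator of G, becomes U' = F(t)U. The unbounded A₀ has disappeared.
  set F : ℝ → X →L[ℂ] X := fun t => (G (-t)).comp (B.comp (G t)) with hFdef
  have hF : ∀ x, Continuous fun t => F t x := fun x =>
    continuous_apply_of_strongly_continuous (F := fun t => G (-t))
      (fun x => (hGc x).comp continuous_neg) (fun t => hGM _) (B.continuous.comp (hGc x))
  have hK : ∀ t, ‖F t‖ ≤ M * (‖B‖ * M) := fun t => by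
    refine (ContinuousLinearMap.opNorm_comp_le _ _).trans ?_
    refine mul_le_mul (hGM _) ?_ (norm_nonneg _) hM0
    exact (ContinuousLinearMap.opNorm_comp_le _ _).trans
      (mul_le_mul_of_nonneg_left (hGM _) (norm_nonneg _))
  obtain ⟨U, hU0, hU⟩ := exists_evolution hF hK
  have hinv : ∀ t x, G t (G (-t) x) = x := fun t x => by rw [← hGadd, add_neg_cancel, hG0]
  have hinv' : ∀ t x, G (-t) (G t x) = x := fun t x => by rw [← hGadd, neg_add_cancel, hG0]
  -- This cocycle identity is the semigroup law for G(t)U(t). As functions of s both sides solve u'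
  -- = F(s + t)u with the same value at s = 0.
  have hUadd : ∀ t x s, U (s + t) x = G (-t) (U s (G t (U t x))) := fun t x s => by
    refine congrFun (linear_ode_unique (F := fun s => F (s + t)) (fun s => hK (s + t))
      (u := fun s => U (s + t) x) (v := fun s => G (-t) (U s (G t (U t x)))) (fun s => ?_)
      (fun s => ?_) ?_) s
    · exact (hU x (s + t)).comp_add_const s t
    · have h1 := ((G (-t)).restrictScalars ℝ).hasFDerivAt.comp_hasDerivAt s (hU (G t (U t x)) s)
      refine HasDerivAt.congr_deriv h1 ?_
      change G (-t) (G (-s) (B (G s _))) = G (-(s + t)) (B (G (s + t) (G (-t) _)))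
      rw [hGadd s t, hinv, ← hGadd (-t) (-s)]
      congr 1
      ring_nf
    · simp only [zero_add, hU0, hinv']
  have hUc : ∀ x, Continuous fun t => U t x := fun x =>
    continuous_iff_continuousAt.2 fun t => (hU x t).continuousAt
  have hSc : ∀ x, Continuous fun t => G t (U t x) := fun x =>
    continuous_apply_of_strongly_continuous hGc hGM (hUc x)
  let S : C0Semigroup X :=
    { toFun := fun t => (G t).comp (U t)
      map_zero := by
        ext x
        simp [hU0, hG0]
      map_add := fun s t _ _ => by
        ext x
        simp only [ContinuousLinearMap.comp_apply, hUadd t x s]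
        rw [hGadd, hinv]
      tendsto_zero := fun v => by
        have := (hSc v).tendsto 0
        simp only [hU0, hG0] at this
        exact this.mono_left nhdsWithin_le_nhds }
  refine ⟨S, hSc, fun v w => ?_⟩
  -- The second summand converges to Bv for every v, so the difference quotients of S and G converge
  -- for the same v and the domain does not change.
  have hsplit : ∀ h : ℝ, ((h⁻¹ : ℝ) : ℂ) • (S.toFun h v - v)
      = ((h⁻¹ : ℝ) : ℂ) • (G h v - v) + G h (((h⁻¹ : ℝ) : ℂ) • (U h v - v)) := fun h => by
    change ((h⁻¹ : ℝ) : ℂ) • (G h (U h v) - v) = _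
    rw [map_smul, map_sub, ← smul_add]
    congr 1
    abel
  have hB : Tendsto (fun h : ℝ => G h (((h⁻¹ : ℝ) : ℂ) • (U h v - v))) (𝓝[>] 0) (𝓝 (B v)) := by
    have h1 : Tendsto (fun h : ℝ => ((h⁻¹ : ℝ) : ℂ) • (U h v - v)) (𝓝[>] 0) (𝓝 (B v)) := by
      have h2 := (hU v 0).tendsto_slope_zero_right
      simp only [zero_add, hU0, Complex.coe_smul] at h2 ⊢
      convert h2 using 2
      change B v = G (-0) (B (G 0 v))
      rw [neg_zero, hG0, hG0]
    rw [tendsto_iff_norm_sub_tendsto_zero] at h1 ⊢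
    have h3 : Tendsto (fun h : ℝ => M * ‖((h⁻¹ : ℝ) : ℂ) • (U h v - v) - B v‖
        + ‖G h (B v) - B v‖) (𝓝[>] 0) (𝓝 0) := by
      have h4 : Tendsto (fun h => ‖G h (B v) - B v‖) (𝓝[>] 0) (𝓝 0) := by
        rw [← tendsto_iff_norm_sub_tendsto_zero]
        have := (hGc (B v)).tendsto 0
        rw [hG0] at this
        exact this.mono_left nhdsWithin_le_nhds
      simpa using (h1.const_mul M).add h4
    refine squeeze_zero (fun _ => norm_nonneg _) (fun h => ?_) h3
    calc _ = ‖G h (((h⁻¹ : ℝ) : ℂ) • (U h v - v) - B v) + (G h (B v) - B v)‖ := by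
          rw [map_sub]; congr 1; abel
      _ ≤ _ := (norm_add_le _ _).trans <| by
          gcongr
          exact (G h).le_of_opNorm_le (hGM h) _
  simp only [hsplit]
  constructor
  · intro h
    simpa using h.sub hB
  · intro h
    simpa using h.add hB

omit [CompleteSpace X] in
/-- A semigroup acts on an eigenvector of its generator by exponentials. -/
theorem C0Semigroup.apply_eigenvector {S : C0Semigroup X}
    (hS : ∀ x, Continuous fun t => S.toFun t x) {v : X} {z : ℂ}
    (hv : Tendsto (fun h : ℝ => ((h⁻¹ : ℝ) : ℂ) • (S.toFun h v - v)) (𝓝[>] 0) (𝓝 (z • v)))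
    {t : ℝ} (ht : 0 ≤ t) : S.toFun t v = Complex.exp (z * t) • v := by
  have hder : ∀ s, 0 ≤ s → HasDerivWithinAt (fun r => S.toFun r v) (z • S.toFun s v) (Ici s) s := by
    intro s hs
    rw [← hasDerivWithinAt_Ioi_iff_Ici, hasDerivWithinAt_iff_tendsto_slope' (by simp)]
    have h1 : Tendsto (fun r : ℝ => r - s) (𝓝[>] s) (𝓝[>] 0) := by
      refine tendsto_nhdsWithin_of_tendsto_nhds_of_eventually_within _ ?_ ?_
      · have : Tendsto (fun r : ℝ => r - s) (𝓝 s) (𝓝 (s - s)) :=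
          (continuous_id.sub continuous_const).tendsto s
        rw [sub_self] at this
        exact this.mono_left nhdsWithin_le_nhds
      · filter_upwards [self_mem_nhdsWithin] with r hr
        exact sub_pos.2 (mem_Ioi.1 hr)
    have h2 := ((S.toFun s).continuous.tendsto _).comp (hv.comp h1)
    rw [map_smul] at h2
    refine h2.congr' ?_
    filter_upwards [self_mem_nhdsWithin] with r hr
    have hr' : 0 ≤ r - s := (sub_pos.2 (mem_Ioi.1 hr)).le
    have h3 := congrArg (fun T : X →L[ℂ] X => T v) (S.map_add s (r - s) hs hr')
    simp only [add_sub_cancel, ContinuousLinearMap.comp_apply] at h3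
    rw [slope_def_module, h3, ← Complex.coe_smul, ← map_sub, ← map_smul]
    rfl
  -- The function exp(-zs)S(s)v is continuous with vanishing right derivative, hence constant. Only
  -- right derivatives are available for a semigroup.
  have hcont : ContinuousOn (fun s : ℝ => Complex.exp (-(z * s)) • S.toFun s v) (Icc 0 t) := by
    have := hS v
    fun_prop
  have hexp : ∀ s : ℝ, HasDerivAt (fun s : ℝ => Complex.exp (-(z * s)))
      (Complex.exp (-(z * s)) * (-z)) s := fun s => by
    have h4 : HasDerivAt (fun s : ℝ => -(z * (s : ℂ))) (-z) s := by
      exact ((Complex.ofRealCLM.hasDerivAt (x := s)).const_mul z).neg.congr_deriv (by simp)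
    exact h4.cexp
  have h := constant_of_has_deriv_right_zero hcont (fun s hs => by
    have h5 := (hexp s).hasDerivWithinAt.smul (hder s hs.1)
    refine HasDerivWithinAt.congr_deriv h5 ?_
    rw [smul_smul, ← add_smul, ← mul_add, add_neg_cancel, mul_zero, zero_smul]) t ⟨ht, le_rfl⟩
  have h0 := congrArg (fun T : X →L[ℂ] X => T v) S.map_zero
  simp only [ContinuousLinearMap.id_apply] at h0
  simp only [Complex.ofReal_zero, mul_zero, neg_zero, Complex.exp_zero, one_smul, h0] at h
  conv_rhs => rw [← h]
  rw [smul_smul, ← Complex.exp_add, add_neg_cancel, Complex.exp_zero, one_smul]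

omit [CompleteSpace X] in
/-- A generator with an eigenvalue in the open right half plane is unstable. -/
theorem unstable_of_eigenvector {S : C0Semigroup X} {A : Set (X × X)} (hA : S.HasGenerator A)
    (hS : ∀ x, Continuous fun t => S.toFun t x) {v : X} (hv : v ≠ 0) {z : ℂ} (hz : 0 < z.re)
    (hvA : (v, z • v) ∈ A) : ¬ SpectrallyStable A ∧ ¬ S.LinearlyStable := by
  constructor
  · intro h
    have hmem : z ∈ operatorSpectrum A := by
      rintro ⟨R, hR⟩
      have h1 := (hR 0 v).2 (by simpa using hvA)
      exact hv (by rw [← h1, map_zero])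
    exact absurd (h hmem) (not_le.2 hz)
  · intro h
    have h1 : ((z.re : ℝ) : EReal) ≤ S.growthBound := by
      refine le_sInf ?_
      rintro _ ⟨a, ⟨M, hM⟩, rfl⟩
      rw [EReal.coe_le_coe_iff]
      by_contra hlt
      push Not at hlt
      have h2 : ∀ t : ℝ, 0 ≤ t → exp ((z.re - a) * t) ≤ M := fun t ht => by
        have h3 := (S.toFun t).le_of_opNorm_le (hM t ht) v
        rw [C0Semigroup.apply_eigenvector hS ((hA _ _).1 hvA) ht, norm_smul, Complex.norm_exp,
          mul_le_mul_iff_left₀ (norm_pos_iff.2 hv)] at h3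
        have h4 : (z * (t : ℂ)).re = (z.re - a) * t + a * t := by simp; ring
        rw [h4, Real.exp_add, mul_le_mul_iff_left₀ (exp_pos _)] at h3
        exact h3
      -- At this time the estimate reads exp |M| ≤ M, contradicting |M| + 1 ≤ exp |M|.
      have h5 := h2 (|M| / (z.re - a)) (div_nonneg (abs_nonneg _) (sub_pos.2 hlt).le)
      rw [mul_div_cancel₀ _ (sub_pos.2 hlt).ne'] at h5
      linarith [Real.add_one_le_exp |M|, le_abs_self M]
    have h6 := h1.trans h
    exact absurd (EReal.coe_nonpos.1 h6) (not_le.2 hz)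

end Perturbation

/-! ### Fourier series on the periodic cell -/

section CellBasis

theorem cellMeasure_eq_prod (K₁ K₂ : ℝ) : cellMeasure K₁ K₂
    = (volume.restrict (Ioc 0 K₁)).prod (volume.restrict (Ioc 0 K₂)) := by
  rw [Measure.prod_restrict, ← Measure.volume_eq_prod]; rfl

instance isFiniteMeasure_cellMeasure (K₁ K₂ : ℝ) : IsFiniteMeasure (cellMeasure K₁ K₂) := by
  rw [cellMeasure_eq_prod]; infer_instance

theorem ae_cellMeasure_mem (K₁ K₂ : ℝ) : ∀ᵐ p ∂cellMeasure K₁ K₂, p ∈ Ioc 0 K₁ ×ˢ Ioc 0 K₂ :=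
  ae_restrict_mem (measurableSet_Ioc.prod measurableSet_Ioc)

theorem exists_bound_on_cell {E : Type*} [SeminormedAddCommGroup E] (K₁ K₂ : ℝ) {f : ℝ × ℝ → E}
    (hf : Continuous f) : ∃ C, ∀ p ∈ Ioc 0 K₁ ×ˢ Ioc 0 K₂, ‖f p‖ ≤ C := by
  obtain ⟨C, hC⟩ := ((isCompact_Icc (a := (0 : ℝ)) (b := K₁)).prod
    (isCompact_Icc (a := (0 : ℝ)) (b := K₂))).exists_bound_of_continuousOn hf.continuousOn
  exact ⟨C, fun p hp => hC p ⟨Ioc_subset_Icc_self hp.1, Ioc_subset_Icc_self hp.2⟩⟩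

theorem memLp_cell_of_continuous (K₁ K₂ : ℝ) (q : ENNReal) {f : ℝ × ℝ → ℂ} (hf : Continuous f) :
    MemLp f q (cellMeasure K₁ K₂) := by
  obtain ⟨C, hC⟩ := exists_bound_on_cell K₁ K₂ hf
  exact MemLp.of_bound hf.aestronglyMeasurable C ((ae_cellMeasure_mem K₁ K₂).mono hC)

theorem integrable_cell_of_continuous (K₁ K₂ : ℝ) {f : ℝ × ℝ → ℂ} (hf : Continuous f) :
    Integrable f (cellMeasure K₁ K₂) :=
  memLp_one_iff_integrable.1 (memLp_cell_of_continuous K₁ K₂ 1 hf)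

/-- The frequency of the mode `j` along `e`. -/
def cellFreq (K₁ K₂ : ℝ) (j : ℤ × ℤ) (e : ℝ × ℝ) : ℝ := 2 * π * (j.1 * e.1 / K₁ + j.2 * e.2 / K₂)

/-- The characters of the torus with periods `K₁` and `K₂`. -/
def cellChar (K₁ K₂ : ℝ) (j : ℤ × ℤ) (p : ℝ × ℝ) : ℂ := Complex.exp (cellFreq K₁ K₂ j p * Complex.I)

theorem cellFreq_neg (K₁ K₂ : ℝ) (j : ℤ × ℤ) (e : ℝ × ℝ) :
    cellFreq K₁ K₂ (-j) e = -cellFreq K₁ K₂ j e := by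
  simp only [cellFreq, Prod.fst_neg, Prod.snd_neg]; push_cast; ring

theorem contDiff_cellFreq (K₁ K₂ : ℝ) (j : ℤ × ℤ) {n : WithTop ℕ∞} :
    ContDiff ℝ n (cellFreq K₁ K₂ j) := by
  unfold cellFreq; fun_prop

theorem contDiff_cellChar (K₁ K₂ : ℝ) (j : ℤ × ℤ) {n : WithTop ℕ∞} :
    ContDiff ℝ n (cellChar K₁ K₂ j) :=
  ((Complex.ofRealCLM.contDiff.comp (contDiff_cellFreq K₁ K₂ j)).mul contDiff_const).cexp

theorem continuous_cellChar (K₁ K₂ : ℝ) (j : ℤ × ℤ) : Continuous (cellChar K₁ K₂ j) :=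
  (contDiff_cellChar K₁ K₂ j (n := 0)).continuous

theorem conj_cellChar (K₁ K₂ : ℝ) (j : ℤ × ℤ) (p : ℝ × ℝ) :
    starRingEnd ℂ (cellChar K₁ K₂ j p) = cellChar K₁ K₂ (-j) p := by
  rw [cellChar, cellChar, ← Complex.exp_conj, cellFreq_neg]
  simp

theorem cellChar_mul (K₁ K₂ : ℝ) (i j : ℤ × ℤ) (p : ℝ × ℝ) :
    cellChar K₁ K₂ i p * cellChar K₁ K₂ j p = cellChar K₁ K₂ (i + j) p := by
  rw [cellChar, cellChar, cellChar, ← Complex.exp_add, ← add_mul]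
  congr 2
  simp only [cellFreq, Prod.fst_add, Prod.snd_add]; push_cast; ring

theorem cellChar_eq_mul (K₁ K₂ : ℝ) (j : ℤ × ℤ) (p : ℝ × ℝ) :
    cellChar K₁ K₂ j p = cellChar K₁ K₂ (j.1, 0) (p.1, 0) * cellChar K₁ K₂ (0, j.2) (0, p.2) := by
  rw [cellChar, cellChar, cellChar, ← Complex.exp_add, ← add_mul]
  congr 2
  simp [cellFreq]; ring

theorem exp_freq_period {K : ℝ} (hK : 0 < K) (m : ℤ) (a : ℝ) :
    Complex.exp (((2 * π * (m * K / K) + a : ℝ) : ℂ) * Complex.I) = Complex.exp (a * Complex.I) := by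
  have hK' : (K : ℂ) ≠ 0 := by exact_mod_cast hK.ne'
  have := Complex.exp_periodic.int_mul m (a * Complex.I)
  rw [← this]
  congr 1
  push_cast
  field_simp
  ring

theorem isPeriodicTest_cellChar {K₁ K₂ : ℝ} (h₁ : 0 < K₁) (h₂ : 0 < K₂) (j : ℤ × ℤ) :
    IsPeriodicTest K₁ K₂ (cellChar K₁ K₂ j) where
  contDiff := contDiff_cellChar K₁ K₂ j
  periodic_x x y := by
    rw [cellChar, cellChar, ← exp_freq_period h₁ j.1 (cellFreq K₁ K₂ j (x, y))]
    congr 3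
    simp only [cellFreq]; ring
  periodic_y x y := by
    rw [cellChar, cellChar, ← exp_freq_period h₂ j.2 (cellFreq K₁ K₂ j (x, y))]
    congr 3
    simp only [cellFreq]; ring

theorem integral_exp_freq {K : ℝ} (hK : 0 < K) (m : ℤ) :
    ∫ x in Ioc 0 K, Complex.exp ((2 * π * (m * x / K) : ℝ) * Complex.I) = if m = 0 then (K : ℂ) else 0 := by
  split_ifs with h
  · subst h
    simp [hK.le]
  · have hK' : (K : ℂ) ≠ 0 := by exact_mod_cast hK.ne'
    have hm : (m : ℂ) ≠ 0 := by exact_mod_cast h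
    have hc : 2 * π * m / K * Complex.I ≠ 0 := by
      simp [hm, hK', Real.pi_ne_zero]
    have h1 := integral_exp_mul_complex (a := 0) (b := K) hc
    rw [intervalIntegral.integral_of_le hK.le] at h1
    have h2 : Complex.exp (2 * π * m / K * Complex.I * K) = 1 := by
      rw [← Complex.exp_int_mul_two_pi_mul_I m]
      congr 1
      field_simp
    rw [h2] at h1
    simp only [Complex.ofReal_zero, mul_zero, Complex.exp_zero, sub_self, zero_div] at h1
    rw [← h1]
    refine integral_congr_ae (Eventually.of_forall fun x => ?_)
    simp only
    congr 1
    push_cast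
    ring

theorem integral_cellChar {K₁ K₂ : ℝ} (h₁ : 0 < K₁) (h₂ : 0 < K₂) (j : ℤ × ℤ) :
    ∫ p, cellChar K₁ K₂ j p ∂cellMeasure K₁ K₂ = if j = 0 then ((K₁ * K₂ : ℝ) : ℂ) else 0 := by
  rw [cellMeasure_eq_prod]
  simp_rw [cellChar_eq_mul K₁ K₂ j]
  rw [integral_prod_mul (fun x => cellChar K₁ K₂ (j.1, 0) (x, 0))
    (fun y => cellChar K₁ K₂ (0, j.2) (0, y))]
  have hx : ∀ x : ℝ, cellChar K₁ K₂ (j.1, 0) (x, 0)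
      = Complex.exp ((2 * π * (j.1 * x / K₁) : ℝ) * Complex.I) := fun x => by
    simp [cellChar, cellFreq]
  have hy : ∀ y : ℝ, cellChar K₁ K₂ (0, j.2) (0, y)
      = Complex.exp ((2 * π * (j.2 * y / K₂) : ℝ) * Complex.I) := fun x => by
    simp [cellChar, cellFreq]
  simp_rw [hx, hy]
  rw [integral_exp_freq h₁, integral_exp_freq h₂]
  by_cases hj₁ : j.1 = 0 <;> by_cases hj₂ : j.2 = 0 <;>
    simp [hj₁, hj₂, Prod.ext_iff]

/-- The representative in `(0, K]` of `K θ`. -/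
def cellRep (K : ℝ) (θ : UnitAddCircle) : ℝ := K * (AddCircle.equivIoc (1 : ℝ) 0 θ : ℝ)

theorem measurePreserving_cellRep {K : ℝ} (hK : 0 < K) :
    MeasurePreserving (cellRep K) AddCircle.haarAddCircle
      (ENNReal.ofReal K⁻¹ • volume.restrict (Ioc 0 K)) := by
  have h1 : MeasurePreserving (fun θ : UnitAddCircle => (AddCircle.equivIoc (1 : ℝ) 0 θ : ℝ))
      AddCircle.haarAddCircle (volume.restrict (Ioc 0 1)) := by
    have h2 : (volume : Measure UnitAddCircle) = AddCircle.haarAddCircle := by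
      rw [AddCircle.volume_eq_smul_haarAddCircle]; simp
    have h3 := AddCircle.measurePreserving_equivIoc (1 : ℝ) (a := 0)
    rw [h2] at h3
    have h4 : MeasurePreserving (Subtype.val : Ioc (0 : ℝ) (0 + 1) → ℝ)
        (Measure.comap Subtype.val volume) (volume.restrict (Ioc 0 1)) := by
      refine ⟨measurable_subtype_coe, ?_⟩
      rw [map_comap_subtype_coe measurableSet_Ioc, zero_add]
    exact h4.comp h3
  have h5 : MeasurePreserving (fun x : ℝ => K * x) (volume.restrict (Ioc 0 1))
      (ENNReal.ofReal K⁻¹ • volume.restrict (Ioc 0 K)) := by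
    refine ⟨measurable_const_mul K, ?_⟩
    have h6 := Measure.restrict_map (μ := (volume : Measure ℝ)) (measurable_const_mul K)
      (measurableSet_Ioc (a := 0) (b := K))
    rw [Real.map_volume_mul_left hK.ne', Measure.restrict_smul, abs_of_pos (inv_pos.2 hK)] at h6
    rw [h6]
    congr 2
    ext x
    simp only [mem_preimage, mem_Ioc]
    constructor
    · rintro ⟨ha, hb⟩
      exact ⟨by positivity, by nlinarith⟩
    · rintro ⟨ha, hb⟩
      exact ⟨by nlinarith, by nlinarith⟩
  exact h5.comp h1

/-- The map from the unit torus to the cell. -/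
def torusToCell (K₁ K₂ : ℝ) (θ : Fin 2 → UnitAddCircle) : ℝ × ℝ :=
  (cellRep K₁ (θ 0), cellRep K₂ (θ 1))

theorem measurePreserving_torusToCell {K₁ K₂ : ℝ} (h₁ : 0 < K₁) (h₂ : 0 < K₂) :
    MeasurePreserving (torusToCell K₁ K₂)
      (Measure.pi fun _ : Fin 2 => (AddCircle.haarAddCircle : Measure UnitAddCircle))
      ((ENNReal.ofReal K₁⁻¹ * ENNReal.ofReal K₂⁻¹) • cellMeasure K₁ K₂) := by
  have h := ((measurePreserving_cellRep h₁).prod (measurePreserving_cellRep h₂)).comp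
    (measurePreserving_finTwoArrow (AddCircle.haarAddCircle : Measure UnitAddCircle))
  have h3 : (ENNReal.ofReal K₁⁻¹ • volume.restrict (Ioc 0 K₁)).prod
      (ENNReal.ofReal K₂⁻¹ • volume.restrict (Ioc 0 K₂))
      = (ENNReal.ofReal K₁⁻¹ * ENNReal.ofReal K₂⁻¹) • cellMeasure K₁ K₂ := by
    rw [cellMeasure_eq_prod, Measure.prod_smul_left, Measure.prod_smul_right, smul_smul]
  rw [h3] at h
  exact h

theorem mFourier_eq_cellChar {K₁ K₂ : ℝ} (h₁ : 0 < K₁) (h₂ : 0 < K₂) (n : Fin 2 → ℤ)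
    (θ : Fin 2 → UnitAddCircle) :
    UnitAddTorus.mFourier n θ = cellChar K₁ K₂ (n 0, n 1) (torusToCell K₁ K₂ θ) := by
  have h : ∀ (m : ℤ) (t : UnitAddCircle), (fourier m t : ℂ)
      = Complex.exp (2 * π * Complex.I * m * (AddCircle.equivIoc (1 : ℝ) 0 t : ℝ)) := fun m t => by
    conv_lhs => rw [← AddCircle.coe_equivIoc (p := (1 : ℝ)) (a := 0) (y := t)]
    rw [fourier_coe_apply]
    simp
  have hK₁ : (K₁ : ℂ) ≠ 0 := by exact_mod_cast h₁.ne'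
  have hK₂ : (K₂ : ℂ) ≠ 0 := by exact_mod_cast h₂.ne'
  simp only [UnitAddTorus.mFourier, ContinuousMap.coe_mk, Fin.prod_univ_two, h, cellChar, cellFreq,
    torusToCell, cellRep]
  rw [← Complex.exp_add]
  congr 1
  push_cast
  field_simp

/-- A square integrable function on the cell is determined by its Fourier coefficients. -/
theorem ae_eq_zero_of_integral_cellChar {K₁ K₂ : ℝ} (h₁ : 0 < K₁) (h₂ : 0 < K₂)
    (f : CellL2 K₁ K₂) (hf : ∀ j, ∫ p, cellChar K₁ K₂ j p * f p ∂cellMeasure K₁ K₂ = 0) :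
    f = 0 := by
  set μ := Measure.pi fun _ : Fin 2 => (AddCircle.haarAddCircle : Measure UnitAddCircle) with hμ
  set c := ENNReal.ofReal K₁⁻¹ * ENNReal.ofReal K₂⁻¹ with hc
  have hc0 : c ≠ 0 := by
    simp [hc, h₁, h₂]
  have hctop : c ≠ ⊤ := ENNReal.mul_ne_top ENNReal.ofReal_ne_top ENNReal.ofReal_ne_top
  -- Completeness of the characters is transported from the unit torus: the rescaling preserves
  -- measure up to the nonzero constant c and pulls the characters back to the standard Fourier
  -- monomials.
  have hmp := measurePreserving_torusToCell h₁ h₂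
  have hmem : MemLp (f ∘ torusToCell K₁ K₂) 2 μ :=
    ((Lp.memLp f).smul_measure hctop).comp_measurePreserving hmp
  let b : HilbertBasis (Fin 2 → ℤ) ℂ (Lp ℂ 2 μ) := UnitAddTorus.mFourierBasis
  have hcoef : ∀ n, b.repr (hmem.toLp _) n = 0 := fun n => by
    have h3 : b.repr (hmem.toLp _) n
        = ∫ θ, UnitAddTorus.mFourier (-n) θ • (hmem.toLp _) θ ∂μ :=
      UnitAddTorus.mFourierBasis_repr _ n
    have h4 : ∫ θ, UnitAddTorus.mFourier (-n) θ • (hmem.toLp _) θ ∂μ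
        = ∫ θ, (fun p => cellChar K₁ K₂ ((-n) 0, (-n) 1) p * f p) (torusToCell K₁ K₂ θ) ∂μ := by
      refine integral_congr_ae ?_
      filter_upwards [hmem.coeFn_toLp] with θ hθ
      rw [hθ, mFourier_eq_cellChar h₁ h₂, smul_eq_mul]
      rfl
    have h5 := integral_map (μ := μ) hmp.measurable.aemeasurable
      (f := fun p => cellChar K₁ K₂ ((-n) 0, (-n) 1) p * f p) (by
        rw [hmp.map_eq]
        exact ((continuous_cellChar K₁ K₂ _).aestronglyMeasurable.mul
          (Lp.aestronglyMeasurable f)).smul_measure c)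
    rw [hmp.map_eq, integral_smul_measure, hf, smul_zero] at h5
    exact h3.trans (h4.trans h5.symm)
  have hzero : hmem.toLp _ = 0 := b.ext_repr fun n => by rw [hcoef]; simp
  have hae : f ∘ torusToCell K₁ K₂ =ᵐ[μ] 0 := by
    rw [Lp.eq_zero_iff_ae_eq_zero] at hzero
    exact hmem.coeFn_toLp.symm.trans hzero
  have hae2 : ∀ᵐ p ∂(c • cellMeasure K₁ K₂), f p = 0 := by
    rw [← hmp.map_eq]
    exact (ae_map_iff hmp.measurable.aemeasurable
      ((Lp.stronglyMeasurable f).measurable (measurableSet_singleton 0))).2 hae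
  rw [Lp.eq_zero_iff_ae_eq_zero]
  exact (Measure.ae_ennreal_smul_measure_iff hc0).1 hae2

/-- The normalized characters in `L²` of the cell. -/
def cellMode (K₁ K₂ : ℝ) (j : ℤ × ℤ) : CellL2 K₁ K₂ :=
  (((√(K₁ * K₂))⁻¹ : ℝ) : ℂ) • (memLp_cell_of_continuous K₁ K₂ 2 (continuous_cellChar K₁ K₂ j)).toLp _

theorem coeFn_cellMode (K₁ K₂ : ℝ) (j : ℤ × ℤ) : ∀ᵐ p ∂cellMeasure K₁ K₂,
    cellMode K₁ K₂ j p = (((√(K₁ * K₂))⁻¹ : ℝ) : ℂ) * cellChar K₁ K₂ j p := by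
  filter_upwards [Lp.coeFn_smul (((√(K₁ * K₂))⁻¹ : ℝ) : ℂ)
    ((memLp_cell_of_continuous K₁ K₂ 2 (continuous_cellChar K₁ K₂ j)).toLp _),
    (memLp_cell_of_continuous K₁ K₂ 2 (continuous_cellChar K₁ K₂ j)).coeFn_toLp] with p hp hq
  rw [cellMode, hp, Pi.smul_apply, hq, smul_eq_mul]

theorem inner_cellMode (K₁ K₂ : ℝ) (j : ℤ × ℤ) (f : CellL2 K₁ K₂) :
    inner ℂ (cellMode K₁ K₂ j) f
      = (((√(K₁ * K₂))⁻¹ : ℝ) : ℂ) * ∫ p, cellChar K₁ K₂ (-j) p * f p ∂cellMeasure K₁ K₂ := by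
  rw [L2.inner_def, ← integral_const_mul]
  refine integral_congr_ae ?_
  filter_upwards [coeFn_cellMode K₁ K₂ j] with p hp
  rw [hp, RCLike.inner_apply, map_mul, conj_cellChar, Complex.conj_ofReal]
  ring

theorem orthonormal_cellMode {K₁ K₂ : ℝ} (h₁ : 0 < K₁) (h₂ : 0 < K₂) :
    Orthonormal ℂ (cellMode K₁ K₂) := by
  classical
  rw [orthonormal_iff_ite]
  intro i j
  have h3 : 0 < √(K₁ * K₂) := Real.sqrt_pos.2 (by positivity)
  have h4 : ∫ p, cellChar K₁ K₂ (-i) p * cellMode K₁ K₂ j p ∂cellMeasure K₁ K₂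
      = ∫ p, (((√(K₁ * K₂))⁻¹ : ℝ) : ℂ) * cellChar K₁ K₂ (-i + j) p ∂cellMeasure K₁ K₂ := by
    refine integral_congr_ae ?_
    filter_upwards [coeFn_cellMode K₁ K₂ j] with p hp
    rw [hp, ← cellChar_mul]
    ring
  rw [inner_cellMode, h4, integral_const_mul, integral_cellChar h₁ h₂]
  have h5 : -i + j = 0 ↔ i = j := by rw [neg_add_eq_zero]
  simp only [h5]
  split_ifs with h
  · rw [← Complex.ofReal_mul, ← Complex.ofReal_mul]
    have : (√(K₁ * K₂))⁻¹ * ((√(K₁ * K₂))⁻¹ * (K₁ * K₂)) = 1 := by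
      have h6 := Real.mul_self_sqrt (by positivity : 0 ≤ K₁ * K₂)
      rw [← mul_assoc, ← mul_inv, h6]
      exact inv_mul_cancel₀ (by positivity)
    rw [this, Complex.ofReal_one]
  · simp

/-- The Fourier basis of `L²` of the cell. -/
def cellBasis {K₁ K₂ : ℝ} (h₁ : 0 < K₁) (h₂ : 0 < K₂) : HilbertBasis (ℤ × ℤ) ℂ (CellL2 K₁ K₂) :=
  HilbertBasis.mkOfOrthogonalEqBot (orthonormal_cellMode h₁ h₂) <| by
    rw [Submodule.eq_bot_iff]
    intro f hf
    refine ae_eq_zero_of_integral_cellChar h₁ h₂ f fun j => ?_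
    have h3 := (Submodule.mem_orthogonal _ _).1 hf (cellMode K₁ K₂ (-j))
      (Submodule.subset_span ⟨_, rfl⟩)
    rw [inner_cellMode, neg_neg] at h3
    have h4 : 0 < √(K₁ * K₂) := Real.sqrt_pos.2 (by positivity)
    refine (mul_eq_zero.1 h3).resolve_left ?_
    exact_mod_cast (inv_pos.2 h4).ne'

theorem cellBasis_apply {K₁ K₂ : ℝ} (h₁ : 0 < K₁) (h₂ : 0 < K₂) (j : ℤ × ℤ) :
    cellBasis h₁ h₂ j = cellMode K₁ K₂ j := by
  rw [cellBasis, HilbertBasis.coe_mkOfOrthogonalEqBot]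

theorem cellBasis_repr {K₁ K₂ : ℝ} (h₁ : 0 < K₁) (h₂ : 0 < K₂) (f : CellL2 K₁ K₂) (j : ℤ × ℤ) :
    (cellBasis h₁ h₂).repr f j
      = (((√(K₁ * K₂))⁻¹ : ℝ) : ℂ) * ∫ p, cellChar K₁ K₂ (-j) p * f p ∂cellMeasure K₁ K₂ := by
  rw [HilbertBasis.repr_apply_apply, cellBasis_apply, inner_cellMode]

end CellBasis

/-! ### Weak derivatives in terms of Fourier coefficients -/

section WeakDerivatives

variable {K₁ K₂ : ℝ}

theorem IsPeriodicTest.differentiableAt {ψ : ℝ × ℝ → ℂ} (h : IsPeriodicTest K₁ K₂ ψ) (p : ℝ × ℝ) :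
    DifferentiableAt ℝ ψ p :=
  (h.contDiff.differentiable (by simp)) p

theorem IsPeriodicTest.continuous {ψ : ℝ × ℝ → ℂ} (h : IsPeriodicTest K₁ K₂ ψ) : Continuous ψ :=
  h.contDiff.continuous

theorem IsPeriodicTest.continuous_fderiv {ψ : ℝ × ℝ → ℂ} (h : IsPeriodicTest K₁ K₂ ψ) (e : ℝ × ℝ) :
    Continuous fun p => fderiv ℝ ψ p e :=
  (h.contDiff.continuous_fderiv (by simp)).clm_apply continuous_const

theorem IsPeriodicTest.mul {ψ χ : ℝ × ℝ → ℂ} (h : IsPeriodicTest K₁ K₂ ψ)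
    (h' : IsPeriodicTest K₁ K₂ χ) : IsPeriodicTest K₁ K₂ fun p => ψ p * χ p where
  contDiff := h.contDiff.mul h'.contDiff
  periodic_x x y := by rw [h.periodic_x, h'.periodic_x]
  periodic_y x y := by rw [h.periodic_y, h'.periodic_y]

theorem IsPeriodicTest.conj {ψ : ℝ × ℝ → ℂ} (h : IsPeriodicTest K₁ K₂ ψ) :
    IsPeriodicTest K₁ K₂ fun p => starRingEnd ℂ (ψ p) where
  contDiff := Complex.conjCLE.contDiff.comp h.contDiff
  periodic_x x y := by rw [h.periodic_x]
  periodic_y x y := by rw [h.periodic_y]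

theorem integral_cell_deriv_fst (h₁ : 0 < K₁) {g g' : ℝ × ℝ → ℂ} (hg' : Continuous g')
    (hd : ∀ x y, HasDerivAt (fun r => g (r, y)) (g' (x, y)) x)
    (hp : ∀ x y, g (x + K₁, y) = g (x, y)) : ∫ p, g' p ∂cellMeasure K₁ K₂ = 0 := by
  have hint := integrable_cell_of_continuous K₁ K₂ hg'
  rw [cellMeasure_eq_prod] at hint ⊢
  rw [integral_prod_symm _ hint]
  refine integral_eq_zero_of_ae (Eventually.of_forall fun y => ?_)
  simp only [Pi.zero_apply]
  rw [← intervalIntegral.integral_of_le h₁.le,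
    intervalIntegral.integral_eq_sub_of_hasDerivAt (fun x _ => hd x y)
      (Continuous.intervalIntegrable (by fun_prop) _ _), sub_eq_zero]
  simpa using hp 0 y

theorem integral_cell_deriv_snd (h₂ : 0 < K₂) {g g' : ℝ × ℝ → ℂ} (hg' : Continuous g')
    (hd : ∀ x y, HasDerivAt (fun r => g (x, r)) (g' (x, y)) y)
    (hp : ∀ x y, g (x, y + K₂) = g (x, y)) : ∫ p, g' p ∂cellMeasure K₁ K₂ = 0 := by
  have hint := integrable_cell_of_continuous K₁ K₂ hg'
  rw [cellMeasure_eq_prod] at hint ⊢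
  rw [integral_prod _ hint]
  refine integral_eq_zero_of_ae (Eventually.of_forall fun x => ?_)
  simp only [Pi.zero_apply]
  rw [← intervalIntegral.integral_of_le h₂.le,
    intervalIntegral.integral_eq_sub_of_hasDerivAt (fun y _ => hd x y)
      (Continuous.intervalIntegrable (by fun_prop) _ _), sub_eq_zero]
  simpa using hp x 0

theorem IsPeriodicTest.integral_fderiv_eq_zero (h₁ : 0 < K₁) (h₂ : 0 < K₂) {ψ : ℝ × ℝ → ℂ}
    (h : IsPeriodicTest K₁ K₂ ψ) {e : ℝ × ℝ} (he : e = (1, 0) ∨ e = (0, 1)) :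
    ∫ p, fderiv ℝ ψ p e ∂cellMeasure K₁ K₂ = 0 := by
  rcases he with rfl | rfl
  · exact integral_cell_deriv_fst h₁ (h.continuous_fderiv _)
      (fun x y => (h.differentiableAt (x, y)).hasFDerivAt.comp_hasDerivAt x
        ((hasDerivAt_id x).prodMk (hasDerivAt_const x y))) h.periodic_x
  · exact integral_cell_deriv_snd h₂ (h.continuous_fderiv _)
      (fun x y => (h.differentiableAt (x, y)).hasFDerivAt.comp_hasDerivAt y
        ((hasDerivAt_const y x).prodMk (hasDerivAt_id y))) h.periodic_y

theorem fderiv_cellChar (j : ℤ × ℤ) (p e : ℝ × ℝ) :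
    fderiv ℝ (cellChar K₁ K₂ j) p e = Complex.I * cellFreq K₁ K₂ j e * cellChar K₁ K₂ j p := by
  let L : ℝ × ℝ →L[ℝ] ℝ := (2 * π * (j.1 / K₁)) • ContinuousLinearMap.fst ℝ ℝ ℝ
    + (2 * π * (j.2 / K₂)) • ContinuousLinearMap.snd ℝ ℝ ℝ
  have hL : ∀ q, L q = cellFreq K₁ K₂ j q := fun q => by
    simp [L, cellFreq]; ring
  have h1 : HasFDerivAt (fun q => ((L q : ℝ) : ℂ) * Complex.I)
      ((Complex.ofRealCLM.comp L).smulRight Complex.I) p :=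
    ((Complex.ofRealCLM.comp L).smulRight Complex.I).hasFDerivAt
  have h2 := h1.cexp
  have h3 : (fun q => Complex.exp (((L q : ℝ) : ℂ) * Complex.I)) = cellChar K₁ K₂ j := by
    funext q; rw [hL]; rfl
  rw [h3] at h2
  rw [h2.fderiv]
  simp only [smul_apply, ContinuousLinearMap.smulRight_apply, ContinuousLinearMap.comp_apply,
    Complex.ofRealCLM_apply, hL, smul_eq_mul]
  rw [← cellChar]
  ring

/-- Integration by parts on the torus: the derivative of a conjugate character times ψ has integral
zero over the cell. -/
theorem repr_toLp_fderiv (h₁ : 0 < K₁) (h₂ : 0 < K₂) {ψ : ℝ × ℝ → ℂ}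
    (h : IsPeriodicTest K₁ K₂ ψ) {e : ℝ × ℝ} (he : e = (1, 0) ∨ e = (0, 1)) (j : ℤ × ℤ) :
    (cellBasis h₁ h₂).repr ((memLp_cell_of_continuous K₁ K₂ 2 (h.continuous_fderiv e)).toLp _) j
      = Complex.I * cellFreq K₁ K₂ j e *
        (cellBasis h₁ h₂).repr ((memLp_cell_of_continuous K₁ K₂ 2 h.continuous).toLp _) j := by
  rw [cellBasis_repr, cellBasis_repr, mul_left_comm]
  congr 1
  have hχ := isPeriodicTest_cellChar h₁ h₂ (-j)
  have h3 := (hχ.mul h).integral_fderiv_eq_zero h₁ h₂ he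
  have h4 : ∀ p, fderiv ℝ (fun p => cellChar K₁ K₂ (-j) p * ψ p) p e
      = cellChar K₁ K₂ (-j) p * fderiv ℝ ψ p e
        - Complex.I * cellFreq K₁ K₂ j e * (cellChar K₁ K₂ (-j) p * ψ p) := fun p => by
    rw [fderiv_fun_mul (hχ.differentiableAt p) (h.differentiableAt p)]
    simp only [add_apply, smul_apply, smul_eq_mul, fderiv_cellChar, cellFreq_neg]
    push_cast
    ring
  simp_rw [h4] at h3
  rw [integral_sub, integral_const_mul, sub_eq_zero] at h3
  · have h5 : ∀ {g : ℝ × ℝ → ℂ} (hg : MemLp g 2 (cellMeasure K₁ K₂)),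
        ∫ p, cellChar K₁ K₂ (-j) p * hg.toLp g p ∂cellMeasure K₁ K₂
          = ∫ p, cellChar K₁ K₂ (-j) p * g p ∂cellMeasure K₁ K₂ := fun hg => by
      refine integral_congr_ae ?_
      filter_upwards [hg.coeFn_toLp] with p hp
      rw [hp]
    rw [h5, h5, h3]
  · exact integrable_cell_of_continuous _ _ (hχ.continuous.mul (h.continuous_fderiv e))
  · exact integrable_cell_of_continuous _ _ (continuous_const.mul (hχ.continuous.mul h.continuous))

theorem fderiv_conj {ψ : ℝ × ℝ → ℂ} {p : ℝ × ℝ} (h : DifferentiableAt ℝ ψ p) (e : ℝ × ℝ) :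
    fderiv ℝ (fun q => starRingEnd ℂ (ψ q)) p e = starRingEnd ℂ (fderiv ℝ ψ p e) := by
  have := ((Complex.conjCLE : ℂ →L[ℝ] ℂ).hasFDerivAt.comp p h.hasFDerivAt).fderiv
  exact congrArg (fun T : ℝ × ℝ →L[ℝ] ℂ => T e) this

/-- Weak derivatives act on Fourier coefficients by multiplication with the frequency. -/
theorem hasWeakDeriv_iff (h₁ : 0 < K₁) (h₂ : 0 < K₂) {e : ℝ × ℝ} (he : e = (1, 0) ∨ e = (0, 1))
    {v w : CellL2 K₁ K₂} : HasWeakDeriv e v w ↔ ∀ j, (cellBasis h₁ h₂).repr w j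
      = Complex.I * cellFreq K₁ K₂ j e * (cellBasis h₁ h₂).repr v j := by
  constructor
  · intro h j
    -- Characters are admissible test functions, so the definition directly gives the coefficients.
    have h3 := h _ (isPeriodicTest_cellChar h₁ h₂ (-j))
    rw [cellBasis_repr, cellBasis_repr, mul_left_comm]
    congr 1
    rw [← integral_const_mul]
    have h4 : ∀ p, w p * cellChar K₁ K₂ (-j) p = cellChar K₁ K₂ (-j) p * w p := fun p =>
      mul_comm _ _
    simp_rw [h4] at h3
    rw [← neg_eq_iff_eq_neg] at h3
    rw [← h3, ← integral_neg]
    refine integral_congr_ae (Eventually.of_forall fun p => ?_)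
    simp only [fderiv_cellChar, cellFreq_neg]
    push_cast
    ring
  · intro h ψ hψ
    -- The pairing in the definition is bilinear, so the test function is conjugated to write it as
    -- an inner product. By Parseval the identity then holds coefficient by coefficient.
    have hint : ∀ {g : ℝ × ℝ → ℂ} (hg : MemLp (fun p => starRingEnd ℂ (g p)) 2 (cellMeasure K₁ K₂))
        (f : CellL2 K₁ K₂), ∫ p, f p * g p ∂cellMeasure K₁ K₂ = inner ℂ (hg.toLp _) f := by
      intro g hg f
      rw [L2.inner_def]
      refine integral_congr_ae ?_
      filter_upwards [hg.coeFn_toLp] with p hp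
      rw [hp, RCLike.inner_apply, Complex.conj_conj]
    have hc := memLp_cell_of_continuous K₁ K₂ 2 hψ.conj.continuous
    have hc' : MemLp (fun p => starRingEnd ℂ (fderiv ℝ ψ p e)) 2 (cellMeasure K₁ K₂) :=
      memLp_cell_of_continuous K₁ K₂ 2 (Complex.continuous_conj.comp (hψ.continuous_fderiv e))
    have hrepr : ∀ j, (cellBasis h₁ h₂).repr (hc'.toLp _) j
        = Complex.I * cellFreq K₁ K₂ j e * (cellBasis h₁ h₂).repr (hc.toLp _) j := fun j => by
      rw [← repr_toLp_fderiv h₁ h₂ hψ.conj he j]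
      have h5 : (fun p => starRingEnd ℂ (fderiv ℝ ψ p e))
          = fun p => fderiv ℝ (fun q => starRingEnd ℂ (ψ q)) p e := by
        funext p
        rw [fderiv_conj (hψ.differentiableAt p)]
      rw [MemLp.toLp_congr hc' (memLp_cell_of_continuous K₁ K₂ 2 (hψ.conj.continuous_fderiv e))
        (Eventually.of_forall (congrFun h5))]
    rw [hint hc', hint hc, (cellBasis h₁ h₂).inner_eq_tsum, (cellBasis h₁ h₂).inner_eq_tsum,
      ← tsum_neg]
    refine tsum_congr fun j => ?_
    rw [hrepr, h]
    simp only [RCLike.inner_apply, map_mul, Complex.conj_I, Complex.conj_ofReal]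
    ring

/-- The symbol of the operator `-Δ`. -/
def cellSymbol (K₁ K₂ : ℝ) (j : ℤ × ℤ) : ℝ :=
  cellFreq K₁ K₂ j (1, 0) ^ 2 + cellFreq K₁ K₂ j (0, 1) ^ 2

theorem cellSymbol_nonneg (K₁ K₂ : ℝ) (j : ℤ × ℤ) : 0 ≤ cellSymbol K₁ K₂ j := by
  unfold cellSymbol; positivity

/-- The Laplacian acts on Fourier coefficients by multiplication with minus the symbol. -/
theorem hasLaplacian_iff (h₁ : 0 < K₁) (h₂ : 0 < K₂) {v w : CellL2 K₁ K₂} :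
    HasLaplacian v w ↔ ∀ j, (cellBasis h₁ h₂).repr w j
      = -cellSymbol K₁ K₂ j * (cellBasis h₁ h₂).repr v j := by
  have hx : ((1, 0) : ℝ × ℝ) = (1, 0) ∨ ((1, 0) : ℝ × ℝ) = (0, 1) := Or.inl rfl
  have hy : ((0, 1) : ℝ × ℝ) = (1, 0) ∨ ((0, 1) : ℝ × ℝ) = (0, 1) := Or.inr rfl
  constructor
  · rintro ⟨vx, vy, vxx, vxy, vyy, hvx, hvy, hvxx, -, hvyy, rfl⟩ j
    rw [hasWeakDeriv_iff h₁ h₂ hx] at hvx hvxx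
    rw [hasWeakDeriv_iff h₁ h₂ hy] at hvy hvyy
    rw [map_add, lp.coeFn_add, Pi.add_apply, hvxx, hvyy, hvx, hvy, cellSymbol]
    push_cast
    linear_combination ((cellFreq K₁ K₂ j (1, 0) : ℂ) ^ 2 + (cellFreq K₁ K₂ j (0, 1) : ℂ) ^ 2)
      * (cellBasis h₁ h₂).repr v j * Complex.I_sq
  · intro h
    -- Elliptic regularity: v - w = v - Δv has coefficients (1 + symbol) times those of v. Every
    -- multiplier bounded by 1 + symbol thus maps v into L², including all derivatives of order one
    -- and two, mixed ones too.
    have hex : ∀ c : ℤ × ℤ → ℂ, (∀ j, ‖c j‖ ≤ 1 + cellSymbol K₁ K₂ j) →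
        ∃ y : CellL2 K₁ K₂, ∀ j, (cellBasis h₁ h₂).repr y j
          = c j * (cellBasis h₁ h₂).repr v j := fun c hc => by
      obtain ⟨y, -, hy⟩ := (cellBasis h₁ h₂).exists_repr_eq
        (c := fun j => c j * (cellBasis h₁ h₂).repr v j) (C := 1) (x := v - w) (fun j => by
          rw [map_sub, lp.coeFn_sub, Pi.sub_apply, h, one_mul, norm_mul]
          have h3 : (cellBasis h₁ h₂).repr v j
              - -(cellSymbol K₁ K₂ j : ℂ) * (cellBasis h₁ h₂).repr v j
              = ((1 + cellSymbol K₁ K₂ j : ℝ) : ℂ) * (cellBasis h₁ h₂).repr v j := by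
            push_cast; ring
          rw [h3, norm_mul, Complex.norm_real, Real.norm_of_nonneg
            (by linarith [cellSymbol_nonneg K₁ K₂ j])]
          exact mul_le_mul_of_nonneg_right (hc j) (norm_nonneg _))
      exact ⟨y, hy⟩
    have h1a : ∀ j e, ‖Complex.I * (cellFreq K₁ K₂ j e : ℂ)‖ = |cellFreq K₁ K₂ j e| := fun j e => by
      rw [norm_mul, Complex.norm_I, one_mul, Complex.norm_real, Real.norm_eq_abs]
    obtain ⟨vx, hvx⟩ := hex (fun j => Complex.I * cellFreq K₁ K₂ j (1, 0)) fun j => by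
      rw [h1a, cellSymbol]
      nlinarith [sq_abs (cellFreq K₁ K₂ j (1, 0)), sq_nonneg (|cellFreq K₁ K₂ j (1, 0)| - 1),
        sq_nonneg (cellFreq K₁ K₂ j (0, 1)), sq_nonneg (cellFreq K₁ K₂ j (1, 0))]
    obtain ⟨vy, hvy⟩ := hex (fun j => Complex.I * cellFreq K₁ K₂ j (0, 1)) fun j => by
      rw [h1a, cellSymbol]
      nlinarith [sq_abs (cellFreq K₁ K₂ j (0, 1)), sq_nonneg (|cellFreq K₁ K₂ j (0, 1)| - 1),
        sq_nonneg (cellFreq K₁ K₂ j (1, 0)), sq_nonneg (cellFreq K₁ K₂ j (0, 1))]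
    have h2a : ∀ e e', ∀ j, e ∈ ({(1, 0), (0, 1)} : Set (ℝ × ℝ)) → e' ∈ ({(1, 0), (0, 1)} : Set (ℝ × ℝ)) →
        ‖Complex.I * (cellFreq K₁ K₂ j e : ℂ) * (Complex.I * cellFreq K₁ K₂ j e')‖
          ≤ 1 + cellSymbol K₁ K₂ j := by
      intro e e' j he he'
      rw [norm_mul, h1a, h1a, cellSymbol]
      have : ∀ a b : ℝ, |a| * |b| ≤ (a ^ 2 + b ^ 2) / 2 := fun a b => by
        nlinarith [sq_abs a, sq_abs b, sq_nonneg (|a| - |b|)]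
      refine (this _ _).trans ?_
      rcases he with rfl | he <;> rcases he' with rfl | he' <;> try rw [mem_singleton_iff.1 he]
      all_goals try rw [mem_singleton_iff.1 he']
      all_goals nlinarith [sq_nonneg (cellFreq K₁ K₂ j (0, 1)), sq_nonneg (cellFreq K₁ K₂ j (1, 0))]
    obtain ⟨vxx, hvxx⟩ := hex _ fun j => h2a (1, 0) (1, 0) j (by simp) (by simp)
    obtain ⟨vxy, hvxy⟩ := hex _ fun j => h2a (0, 1) (1, 0) j (by simp) (by simp)
    obtain ⟨vyy, hvyy⟩ := hex _ fun j => h2a (0, 1) (0, 1) j (by simp) (by simp)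
    refine ⟨vx, vy, vxx, vxy, vyy, (hasWeakDeriv_iff h₁ h₂ hx).2 hvx,
      (hasWeakDeriv_iff h₁ h₂ hy).2 hvy,
      (hasWeakDeriv_iff h₁ h₂ hx).2 fun j => by rw [hvxx, hvx]; ring,
      (hasWeakDeriv_iff h₁ h₂ hy).2 fun j => by rw [hvxy, hvx]; ring,
      (hasWeakDeriv_iff h₁ h₂ hy).2 fun j => by rw [hvyy, hvy]; ring,
      (cellBasis h₁ h₂).ext_repr fun j => ?_⟩
    rw [h, map_add, lp.coeFn_add, Pi.add_apply, hvxx, hvyy, cellSymbol]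
    push_cast
    linear_combination (-(cellFreq K₁ K₂ j (1, 0) : ℂ) ^ 2 - (cellFreq K₁ K₂ j (0, 1) : ℂ) ^ 2)
      * (cellBasis h₁ h₂).repr v j * Complex.I_sq

end WeakDerivatives

/-! ### The free Schrödinger group and the semigroup of the linearization -/

section FreeGroup

variable {ι H : Type*} [NormedAddCommGroup H] [InnerProductSpace ℂ H]

theorem HilbertBasis.hasSum_norm_sq (b : HilbertBasis ι ℂ H) (x : H) :
    HasSum (fun i => ‖b.repr x i‖ ^ 2) (‖x‖ ^ 2) := by
  have h := lp.hasSum_norm (p := 2) (by norm_num) (b.repr x)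
  simpa [b.repr.norm_map] using h

/-- Dominated convergence for the Parseval sum. It provides both the strong continuity of the free
group and its generator. -/
theorem HilbertBasis.tendsto_of_repr {α : Type*} {l : Filter α} (b : HilbertBasis ι ℂ H)
    {y : α → H} {z : H} {g : ι → ℝ} (hg : Summable g)
    (hlim : ∀ i, Tendsto (fun a => b.repr (y a) i) l (𝓝 (b.repr z i)))
    (hle : ∀ᶠ a in l, ∀ i, ‖b.repr (y a) i - b.repr z i‖ ^ 2 ≤ g i) : Tendsto y l (𝓝 z) := by
  rw [tendsto_iff_norm_sub_tendsto_zero]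
  have h1 : Tendsto (fun a => ‖y a - z‖ ^ 2) l (𝓝 0) := by
    have h2 : ∀ a, ‖y a - z‖ ^ 2 = ∑' i, ‖b.repr (y a) i - b.repr z i‖ ^ 2 := fun a => by
      rw [← (b.hasSum_norm_sq (y a - z)).tsum_eq]
      simp only [map_sub, lp.coeFn_sub, Pi.sub_apply]
    simp only [h2]
    rw [show 𝓝 (0 : ℝ) = 𝓝 (∑' _ : ι, (0 : ℝ)) by rw [tsum_zero]]
    refine tendsto_tsum_of_dominated_convergence hg (fun i => ?_) ?_
    · have h3 := ((hlim i).sub_const (b.repr z i)).norm.pow 2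
      simpa using h3
    · filter_upwards [hle] with a ha i
      rw [Real.norm_of_nonneg (by positivity)]
      exact ha i
  have h4 := (Real.continuous_sqrt.tendsto 0).comp h1
  simpa [Function.comp_def, Real.sqrt_sq (norm_nonneg _)] using h4

/-- The group generated by `(v₁, v₂) ↦ (-D v₂, D v₁)`, with `D` diagonal. -/
def HilbertBasis.rotation (b : HilbertBasis ι ℂ H) (ν : ι → ℝ) (t : ℝ) : H × H →L[ℂ] H × H :=
  ((b.diagonal fun i => (cos (ν i * t) : ℂ)).comp (.fst ℂ H H)
    - (b.diagonal fun i => (sin (ν i * t) : ℂ)).comp (.snd ℂ H H)).prod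
  ((b.diagonal fun i => (sin (ν i * t) : ℂ)).comp (.fst ℂ H H)
    + (b.diagonal fun i => (cos (ν i * t) : ℂ)).comp (.snd ℂ H H))

variable (b : HilbertBasis ι ℂ H) (ν : ι → ℝ)

theorem norm_cos_mul_le (t : ℝ) (i : ι) : ‖(cos (ν i * t) : ℂ)‖ ≤ 1 := by
  rw [Complex.norm_real, Real.norm_eq_abs]
  exact abs_cos_le_one _

theorem norm_sin_mul_le (t : ℝ) (i : ι) : ‖(sin (ν i * t) : ℂ)‖ ≤ 1 := by
  rw [Complex.norm_real, Real.norm_eq_abs]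
  exact abs_sin_le_one _

theorem HilbertBasis.repr_rotation_fst (t : ℝ) (v : H × H) (i : ι) :
    b.repr (b.rotation ν t v).1 i
      = cos (ν i * t) * b.repr v.1 i - sin (ν i * t) * b.repr v.2 i := by
  change b.repr (b.diagonal _ v.1 - b.diagonal _ v.2) i = _
  rw [map_sub, lp.coeFn_sub, Pi.sub_apply, b.repr_diagonal (norm_cos_mul_le ν t),
    b.repr_diagonal (norm_sin_mul_le ν t)]

theorem HilbertBasis.repr_rotation_snd (t : ℝ) (v : H × H) (i : ι) :
    b.repr (b.rotation ν t v).2 i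
      = sin (ν i * t) * b.repr v.1 i + cos (ν i * t) * b.repr v.2 i := by
  change b.repr (b.diagonal _ v.1 + b.diagonal _ v.2) i = _
  rw [map_add, lp.coeFn_add, Pi.add_apply, b.repr_diagonal (norm_cos_mul_le ν t),
    b.repr_diagonal (norm_sin_mul_le ν t)]

theorem HilbertBasis.rotation_zero (v : H × H) : b.rotation ν 0 v = v :=
  Prod.ext (b.ext_repr fun i => by rw [b.repr_rotation_fst]; simp)
    (b.ext_repr fun i => by rw [b.repr_rotation_snd]; simp)

theorem HilbertBasis.rotation_add (s t : ℝ) (v : H × H) :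
    b.rotation ν (s + t) v = b.rotation ν s (b.rotation ν t v) := by
  refine Prod.ext (b.ext_repr fun i => ?_) (b.ext_repr fun i => ?_)
  · rw [b.repr_rotation_fst, b.repr_rotation_fst, b.repr_rotation_fst, b.repr_rotation_snd]
    push_cast
    rw [mul_add, Complex.cos_add, Complex.sin_add]
    ring
  · rw [b.repr_rotation_snd, b.repr_rotation_snd, b.repr_rotation_fst, b.repr_rotation_snd]
    push_cast
    rw [mul_add, Complex.cos_add, Complex.sin_add]
    ring

/-- The product carries the maximum norm, for which the rotations need not be isometries. Any bound
uniform in t is enough for the perturbation argument. -/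
theorem HilbertBasis.norm_rotation_le (t : ℝ) : ‖b.rotation ν t‖ ≤ 2 := by
  have hc := b.norm_diagonal_le zero_le_one (norm_cos_mul_le ν t)
  have hs := b.norm_diagonal_le zero_le_one (norm_sin_mul_le ν t)
  refine ContinuousLinearMap.opNorm_le_bound _ zero_le_two fun v => ?_
  have h1 := norm_fst_le v
  have h2 := norm_snd_le v
  refine (Prod.norm_def _).trans_le (max_le ?_ ?_)
  · refine (norm_sub_le _ _).trans ?_
    have h3 := ContinuousLinearMap.le_of_opNorm_le _ hc v.1
    have h4 := ContinuousLinearMap.le_of_opNorm_le _ hs v.2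
    exact (add_le_add h3 h4).trans (by linarith)
  · refine (norm_add_le _ _).trans ?_
    have h3 := ContinuousLinearMap.le_of_opNorm_le _ hs v.1
    have h4 := ContinuousLinearMap.le_of_opNorm_le _ hc v.2
    exact (add_le_add h3 h4).trans (by linarith)

theorem norm_add_sq_le_of_le {x y : ℂ} {a c : ℝ} (hx : ‖x‖ ≤ a) (hy : ‖y‖ ≤ c) :
    ‖x + y‖ ^ 2 ≤ 2 * a ^ 2 + 2 * c ^ 2 := by
  have h := norm_add_le x y
  have h0 := norm_nonneg (x + y)
  have h1 := norm_nonneg x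
  have h2 := norm_nonneg y
  nlinarith [sq_nonneg (a - c)]

theorem HilbertBasis.continuous_rotation (v : H × H) : Continuous fun t => b.rotation ν t v := by
  refine continuous_iff_continuousAt.2 fun t₀ => ?_
  have hsum : Summable fun i => 2 * (2 * ‖b.repr v.1 i‖) ^ 2 + 2 * (2 * ‖b.repr v.2 i‖) ^ 2 := by
    simp only [mul_pow]
    exact (((b.hasSum_norm_sq v.1).summable.mul_left _).mul_left _).add
      (((b.hasSum_norm_sq v.2).summable.mul_left _).mul_left _)
  have hcc : ∀ t i (x : ℂ), ‖((cos (ν i * t) : ℂ) - cos (ν i * t₀)) * x‖ ≤ 2 * ‖x‖ := fun t i x => by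
    rw [norm_mul]
    refine mul_le_mul_of_nonneg_right ((norm_sub_le _ _).trans ?_) (norm_nonneg _)
    linarith [norm_cos_mul_le ν t i, norm_cos_mul_le ν t₀ i]
  have hss : ∀ t i (x : ℂ), ‖((sin (ν i * t) : ℂ) - sin (ν i * t₀)) * x‖ ≤ 2 * ‖x‖ := fun t i x => by
    rw [norm_mul]
    refine mul_le_mul_of_nonneg_right ((norm_sub_le _ _).trans ?_) (norm_nonneg _)
    linarith [norm_sin_mul_le ν t i, norm_sin_mul_le ν t₀ i]
  refine (Prod.tendsto_iff _ _).2
    ⟨b.tendsto_of_repr hsum (fun i => ?_) (Eventually.of_forall fun t i => ?_),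
      b.tendsto_of_repr hsum (fun i => ?_) (Eventually.of_forall fun t i => ?_)⟩
  · simp only [b.repr_rotation_fst]
    exact Continuous.tendsto (by fun_prop) t₀
  · rw [b.repr_rotation_fst, b.repr_rotation_fst]
    refine le_trans (le_of_eq ?_) (norm_add_sq_le_of_le (hcc t i (b.repr v.1 i))
      ((norm_neg _).trans_le (hss t i (b.repr v.2 i))))
    congr 2
    ring
  · simp only [b.repr_rotation_snd]
    exact Continuous.tendsto (by fun_prop) t₀
  · rw [b.repr_rotation_snd, b.repr_rotation_snd, add_comm (2 * (2 * ‖b.repr v.1 i‖) ^ 2)]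
    refine le_trans (le_of_eq ?_) (norm_add_sq_le_of_le (hcc t i (b.repr v.2 i))
      (hss t i (b.repr v.1 i)))
    congr 2
    ring

theorem tendsto_sin_quotient (r : ℝ) :
    Tendsto (fun h : ℝ => ((h⁻¹ * sin (r * h) : ℝ) : ℂ)) (𝓝[>] 0) (𝓝 r) := by
  have h1 : HasDerivAt (fun h => sin (r * h)) r 0 := by
    have := ((hasDerivAt_id (0 : ℝ)).const_mul r).sin
    simpa using this
  have h2 := h1.tendsto_slope_zero_right
  simp only [zero_add, mul_zero, sin_zero, sub_zero, smul_eq_mul] at h2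
  exact (Complex.continuous_ofReal.tendsto r).comp h2

theorem tendsto_cos_quotient (r : ℝ) :
    Tendsto (fun h : ℝ => ((h⁻¹ * (cos (r * h) - 1) : ℝ) : ℂ)) (𝓝[>] 0) (𝓝 0) := by
  have h1 : HasDerivAt (fun h => cos (r * h)) 0 0 := by
    have := ((hasDerivAt_id (0 : ℝ)).const_mul r).cos
    simpa using this
  have h2 := h1.tendsto_slope_zero_right
  simp only [zero_add, mul_zero, cos_zero, smul_eq_mul] at h2
  have h3 := (Complex.continuous_ofReal.tendsto 0).comp h2
  rwa [Complex.ofReal_zero] at h3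

theorem norm_sin_quotient_le (r h : ℝ) : ‖((h⁻¹ * sin (r * h) : ℝ) : ℂ)‖ ≤ |r| := by
  rw [Complex.norm_real, Real.norm_eq_abs, abs_mul, abs_inv]
  rcases eq_or_ne h 0 with rfl | hh
  · simp
  · rw [inv_mul_le_iff₀ (abs_pos.2 hh), ← abs_mul, mul_comm h]
    exact abs_sin_le_abs

theorem norm_cos_quotient_le (r h : ℝ) : ‖((h⁻¹ * (cos (r * h) - 1) : ℝ) : ℂ)‖ ≤ |r| := by
  rw [Complex.norm_real, Real.norm_eq_abs, abs_mul, abs_inv]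
  rcases eq_or_ne h 0 with rfl | hh
  · simp
  · rw [inv_mul_le_iff₀ (abs_pos.2 hh), ← abs_mul, mul_comm h, abs_sub_comm]
    have h1 := abs_cos_sub_cos_le 0 (r * h)
    simpa using h1

/-- The generator of the rotation group. -/
theorem HilbertBasis.tendsto_rotation_iff (v w : H × H) :
    Tendsto (fun h : ℝ => ((h⁻¹ : ℝ) : ℂ) • (b.rotation ν h v - v)) (𝓝[>] 0) (𝓝 w) ↔
      (∀ i, b.repr w.1 i = -ν i * b.repr v.2 i) ∧ ∀ i, b.repr w.2 i = ν i * b.repr v.1 i := by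
  have hq1 : ∀ (h : ℝ) i, b.repr (((h⁻¹ : ℝ) : ℂ) • (b.rotation ν h v - v)).1 i
      = ((h⁻¹ * (cos (ν i * h) - 1) : ℝ) : ℂ) * b.repr v.1 i
        - ((h⁻¹ * sin (ν i * h) : ℝ) : ℂ) * b.repr v.2 i := fun h i => by
    rw [Prod.smul_fst, Prod.fst_sub, map_smul, map_sub, lp.coeFn_smul, lp.coeFn_sub, Pi.smul_apply,
      Pi.sub_apply, b.repr_rotation_fst, smul_eq_mul]
    push_cast
    ring
  have hq2 : ∀ (h : ℝ) i, b.repr (((h⁻¹ : ℝ) : ℂ) • (b.rotation ν h v - v)).2 i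
      = ((h⁻¹ * sin (ν i * h) : ℝ) : ℂ) * b.repr v.1 i
        + ((h⁻¹ * (cos (ν i * h) - 1) : ℝ) : ℂ) * b.repr v.2 i := fun h i => by
    rw [Prod.smul_snd, Prod.snd_sub, map_smul, map_sub, lp.coeFn_smul, lp.coeFn_sub, Pi.smul_apply,
      Pi.sub_apply, b.repr_rotation_snd, smul_eq_mul]
    push_cast
    ring
  have hl1 : ∀ i, Tendsto (fun h : ℝ => b.repr (((h⁻¹ : ℝ) : ℂ) • (b.rotation ν h v - v)).1 i)
      (𝓝[>] 0) (𝓝 (-ν i * b.repr v.2 i)) := fun i => by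
    simp only [hq1]
    have := ((tendsto_cos_quotient (ν i)).mul_const (b.repr v.1 i)).sub
      ((tendsto_sin_quotient (ν i)).mul_const (b.repr v.2 i))
    simpa using this
  have hl2 : ∀ i, Tendsto (fun h : ℝ => b.repr (((h⁻¹ : ℝ) : ℂ) • (b.rotation ν h v - v)).2 i)
      (𝓝[>] 0) (𝓝 (ν i * b.repr v.1 i)) := fun i => by
    simp only [hq2]
    have := ((tendsto_sin_quotient (ν i)).mul_const (b.repr v.1 i)).add
      ((tendsto_cos_quotient (ν i)).mul_const (b.repr v.2 i))
    simpa using this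
  have hcont : ∀ i, Continuous fun x : H => b.repr x i := fun i => by
    simp only [b.repr_apply_apply]
    fun_prop
  constructor
  · intro h
    refine ⟨fun i => ?_, fun i => ?_⟩
    · exact tendsto_nhds_unique
        (((hcont i).tendsto w.1).comp ((continuous_fst.tendsto w).comp h)) (hl1 i)
    · exact tendsto_nhds_unique
        (((hcont i).tendsto w.2).comp ((continuous_snd.tendsto w).comp h)) (hl2 i)
  · rintro ⟨h1, h2⟩
    -- The difference quotients of sine and cosine are bounded by |ν i|. Thus the coefficients of w,
    -- which are square summable, dominate those of the difference quotients uniformly in h.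
    have hn1 : ∀ i, |ν i| * ‖b.repr v.2 i‖ = ‖b.repr w.1 i‖ := fun i => by
      rw [h1, norm_mul, norm_neg, Complex.norm_real, Real.norm_eq_abs]
    have hn2 : ∀ i, |ν i| * ‖b.repr v.1 i‖ = ‖b.repr w.2 i‖ := fun i => by
      rw [h2, norm_mul, Complex.norm_real, Real.norm_eq_abs]
    have hs : ∀ h i (x : ℂ), ‖(((h⁻¹ * sin (ν i * h) : ℝ) : ℂ) - ν i) * x‖
        ≤ 2 * (|ν i| * ‖x‖) := fun h i x => by
      rw [norm_mul, ← mul_assoc]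
      refine mul_le_mul_of_nonneg_right ((norm_sub_le _ _).trans ?_) (norm_nonneg _)
      have := norm_sin_quotient_le (ν i) h
      rw [Complex.norm_real (ν i), Real.norm_eq_abs]
      linarith
    have hc : ∀ h i (x : ℂ), ‖((h⁻¹ * (cos (ν i * h) - 1) : ℝ) : ℂ) * x‖
        ≤ |ν i| * ‖x‖ := fun h i x => by
      rw [norm_mul]
      exact mul_le_mul_of_nonneg_right (norm_cos_quotient_le _ _) (norm_nonneg _)
    have hsum : ∀ x y : H, Summable fun i => 2 * ‖b.repr x i‖ ^ 2 + 2 * (2 * ‖b.repr y i‖) ^ 2 :=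
      fun x y => by
        simp only [mul_pow]
        exact ((b.hasSum_norm_sq x).summable.mul_left _).add
          (((b.hasSum_norm_sq y).summable.mul_left _).mul_left _)
    refine (Prod.tendsto_iff _ _).2
      ⟨b.tendsto_of_repr (hsum w.2 w.1) (fun i => ?_) (Eventually.of_forall fun h i => ?_),
        b.tendsto_of_repr (hsum w.1 w.2) (fun i => ?_) (Eventually.of_forall fun h i => ?_)⟩
    · rw [h1]; exact hl1 i
    · rw [hq1, ← hn1, ← hn2]
      refine le_trans (le_of_eq ?_) (norm_add_sq_le_of_le (hc h i (b.repr v.1 i))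
        ((norm_neg _).trans_le (hs h i (b.repr v.2 i))))
      rw [h1]
      congr 2
      ring
    · rw [h2]; exact hl2 i
    · rw [hq2, ← hn1, ← hn2]
      refine le_trans (le_of_eq ?_) (norm_add_sq_le_of_le (hc h i (b.repr v.2 i))
        (hs h i (b.repr v.1 i)))
      rw [h2]
      congr 2
      ring

end FreeGroup

/-! ### The linearization as a bounded perturbation of the free group -/

section Linearization

variable {K₁ K₂ : ℝ}

/-- Multiplication with a continuous real function is a bounded self-adjoint operator. -/
theorem exists_multiplication (K₁ K₂ : ℝ) {m : ℝ × ℝ → ℝ} (hm : Continuous m) :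
    ∃ T : CellL2 K₁ K₂ →L[ℂ] CellL2 K₁ K₂, IsSelfAdjoint T ∧
      ∀ v, ∀ᵐ p ∂cellMeasure K₁ K₂, T v p = (m p : ℂ) * v p := by
  obtain ⟨C, hC⟩ := exists_bound_on_cell K₁ K₂ hm
  have hbd : ∀ v : CellL2 K₁ K₂, ∀ᵐ p ∂cellMeasure K₁ K₂, ‖(m p : ℂ) * v p‖ ≤ C * ‖v p‖ := fun v => by
    filter_upwards [ae_cellMeasure_mem K₁ K₂] with p hp
    rw [norm_mul, Complex.norm_real]
    exact mul_le_mul_of_nonneg_right (hC p hp) (norm_nonneg _)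
  have hmem : ∀ v : CellL2 K₁ K₂, MemLp (fun p => (m p : ℂ) * v p) 2 (cellMeasure K₁ K₂) := fun v =>
    (Lp.memLp v).of_le_mul ((Complex.continuous_ofReal.comp hm).aestronglyMeasurable.mul
      (Lp.aestronglyMeasurable v)) (hbd v)
  let L : CellL2 K₁ K₂ →ₗ[ℂ] CellL2 K₁ K₂ :=
    { toFun := fun v => (hmem v).toLp _
      map_add' := fun v w => by
        refine Lp.ext ?_
        filter_upwards [(hmem (v + w)).coeFn_toLp, Lp.coeFn_add ((hmem v).toLp _) ((hmem w).toLp _),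
          (hmem v).coeFn_toLp, (hmem w).coeFn_toLp, Lp.coeFn_add v w] with p h1 h2 h3 h4 h5
        rw [h1, h2, Pi.add_apply, h3, h4, h5, Pi.add_apply]
        ring
      map_smul' := fun c v => by
        refine Lp.ext ?_
        filter_upwards [(hmem (c • v)).coeFn_toLp, Lp.coeFn_smul c ((hmem v).toLp _),
          (hmem v).coeFn_toLp, Lp.coeFn_smul c v] with p h1 h2 h3 h4
        rw [h1, RingHom.id_apply, h2, Pi.smul_apply, h3, h4, Pi.smul_apply, smul_eq_mul, smul_eq_mul]
        ring }
  have hL : ∀ v, ‖L v‖ ≤ C * ‖v‖ := fun v => by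
    refine Lp.norm_le_mul_norm_of_ae_le_mul ?_
    filter_upwards [(hmem v).coeFn_toLp, hbd v] with p h1 h2
    change ‖(hmem v).toLp _ p‖ ≤ _
    rwa [h1]
  refine ⟨L.mkContinuous C hL, ?_, fun v => (hmem v).coeFn_toLp⟩
  rw [ContinuousLinearMap.isSelfAdjoint_iff_isSymmetric]
  intro v w
  change inner ℂ ((hmem v).toLp _) w = inner ℂ v ((hmem w).toLp _)
  rw [L2.inner_def, L2.inner_def]
  refine integral_congr_ae ?_
  filter_upwards [(hmem v).coeFn_toLp, (hmem w).coeFn_toLp] with p h1 h2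
  rw [h1, h2]
  simp only [RCLike.inner_apply, map_mul, Complex.conj_ofReal]
  ring

/-- Membership in the linearization in terms of Fourier coefficients. -/
theorem mem_linearizedNLS_iff (h₁ : 0 < K₁) (h₂ : 0 < K₂) {f φ : ℝ → ℝ} {ω : ℝ}
    {P M : CellL2 K₁ K₂ →L[ℂ] CellL2 K₁ K₂}
    (hP : ∀ v, ∀ᵐ p ∂cellMeasure K₁ K₂, P v p = (potentialPlus f ω φ p.1 : ℂ) * v p)
    (hM : ∀ v, ∀ᵐ p ∂cellMeasure K₁ K₂, M v p = (potentialMinus f ω φ p.1 : ℂ) * v p)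
    {v w : CellL2 K₁ K₂ × CellL2 K₁ K₂} :
    (v, w) ∈ linearizedNLS f ω φ K₁ K₂ ↔
      (∀ j, (cellBasis h₁ h₂).repr (w.1 + P v.2) j
        = -cellSymbol K₁ K₂ j * (cellBasis h₁ h₂).repr v.2 j) ∧
      ∀ j, (cellBasis h₁ h₂).repr (w.2 - M v.1) j
        = cellSymbol K₁ K₂ j * (cellBasis h₁ h₂).repr v.1 j := by
  constructor
  · rintro ⟨d₁, d₂, hd₁, hd₂, h3, h4⟩
    rw [hasLaplacian_iff h₁ h₂] at hd₁ hd₂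
    have e2 : w.1 + P v.2 = d₂ := by
      refine Lp.ext ?_
      filter_upwards [h3, hP v.2, Lp.coeFn_add w.1 (P v.2)] with p h5 h6 h7
      rw [h7, Pi.add_apply, h6, h5]
      ring
    have e1 : w.2 - M v.1 = -d₁ := by
      refine Lp.ext ?_
      filter_upwards [h4, hM v.1, Lp.coeFn_sub w.2 (M v.1), Lp.coeFn_neg d₁] with p h5 h6 h7 h8
      rw [h7, Pi.sub_apply, h6, h5, h8, Pi.neg_apply]
      ring
    refine ⟨fun j => by rw [e2, hd₂], fun j => ?_⟩
    rw [e1, map_neg, lp.coeFn_neg, Pi.neg_apply, hd₁]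
    ring
  · rintro ⟨h3, h4⟩
    refine ⟨-(w.2 - M v.1), w.1 + P v.2, (hasLaplacian_iff h₁ h₂).2 fun j => ?_,
      (hasLaplacian_iff h₁ h₂).2 h3, ?_, ?_⟩
    · rw [map_neg, lp.coeFn_neg, Pi.neg_apply, h4]
      ring
    · filter_upwards [hP v.2, Lp.coeFn_add w.1 (P v.2)] with p h6 h7
      rw [h7, Pi.add_apply, h6]
      ring
    · filter_upwards [hM v.1, Lp.coeFn_sub w.2 (M v.1), Lp.coeFn_neg (w.2 - M v.1)] with p h6 h7 h8
      rw [h8, Pi.neg_apply, h7, Pi.sub_apply, h6]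
      ring

/-- The linearization generates a `C₀` semigroup. -/
theorem exists_semigroup_linearizedNLS (h₁ : 0 < K₁) (h₂ : 0 < K₂) {f φ : ℝ → ℝ} {ω : ℝ}
    (hp : Continuous (potentialPlus f ω φ)) (hm : Continuous (potentialMinus f ω φ)) :
    ∃ S : C0Semigroup (CellL2 K₁ K₂ × CellL2 K₁ K₂),
      S.HasGenerator (linearizedNLS f ω φ K₁ K₂) ∧ ∀ v, Continuous fun t => S.toFun t v := by
  obtain ⟨P, -, hP⟩ := exists_multiplication K₁ K₂ (hp.comp continuous_fst)
  obtain ⟨M, -, hM⟩ := exists_multiplication K₁ K₂ (hm.comp continuous_fst)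
  set b := cellBasis h₁ h₂ with hb
  -- The potential part (v₁, v₂) ↦ (-Pv₂, Mv₁). The remainder (v₁, v₂) ↦ (Δv₂, -Δv₁) generates the
  -- rotations with frequencies given by the symbol of -Δ.
  let B : CellL2 K₁ K₂ × CellL2 K₁ K₂ →L[ℂ] CellL2 K₁ K₂ × CellL2 K₁ K₂ :=
    (-(P.comp (.snd ℂ _ _))).prod (M.comp (.fst ℂ _ _))
  obtain ⟨S, hSc, hS⟩ := exists_perturbed_semigroup (b.rotation_zero (cellSymbol K₁ K₂))
    (b.rotation_add (cellSymbol K₁ K₂)) (b.norm_rotation_le (cellSymbol K₁ K₂))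
    (b.continuous_rotation (cellSymbol K₁ K₂)) B
  refine ⟨S, fun v w => ?_, hSc⟩
  rw [hS, b.tendsto_rotation_iff, mem_linearizedNLS_iff h₁ h₂ hP hM]
  have e1 : (w - B v).1 = w.1 + P v.2 := sub_neg_eq_add w.1 (P v.2)
  have e2 : (w - B v).2 = w.2 - M v.1 := rfl
  rw [e1, e2]

end Linearization

/-! ### The transversally modulated sector and the instability criterion -/

section Instability

variable {K₁ K₂ : ℝ}

theorem hasDerivAt_cellChar (j : ℤ × ℤ) (x y : ℝ) :
    HasDerivAt (fun r => cellChar K₁ K₂ j (r, y))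
      (Complex.I * cellFreq K₁ K₂ j (1, 0) * cellChar K₁ K₂ j (x, y)) x := by
  have h := (((contDiff_cellChar K₁ K₂ j (n := 1)).differentiable (by simp)
    (x, y)).hasFDerivAt).comp_hasDerivAt x ((hasDerivAt_id x).prodMk (hasDerivAt_const x y))
  rwa [fderiv_cellChar] at h

/-- Functions of `x` alone do not couple modes with different `y` frequencies. -/
theorem integral_mul_cellChar_eq_zero (h₂ : 0 < K₂) (h : ℝ → ℂ) {j : ℤ × ℤ} (hj : j.2 ≠ 0) :
    ∫ p, h p.1 * cellChar K₁ K₂ j p ∂cellMeasure K₁ K₂ = 0 := by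
  rw [cellMeasure_eq_prod]
  have h3 : ∀ p : ℝ × ℝ, h p.1 * cellChar K₁ K₂ j p
      = (h p.1 * cellChar K₁ K₂ (j.1, 0) (p.1, 0)) * cellChar K₁ K₂ (0, j.2) (0, p.2) := fun p => by
    rw [cellChar_eq_mul K₁ K₂ j p]; ring
  simp_rw [h3]
  rw [integral_prod_mul (fun x => h x * cellChar K₁ K₂ (j.1, 0) (x, 0))
    (fun y => cellChar K₁ K₂ (0, j.2) (0, y))]
  have hy : ∀ y : ℝ, cellChar K₁ K₂ (0, j.2) (0, y)
      = Complex.exp ((2 * π * (j.2 * y / K₂) : ℝ) * Complex.I) := fun x => by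
    simp [cellChar, cellFreq]
  simp_rw [hy]
  rw [integral_exp_freq h₂, if_neg hj, mul_zero]

theorem repr_toLp (h₁ : 0 < K₁) (h₂ : 0 < K₂) {g : ℝ × ℝ → ℂ} (hg : MemLp g 2 (cellMeasure K₁ K₂))
    (j : ℤ × ℤ) : (cellBasis h₁ h₂).repr (hg.toLp g) j
      = (((√(K₁ * K₂))⁻¹ : ℝ) : ℂ) * ∫ p, cellChar K₁ K₂ (-j) p * g p ∂cellMeasure K₁ K₂ := by
  rw [cellBasis_repr]
  congr 1
  refine integral_congr_ae ?_
  filter_upwards [hg.coeFn_toLp] with p hp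
  rw [hp]

/-- Functions on the cell of the form `v(x) exp (2 π i y / K₂)`. -/
def modulatedSector (h₁ : 0 < K₁) (h₂ : 0 < K₂) : Submodule ℂ (CellL2 K₁ K₂) where
  carrier := {v | ∀ j : ℤ × ℤ, j.2 ≠ 1 → (cellBasis h₁ h₂).repr v j = 0}
  add_mem' := fun {v w} hv hw j hj => by
    rw [map_add, lp.coeFn_add, Pi.add_apply, hv j hj, hw j hj, add_zero]
  zero_mem' := fun j _ => by simp
  smul_mem' := fun c v hv j hj => by
    rw [map_smul, lp.coeFn_smul, Pi.smul_apply, hv j hj, smul_zero]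

theorem mem_modulatedSector {h₁ : 0 < K₁} {h₂ : 0 < K₂} {v : CellL2 K₁ K₂} :
    v ∈ modulatedSector h₁ h₂ ↔ ∀ j : ℤ × ℤ, j.2 ≠ 1 → (cellBasis h₁ h₂).repr v j = 0 := Iff.rfl

instance completeSpace_modulatedSector (h₁ : 0 < K₁) (h₂ : 0 < K₂) :
    CompleteSpace (modulatedSector h₁ h₂) := by
  refine IsClosed.completeSpace_coe (hs := ?_)
  have h : ((modulatedSector h₁ h₂ : Submodule ℂ (CellL2 K₁ K₂)) : Set (CellL2 K₁ K₂))
      = ⋂ j : ℤ × ℤ, ⋂ _ : j.2 ≠ 1, {v | inner ℂ (cellBasis h₁ h₂ j) v = 0} := by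
    ext v
    simp only [SetLike.mem_coe, mem_modulatedSector, mem_iInter, HilbertBasis.repr_apply_apply]
    rfl
  rw [h]
  exact isClosed_iInter fun j => isClosed_iInter fun _ => isClosed_eq (by fun_prop) continuous_const

theorem cellMode_mem_modulatedSector (h₁ : 0 < K₁) (h₂ : 0 < K₂) (m : ℤ) :
    cellBasis h₁ h₂ (m, 1) ∈ modulatedSector h₁ h₂ := fun j hj => by
  rw [HilbertBasis.repr_self, lp.single_apply, Pi.single_eq_of_ne]
  rintro rfl
  exact hj rfl

theorem orthonormal_sectorModes (h₁ : 0 < K₁) (h₂ : 0 < K₂) :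
    Orthonormal ℂ fun m : ℤ => (⟨cellBasis h₁ h₂ (m, 1), cellMode_mem_modulatedSector h₁ h₂ m⟩ :
      modulatedSector h₁ h₂) := by
  have h := (cellBasis h₁ h₂).orthonormal.comp (fun m : ℤ => (m, (1 : ℤ)))
    (fun m n h => (Prod.ext_iff.1 h).1)
  exact ⟨h.1, h.2⟩

theorem orthogonal_sectorModes (h₁ : 0 < K₁) (h₂ : 0 < K₂) :
    (Submodule.span ℂ (range fun m : ℤ => (⟨cellBasis h₁ h₂ (m, 1),
      cellMode_mem_modulatedSector h₁ h₂ m⟩ : modulatedSector h₁ h₂)))ᗮ = ⊥ := by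
  rw [Submodule.eq_bot_iff]
  intro v hv
  refine Subtype.ext ((cellBasis h₁ h₂).ext_repr fun j => ?_)
  by_cases hj : j.2 = 1
  · have h := (Submodule.mem_orthogonal _ _).1 hv _ (Submodule.subset_span ⟨j.1, rfl⟩)
    rw [HilbertBasis.repr_apply_apply, show j = (j.1, 1) from Prod.ext rfl hj]
    refine Eq.trans h ?_
    simp
  · rw [v.2 j hj]
    simp

/-- The Fourier basis of the modulated sector. -/
def sectorBasis (h₁ : 0 < K₁) (h₂ : 0 < K₂) : HilbertBasis ℤ ℂ (modulatedSector h₁ h₂) :=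
  HilbertBasis.mkOfOrthogonalEqBot (orthonormal_sectorModes h₁ h₂) (orthogonal_sectorModes h₁ h₂)

theorem coe_sectorBasis (h₁ : 0 < K₁) (h₂ : 0 < K₂) (m : ℤ) :
    (sectorBasis h₁ h₂ m : CellL2 K₁ K₂) = cellBasis h₁ h₂ (m, 1) := by
  rw [sectorBasis, HilbertBasis.coe_mkOfOrthogonalEqBot]

theorem sectorBasis_repr (h₁ : 0 < K₁) (h₂ : 0 < K₂) (v : modulatedSector h₁ h₂) (m : ℤ) :
    (sectorBasis h₁ h₂).repr v m = (cellBasis h₁ h₂).repr v (m, 1) := by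
  rw [HilbertBasis.repr_apply_apply, HilbertBasis.repr_apply_apply, ← coe_sectorBasis]
  rfl

theorem toLp_mem_modulatedSector (h₁ : 0 < K₁) (h₂ : 0 < K₂) {h : ℝ → ℂ}
    (hh : MemLp (fun p => h p.1 * cellChar K₁ K₂ (0, 1) p) 2 (cellMeasure K₁ K₂)) :
    hh.toLp _ ∈ modulatedSector h₁ h₂ := fun j hj => by
  rw [repr_toLp]
  have h3 : ∀ p, cellChar K₁ K₂ (-j) p * (h p.1 * cellChar K₁ K₂ (0, 1) p)
      = h p.1 * cellChar K₁ K₂ (-j + (0, 1)) p := fun p => by rw [← cellChar_mul]; ring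
  simp_rw [h3]
  rw [integral_mul_cellChar_eq_zero h₂ h (by simp; omega), mul_zero]

/-- Multiplication with a function of `x` preserves the modulated sector. -/
theorem multiplication_mem_modulatedSector (h₁ : 0 < K₁) (h₂ : 0 < K₂) {h : ℝ → ℝ}
    {T : CellL2 K₁ K₂ →L[ℂ] CellL2 K₁ K₂} (hTs : IsSelfAdjoint T)
    (hT : ∀ v, ∀ᵐ p ∂cellMeasure K₁ K₂, T v p = (h p.1 : ℂ) * v p) {v : CellL2 K₁ K₂}
    (hv : v ∈ modulatedSector h₁ h₂) : T v ∈ modulatedSector h₁ h₂ := fun j hj => by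
  -- Moving T to the basis vector, T applied to mode j contains only modes with the same y
  -- frequency, whereas v contains only y frequency one; for j.2 ≠ 1 the two are orthogonal.
  have hsym : inner ℂ (T (cellBasis h₁ h₂ j)) v = inner ℂ (cellBasis h₁ h₂ j) (T v) :=
    (ContinuousLinearMap.isSelfAdjoint_iff_isSymmetric.1 hTs) _ _
  rw [HilbertBasis.repr_apply_apply, ← hsym, (cellBasis h₁ h₂).inner_eq_tsum]
  refine (tsum_congr fun i => ?_).trans tsum_zero
  by_cases hi : i.2 = 1
  · have h3 : (cellBasis h₁ h₂).repr (T (cellBasis h₁ h₂ j)) i = 0 := by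
      rw [cellBasis_repr, cellBasis_apply]
      have h4 : ∫ p, cellChar K₁ K₂ (-i) p * T (cellMode K₁ K₂ j) p ∂cellMeasure K₁ K₂
          = ∫ p, ((((√(K₁ * K₂))⁻¹ : ℝ) : ℂ) * h p.1) * cellChar K₁ K₂ (-i + j) p
            ∂cellMeasure K₁ K₂ := by
        refine integral_congr_ae ?_
        filter_upwards [hT (cellMode K₁ K₂ j), coeFn_cellMode K₁ K₂ j] with p h5 h6
        rw [h5, h6, ← cellChar_mul]
        ring
      rw [h4, integral_mul_cellChar_eq_zero h₂ (fun x => (((√(K₁ * K₂))⁻¹ : ℝ) : ℂ) * h x)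
        (by simp; omega), mul_zero]
    rw [h3, inner_zero_left]
  · rw [hv i hi, inner_zero_right]

theorem tendsto_cellSymbol_sector (h₁ : 0 < K₁) :
    Tendsto (fun m : ℤ => cellSymbol K₁ K₂ (m, 1)) cofinite atTop := by
  have h3 : Tendsto (fun m : ℤ => ‖(m : ℝ)‖) cofinite atTop :=
    tendsto_norm_cocompact_atTop.comp Int.tendsto_coe_cofinite
  have h4 : Tendsto (fun m : ℤ => (2 * π / K₁) ^ 2 * ‖(m : ℝ)‖ ^ 2) cofinite atTop :=
    ((tendsto_pow_atTop two_ne_zero).comp h3).const_mul_atTop (by positivity)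
  refine tendsto_atTop_mono (fun m => ?_) h4
  rw [cellSymbol, Real.norm_eq_abs, sq_abs]
  have h5 : cellFreq K₁ K₂ (m, 1) (1, 0) ^ 2 = (2 * π / K₁) ^ 2 * (m : ℝ) ^ 2 := by
    simp [cellFreq]; ring
  rw [h5]
  linarith [sq_nonneg (cellFreq K₁ K₂ (m, 1) (0, 1))]

/-- A positive periodic solution of `ψ'' = P ψ`. -/
structure IsGroundState (K₁ : ℝ) (P ψ ψ' : ℝ → ℝ) : Prop where
  hasDerivAt : ∀ x, HasDerivAt ψ (ψ' x) x
  hasDerivAt' : ∀ x, HasDerivAt ψ' (P x * ψ x) x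
  pos : ∀ x, 0 < ψ x
  periodic : ∀ x, ψ (x + K₁) = ψ x
  periodic' : ∀ x, ψ' (x + K₁) = ψ' x
  continuous_potential : Continuous P

variable {P ψ ψ' : ℝ → ℝ}

theorem IsGroundState.continuous (h : IsGroundState K₁ P ψ ψ') : Continuous ψ :=
  continuous_iff_continuousAt.2 fun x => (h.hasDerivAt x).continuousAt

theorem IsGroundState.continuous' (h : IsGroundState K₁ P ψ ψ') : Continuous ψ' :=
  continuous_iff_continuousAt.2 fun x => (h.hasDerivAt' x).continuousAt

/-- The quadratic form of `-∂ₓ² + P` is nonnegative if `ψ'' = P ψ` has a positive periodic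
solution. -/
theorem IsGroundState.form_nonneg (hψ : IsGroundState K₁ P ψ ψ') (h₁ : 0 < K₁) (h₂ : 0 < K₂)
    {V : CellL2 K₁ K₂ →L[ℂ] CellL2 K₁ K₂}
    (hV : ∀ v, ∀ᵐ p ∂cellMeasure K₁ K₂, V v p = (P p.1 : ℂ) * v p) (s : Finset (ℤ × ℤ))
    (c : ℤ × ℤ → ℂ) : 0 ≤ ∑ j ∈ s, cellFreq K₁ K₂ j (1, 0) ^ 2 * ‖c j‖ ^ 2
      + (inner ℂ (V (∑ j ∈ s, c j • cellBasis h₁ h₂ j)) (∑ j ∈ s, c j • cellBasis h₁ h₂ j)).re := by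
  set N : ℂ := (((√(K₁ * K₂))⁻¹ : ℝ) : ℂ) with hN
  have hsum : ∀ d : ℤ × ℤ → ℂ, ∀ᵐ p ∂cellMeasure K₁ K₂, (∑ j ∈ s, d j • cellBasis h₁ h₂ j) p
      = ∑ j ∈ s, d j * (N * cellChar K₁ K₂ j p) := fun d => by
    induction s using Finset.induction_on with
    | empty =>
      filter_upwards [Lp.coeFn_zero ℂ 2 (cellMeasure K₁ K₂)] with p hp
      simpa using hp
    | insert i s hi ih =>
      filter_upwards [ih, Lp.coeFn_add (d i • cellBasis h₁ h₂ i) (∑ j ∈ s, d j • cellBasis h₁ h₂ j),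
        Lp.coeFn_smul (d i) (cellBasis h₁ h₂ i), coeFn_cellMode K₁ K₂ i] with p h3 h4 h5 h6
      rw [Finset.sum_insert hi, Finset.sum_insert hi, h4, Pi.add_apply, h5, h3, Pi.smul_apply,
        cellBasis_apply, h6, smul_eq_mul]
  set g := ∑ j ∈ s, c j • cellBasis h₁ h₂ j with hg
  set d : ℤ × ℤ → ℂ := fun j => Complex.I * cellFreq K₁ K₂ j (1, 0) * c j with hd
  set gx := ∑ j ∈ s, d j • cellBasis h₁ h₂ j with hgx
  set G : ℝ × ℝ → ℂ := fun p => ∑ j ∈ s, c j * (N * cellChar K₁ K₂ j p) with hG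
  set Gx : ℝ × ℝ → ℂ := fun p => ∑ j ∈ s, d j * (N * cellChar K₁ K₂ j p) with hGx
  have hGc : Continuous G := continuous_finsetSum _ fun j _ =>
    continuous_const.mul (continuous_const.mul (continuous_cellChar K₁ K₂ j))
  have hGxc : Continuous Gx := continuous_finsetSum _ fun j _ =>
    continuous_const.mul (continuous_const.mul (continuous_cellChar K₁ K₂ j))
  have hder : ∀ x y, HasDerivAt (fun r => G (r, y)) (Gx (x, y)) x := fun x y => by
    refine HasDerivAt.fun_sum fun j _ => ?_
    refine (((hasDerivAt_cellChar j x y).const_mul N).const_mul (c j)).congr_deriv ?_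
    simp only [hd]
    ring
  have hGp : ∀ x y, G (x + K₁, y) = G (x, y) := fun x y => by
    simp only [hG, (isPeriodicTest_cellChar h₁ h₂ _).periodic_x]
  have hnorm : ((∑ j ∈ s, cellFreq K₁ K₂ j (1, 0) ^ 2 * ‖c j‖ ^ 2 : ℝ) : ℂ) = inner ℂ gx gx := by
    rw [hgx, (cellBasis h₁ h₂).orthonormal.inner_sum, Complex.ofReal_sum]
    refine Finset.sum_congr rfl fun j _ => ?_
    have h3 : (c j) * starRingEnd ℂ (c j) = ((‖c j‖ ^ 2 : ℝ) : ℂ) := by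
      rw [Complex.mul_conj, Complex.normSq_eq_norm_sq]
    simp only [hd, map_mul, Complex.conj_I, Complex.conj_ofReal]
    push_cast at h3 ⊢
    rw [← h3]
    linear_combination ((cellFreq K₁ K₂ j (1, 0) : ℂ) ^ 2 * (c j * starRingEnd ℂ (c j)))
      * Complex.I_sq
  -- The logarithmic derivative satisfies the Riccati equation a' = P - a², so |G_x|² + P|G|² = |G_x
  -- - aG|² + ∂ₓ(a|G|²). The last term is D, whose integral vanishes by periodicity. Positivity of ψ
  -- is what makes a globally defined.
  set a : ℝ → ℝ := fun x => ψ' x / ψ x with ha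
  have hac : Continuous a := hψ.continuous'.div hψ.continuous fun x => (hψ.pos x).ne'
  have had : ∀ x, HasDerivAt a (P x - a x ^ 2) x := fun x => by
    refine ((hψ.hasDerivAt' x).div (hψ.hasDerivAt x) (hψ.pos x).ne').congr_deriv ?_
    have := (hψ.pos x).ne'
    simp only [ha]
    field_simp
  have hPc := hψ.continuous_potential
  set D : ℝ × ℝ → ℂ := fun p => ((P p.1 - a p.1 ^ 2 : ℝ) : ℂ) * (G p * starRingEnd ℂ (G p))
    + (a p.1 : ℂ) * (Gx p * starRingEnd ℂ (G p) + G p * starRingEnd ℂ (Gx p)) with hD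
  have hDc : Continuous D := by
    have := Complex.continuous_conj
    have := Complex.continuous_ofReal
    fun_prop
  have hD0 : ∫ p, D p ∂cellMeasure K₁ K₂ = 0 := by
    refine integral_cell_deriv_fst h₁ (g := fun p => (a p.1 : ℂ) * (G p * starRingEnd ℂ (G p)))
      hDc (fun x y => ?_) fun x y => ?_
    · have h3 := (hder x y).star
      refine ((had x).ofReal_comp.mul ((hder x y).mul h3)).congr_deriv ?_
      rfl
    · simp only [ha, hGp, hψ.periodic, hψ.periodic']
  have hinner : inner ℂ gx gx + inner ℂ (V g) g
      = ∫ p, (((‖Gx p - a p.1 * G p‖ ^ 2 : ℝ) : ℂ) + D p) ∂cellMeasure K₁ K₂ := by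
    rw [L2.inner_def, L2.inner_def, ← integral_add (L2.integrable_inner gx gx)
      (L2.integrable_inner (V g) g)]
    refine integral_congr_ae ?_
    filter_upwards [hsum c, hsum d, hV g] with p h3 h4 h5
    have h6 : ((‖Gx p - a p.1 * G p‖ ^ 2 : ℝ) : ℂ)
        = (Gx p - a p.1 * G p) * starRingEnd ℂ (Gx p - a p.1 * G p) := by
      rw [Complex.mul_conj, Complex.normSq_eq_norm_sq]
    change inner ℂ (gx p) (gx p) + inner ℂ (V g p) (g p) = _
    rw [h5, h6]
    change g p = G p at h3
    change gx p = Gx p at h4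
    rw [h3, h4]
    simp only [hD, RCLike.inner_apply, map_sub, map_mul, Complex.conj_ofReal]
    push_cast
    ring
  rw [integral_add _ (integrable_cell_of_continuous _ _ hDc), hD0, add_zero, integral_complex_ofReal,
    ← hnorm] at hinner
  · have h3 := congrArg Complex.re hinner
    rw [Complex.add_re, Complex.ofReal_re, Complex.ofReal_re] at h3
    rw [h3]
    exact integral_nonneg fun p => by positivity
  · refine integrable_cell_of_continuous _ _ ?_
    have := Complex.continuous_ofReal
    fun_prop

/-- The profile `ψ(x) exp (2 π i y / K₂)` is annihilated by `-∂ₓ² + P`. -/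
theorem IsGroundState.repr_profile (hψ : IsGroundState K₁ P ψ ψ') (h₁ : 0 < K₁) (h₂ : 0 < K₂)
    (hm : MemLp (fun p => (ψ p.1 : ℂ) * cellChar K₁ K₂ (0, 1) p) 2 (cellMeasure K₁ K₂))
    {V : CellL2 K₁ K₂ →L[ℂ] CellL2 K₁ K₂}
    (hV : ∀ v, ∀ᵐ p ∂cellMeasure K₁ K₂, V v p = (P p.1 : ℂ) * v p) (j : ℤ × ℤ) :
    (cellFreq K₁ K₂ j (1, 0) : ℂ) ^ 2 * (cellBasis h₁ h₂).repr (hm.toLp _) j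
      + (cellBasis h₁ h₂).repr (V (hm.toLp _)) j = 0 := by
  have hcP := hψ.continuous_potential
  have hc := hψ.continuous
  have hc' := hψ.continuous'
  have hco := Complex.continuous_ofReal
  have hcc := continuous_cellChar K₁ K₂
  set f : ℂ := ((cellFreq K₁ K₂ j (1, 0) : ℝ) : ℂ) with hf
  rw [repr_toLp, cellBasis_repr]
  have h3 : ∫ p, cellChar K₁ K₂ (-j) p * V (hm.toLp _) p ∂cellMeasure K₁ K₂
      = ∫ p, cellChar K₁ K₂ (-j) p * ((P p.1 * ψ p.1 : ℝ) * cellChar K₁ K₂ (0, 1) p)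
        ∂cellMeasure K₁ K₂ := by
    refine integral_congr_ae ?_
    filter_upwards [hV (hm.toLp _), hm.coeFn_toLp] with p h4 h5
    rw [h4, h5]
    push_cast
    ring
  rw [h3, mul_left_comm, ← mul_add, ← integral_const_mul, ← integral_add]
  · have h4 := integral_cell_deriv_fst (K₂ := K₂) h₁
      (g := fun p => cellChar K₁ K₂ (-j) p * cellChar K₁ K₂ (0, 1) p
        * ((ψ' p.1 : ℂ) + Complex.I * f * ψ p.1))
      (g' := fun p => f ^ 2 * (cellChar K₁ K₂ (-j) p * (ψ p.1 * cellChar K₁ K₂ (0, 1) p))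
        + cellChar K₁ K₂ (-j) p * ((P p.1 * ψ p.1 : ℝ) * cellChar K₁ K₂ (0, 1) p))
      (by fun_prop) (fun x y => ?_) fun x y => ?_
    · rw [h4, mul_zero]
    · refine (((hasDerivAt_cellChar (-j) x y).mul (hasDerivAt_cellChar (0, 1) x y)).mul
        ((hψ.hasDerivAt' x).ofReal_comp.add
          ((hψ.hasDerivAt x).ofReal_comp.const_mul (Complex.I * f)))).congr_deriv ?_
      have h5 : cellFreq K₁ K₂ (0, 1) (1, 0) = 0 := by simp [cellFreq]
      rw [h5, cellFreq_neg]
      push_cast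
      rw [← hf]
      simp only [Pi.mul_apply, Pi.add_apply]
      linear_combination (-(cellChar K₁ K₂ (-j) (x, y)) * cellChar K₁ K₂ (0, 1) (x, y)
        * f ^ 2 * ψ x) * Complex.I_sq
    · simp only [hψ.periodic, hψ.periodic', (isPeriodicTest_cellChar h₁ h₂ _).periodic_x]
  · exact integrable_cell_of_continuous _ _ (by fun_prop)
  · exact integrable_cell_of_continuous _ _ (by fun_prop)

end Instability

/-! ### Instability from a ground state and a positive gap between the two potentials -/

section InstabilityCriterion

variable {K₁ K₂ : ℝ}

theorem exists_sector_multiplication (h₁ : 0 < K₁) (h₂ : 0 < K₂) {h : ℝ → ℝ} (hc : Continuous h) :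
    ∃ (T : CellL2 K₁ K₂ →L[ℂ] CellL2 K₁ K₂) (R : modulatedSector h₁ h₂ →L[ℂ] modulatedSector h₁ h₂),
      (∀ v, ∀ᵐ p ∂cellMeasure K₁ K₂, T v p = (h p.1 : ℂ) * v p) ∧ IsSelfAdjoint R ∧
        ∀ v, (R v : CellL2 K₁ K₂) = T v := by
  obtain ⟨T, hTs, hT⟩ := exists_multiplication K₁ K₂ (hc.comp continuous_fst)
  refine ⟨T, (T.comp (modulatedSector h₁ h₂).subtypeL).codRestrict _
    (fun v => multiplication_mem_modulatedSector h₁ h₂ hTs hT v.2), hT, ?_, fun v => rfl⟩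
  rw [ContinuousLinearMap.isSelfAdjoint_iff_isSymmetric]
  exact fun v w => (ContinuousLinearMap.isSelfAdjoint_iff_isSymmetric.1 hTs) v w

theorem cellSymbol_sector (m : ℤ) : cellSymbol K₁ K₂ (m, 1)
    = cellFreq K₁ K₂ (m, 1) (1, 0) ^ 2 + (2 * π / K₂) ^ 2 := by
  rw [cellSymbol]
  congr 1
  simp [cellFreq]
  ring

variable {P ψ ψ' : ℝ → ℝ}

/-- On the sector the y part of the symbol is the constant (2π/K₂)², which is added to the
nonnegative form of -∂ₓ² + P and lifts its kernel. -/
theorem IsGroundState.sector_form_ge (hψ : IsGroundState K₁ P ψ ψ') (h₁ : 0 < K₁) (h₂ : 0 < K₂)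
    {V : CellL2 K₁ K₂ →L[ℂ] CellL2 K₁ K₂}
    (hV : ∀ v, ∀ᵐ p ∂cellMeasure K₁ K₂, V v p = (P p.1 : ℂ) * v p)
    {R : modulatedSector h₁ h₂ →L[ℂ] modulatedSector h₁ h₂}
    (hR : ∀ v, (R v : CellL2 K₁ K₂) = V v) (s : Finset ℤ) (c : ℤ → ℂ) :
    (2 * π / K₂) ^ 2 * ∑ m ∈ s, ‖c m‖ ^ 2 ≤ ∑ m ∈ s, cellSymbol K₁ K₂ (m, 1) * ‖c m‖ ^ 2
      + (inner ℂ (R (∑ m ∈ s, c m • sectorBasis h₁ h₂ m))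
        (∑ m ∈ s, c m • sectorBasis h₁ h₂ m)).re := by
  have h := hψ.form_nonneg h₁ h₂ hV
    (s.map ⟨fun m : ℤ => (m, (1 : ℤ)), fun m n h => (Prod.ext_iff.1 h).1⟩) fun j => c j.1
  have hco : ((∑ m ∈ s, c m • sectorBasis h₁ h₂ m : modulatedSector h₁ h₂) : CellL2 K₁ K₂)
      = ∑ m ∈ s, c m • cellBasis h₁ h₂ (m, 1) := by
    rw [Submodule.coe_sum]
    exact Finset.sum_congr rfl fun m _ => by rw [Submodule.coe_smul, coe_sectorBasis]
  simp only [Finset.sum_map] at h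
  change 0 ≤ ∑ m ∈ s, cellFreq K₁ K₂ (m, 1) (1, 0) ^ 2 * ‖c m‖ ^ 2
    + (inner ℂ (V (∑ m ∈ s, c m • cellBasis h₁ h₂ (m, 1)))
      (∑ m ∈ s, c m • cellBasis h₁ h₂ (m, 1))).re at h
  rw [Submodule.coe_inner, hR, hco]
  simp only [cellSymbol_sector, add_mul, Finset.sum_add_distrib, Finset.mul_sum]
  linarith

theorem toLp_profile_ne_zero (h₁ : 0 < K₁) (h₂ : 0 < K₂) (hpos : ∀ x, 0 < ψ x)
    (hm : MemLp (fun p => (ψ p.1 : ℂ) * cellChar K₁ K₂ (0, 1) p) 2 (cellMeasure K₁ K₂)) :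
    hm.toLp _ ≠ 0 := fun h => by
  have h3 : ∀ᵐ p ∂cellMeasure K₁ K₂, False := by
    filter_upwards [hm.coeFn_toLp, Lp.coeFn_zero ℂ 2 (cellMeasure K₁ K₂)] with p h4 h5
    rw [h, h5, Pi.zero_apply] at h4
    have h6 : cellChar K₁ K₂ (0, 1) p ≠ 0 := by
      rw [cellChar]; exact Complex.exp_ne_zero _
    have h7 : (ψ p.1 : ℂ) ≠ 0 := by exact_mod_cast (hpos p.1).ne'
    exact mul_ne_zero h7 h6 h4.symm
  have h8 : cellMeasure K₁ K₂ = 0 := by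
    rw [← Measure.measure_univ_eq_zero]
    simpa [ae_iff] using h3
  have h9 := integral_cellChar h₁ h₂ 0
  rw [h8, integral_zero_measure] at h9
  have h10 : (K₁ : ℂ) * K₂ ≠ 0 := by
    exact_mod_cast (mul_pos h₁ h₂).ne'
  simp at h9
  rcases h9 with h9 | h9
  · exact h₁.ne' h9
  · exact h₂.ne' h9

/-- Transverse instability: if `ℒ₊` has a positive periodic zero mode and `ℒ₊ - ℒ₋` is
multiplication with a positive function, then the wave is unstable with respect to some period. -/
theorem IsGroundState.exists_unstable_period {f φ : ℝ → ℝ} {ω : ℝ} (h₁ : 0 < K₁)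
    (hψ : IsGroundState K₁ (potentialPlus f ω φ) ψ ψ') {W : ℝ → ℝ} (hW : Continuous W)
    (hpos : ∀ x, 0 < W x) (hM : ∀ x, potentialMinus f ω φ x = potentialPlus f ω φ x - W x) :
    ∃ K₂ : ℝ, 0 < K₂ ∧ SpectrallyAndLinearlyUnstable f ω φ K₁ K₂ := by
  obtain ⟨x₀, -, hx₀⟩ := isCompact_Icc.exists_isMinOn (nonempty_Icc.2 h₁.le) hW.continuousOn
  set w := W x₀ with hw
  have hw0 : 0 < w := hpos x₀
  -- Any k strictly between 0 and min W would do; K₂ is then chosen so that the first y frequency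
  -- squared equals k.
  set k := w / 2 with hk
  have hk0 : 0 < k := half_pos hw0
  set K₂ := 2 * π / √k with hK₂
  have h₂ : 0 < K₂ := by positivity
  have hkK : (2 * π / K₂) ^ 2 = k := by
    have : 2 * π / K₂ = √k := by rw [hK₂]; field_simp
    rw [this, sq_sqrt hk0.le]
  have hPc := hψ.continuous_potential
  have hMc : Continuous (potentialMinus f ω φ) := by
    rw [show potentialMinus f ω φ = fun x => potentialPlus f ω φ x - W x from funext hM]
    fun_prop
  refine ⟨K₂, h₂, ?_⟩
  obtain ⟨S, hSg, hSc⟩ := exists_semigroup_linearizedNLS h₁ h₂ hPc hMc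
  refine ⟨S, hSg, ?_⟩
  obtain ⟨V, RV, hV, hRVs, hRV⟩ := exists_sector_multiplication h₁ h₂ hPc
  obtain ⟨Q, RQ, hQ, hRQs, hRQ⟩ := exists_sector_multiplication h₁ h₂ hW.sqrt
  obtain ⟨M, -, hMm⟩ := exists_multiplication K₁ K₂ (hMc.comp continuous_fst)
  have hψc := hψ.continuous
  have hco := Complex.continuous_ofReal
  have hcc := continuous_cellChar K₁ K₂
  have hsW : ∀ x, √(W x) ≠ 0 := fun x => (sqrt_pos.2 (hpos x)).ne'
  have hqc : Continuous fun x => ψ x / √(W x) := hψc.div hW.sqrt hsW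
  have hm : MemLp (fun p => (ψ p.1 : ℂ) * cellChar K₁ K₂ (0, 1) p) 2 (cellMeasure K₁ K₂) :=
    memLp_cell_of_continuous _ _ _ (by fun_prop)
  have hmg : MemLp (fun p => ((ψ p.1 / √(W p.1) : ℝ) : ℂ) * cellChar K₁ K₂ (0, 1) p) 2
      (cellMeasure K₁ K₂) :=
    memLp_cell_of_continuous _ _ _ ((hco.comp (hqc.comp continuous_fst)).mul (hcc _))
  -- The trial vector is S⁻¹ applied to the ground state mode, with S multiplication by √W. Thus S g
  -- is an eigenvector of ℒ₊ - ∂_y² for k, and W ≥ 2k on the cell gives k‖g‖² ≤ ‖S g‖²/2.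
  set g : modulatedSector h₁ h₂ :=
    ⟨hmg.toLp _, toLp_mem_modulatedSector h₁ h₂ (h := fun x => ((ψ x / √(W x) : ℝ) : ℂ)) hmg⟩ with hg
  have hQg : (RQ g : CellL2 K₁ K₂) = hm.toLp _ := by
    rw [hRQ]
    refine Lp.ext ?_
    filter_upwards [hQ g, hmg.coeFn_toLp, hm.coeFn_toLp] with p h3 h4 h5
    rw [h3, h5]
    change _ * hmg.toLp _ p = _
    rw [h4, ← mul_assoc, ← Complex.ofReal_mul, mul_div_cancel₀ _ (hsW p.1)]
  have hnorm : ‖g‖ ≤ (√w)⁻¹ * ‖RQ g‖ := by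
    rw [Submodule.coe_norm, Submodule.coe_norm, hQg]
    refine Lp.norm_le_mul_norm_of_ae_le_mul ?_
    filter_upwards [hmg.coeFn_toLp, hm.coeFn_toLp, ae_cellMeasure_mem K₁ K₂] with p h4 h5 h6
    change ‖hmg.toLp _ p‖ ≤ _
    rw [h4, h5, norm_mul, norm_mul, ← mul_assoc, Complex.norm_real, Complex.norm_real, norm_div,
      div_eq_inv_mul, Real.norm_of_nonneg (sqrt_nonneg _)]
    have h7 : w ≤ W p.1 := hx₀ (Ioc_subset_Icc_self h6.1)
    gcongr
  have hne : 0 < ‖RQ g‖ := by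
    rw [Submodule.coe_norm, hQg, norm_pos_iff]
    exact toLp_profile_ne_zero h₁ h₂ hψ.pos hm
  have hlt : k * ‖g‖ ^ 2 < ‖RQ g‖ ^ 2 := by
    have h3 : ‖g‖ ^ 2 ≤ w⁻¹ * ‖RQ g‖ ^ 2 := by
      refine (pow_le_pow_left₀ (norm_nonneg _) hnorm 2).trans_eq ?_
      rw [mul_pow, inv_pow, sq_sqrt hw0.le]
    have h4 : k * ‖g‖ ^ 2 ≤ k * (w⁻¹ * ‖RQ g‖ ^ 2) := mul_le_mul_of_nonneg_left h3 hk0.le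
    have h5 : k * (w⁻¹ * ‖RQ g‖ ^ 2) = ‖RQ g‖ ^ 2 / 2 := by
      rw [hk]; field_simp
    have h6 : 0 < ‖RQ g‖ ^ 2 := by positivity
    linarith
  obtain ⟨l, hl, v₁, v₂, hv, he₁, he₂⟩ := (sectorBasis h₁ h₂).exists_unstable_pair hk0
    (ν := fun m => cellSymbol K₁ K₂ (m, 1))
    (fun m => by
      rw [cellSymbol_sector, hkK]
      linarith [sq_nonneg (cellFreq K₁ K₂ (m, 1) (1, 0))])
    (tendsto_cellSymbol_sector h₁) hRVs hRQs
    (fun s c => by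
      have := hψ.sector_form_ge h₁ h₂ hV hRV s c
      rwa [hkK] at this)
    (g := g)
    (fun m => by
      rw [sectorBasis_repr, sectorBasis_repr, hRV, hQg, cellSymbol_sector, hkK]
      have := hψ.repr_profile h₁ h₂ hm hV (m, 1)
      push_cast
      linear_combination this)
    hlt
  have hMv : M v₁ = V v₁ - Q (Q v₁) := by
    refine Lp.ext ?_
    filter_upwards [hMm v₁, hV v₁, hQ v₁, hQ (Q v₁), Lp.coeFn_sub (V v₁) (Q (Q v₁))]
      with p h3 h4 h5 h6 h7
    rw [h3, h7, Pi.sub_apply, h4, h6, h5, Function.comp_apply, hM]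
    have h8 : ((√(W p.1) : ℝ) : ℂ) * (√(W p.1) : ℝ) = (W p.1 : ℝ) := by
      rw [← Complex.ofReal_mul, mul_self_sqrt (hpos p.1).le]
    push_cast
    linear_combination (v₁ : CellL2 K₁ K₂) p * h8
  refine unstable_of_eigenvector hSg hSc (v := ((v₁ : CellL2 K₁ K₂), (v₂ : CellL2 K₁ K₂)))
    (z := (l : ℂ)) (fun h => hv (Subtype.ext (Prod.ext_iff.1 h).1)) (by simpa using hl) ?_
  -- Modes with y frequency one are the sector equations; for all other modes every term vanishes,
  -- because the multiplications preserve the sector.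
  refine (mem_linearizedNLS_iff h₁ h₂ hV hMm).2 ⟨fun j => ?_, fun j => ?_⟩
  · change (cellBasis h₁ h₂).repr ((l : ℂ) • (v₁ : CellL2 K₁ K₂) + V v₂) j
      = -cellSymbol K₁ K₂ j * (cellBasis h₁ h₂).repr v₂ j
    rw [map_add, map_smul, lp.coeFn_add, lp.coeFn_smul, Pi.add_apply, Pi.smul_apply, smul_eq_mul,
      ← hRV]
    by_cases hj : j.2 = 1
    · have h3 := he₁ j.1
      rw [sectorBasis_repr, sectorBasis_repr, sectorBasis_repr,
        show (j.1, (1 : ℤ)) = j from Prod.ext rfl hj.symm] at h3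
      linear_combination h3
    · rw [v₁.2 j hj, v₂.2 j hj, (RV v₂).2 j hj]
      ring
  · change (cellBasis h₁ h₂).repr ((l : ℂ) • (v₂ : CellL2 K₁ K₂) - M v₁) j
      = cellSymbol K₁ K₂ j * (cellBasis h₁ h₂).repr v₁ j
    rw [hMv, map_sub, map_sub, map_smul, lp.coeFn_sub, lp.coeFn_sub, lp.coeFn_smul, Pi.sub_apply,
      Pi.sub_apply, Pi.smul_apply, smul_eq_mul, ← hRV, ← hRQ, ← hRQ]
    by_cases hj : j.2 = 1
    · have h3 := he₂ j.1
      rw [sectorBasis_repr, sectorBasis_repr, sectorBasis_repr, sectorBasis_repr,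
        show (j.1, (1 : ℤ)) = j from Prod.ext rfl hj.symm] at h3
      linear_combination -h3
    · rw [v₁.2 j hj, v₂.2 j hj, (RV v₁).2 j hj, (RQ (RQ v₁)).2 j hj]
      ring

end InstabilityCriterion

/-! ### Jacobi elliptic functions -/

section Jacobi

variable {k : ℝ}

theorem one_sub_mul_sin_sq_pos (hk : k ^ 2 < 1) (θ : ℝ) : 0 < 1 - k ^ 2 * sin θ ^ 2 := by
  nlinarith [sin_sq_le_one θ, sq_nonneg k, sq_nonneg (sin θ)]

theorem hasDerivAt_ellipticF (hk : k ^ 2 < 1) (θ : ℝ) :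
    HasDerivAt (ellipticF k) (1 / √(1 - k ^ 2 * sin θ ^ 2)) θ := by
  have hc : Continuous fun s => 1 / √(1 - k ^ 2 * sin s ^ 2) :=
    continuous_const.div (by fun_prop) fun s => (sqrt_pos.2 (one_sub_mul_sin_sq_pos hk s)).ne'
  exact (hc.integral_hasStrictDerivAt 0 θ).hasDerivAt

theorem ellipticF_zero (k : ℝ) : ellipticF k 0 = 0 := intervalIntegral.integral_same

theorem strictMono_ellipticF (hk : k ^ 2 < 1) : StrictMono (ellipticF k) :=
  strictMono_of_hasDerivAt_pos (hasDerivAt_ellipticF hk) fun θ =>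
    one_div_pos.2 (sqrt_pos.2 (one_sub_mul_sin_sq_pos hk θ))

/-- The integrand is at least one. Hence the elliptic integral tends to ±∞ with θ and is onto, so
the amplitude is a genuine inverse. -/
theorem monotone_ellipticF_sub (hk : k ^ 2 < 1) : Monotone fun θ => ellipticF k θ - θ := by
  have h := fun θ => (hasDerivAt_ellipticF hk θ).sub (hasDerivAt_id θ)
  refine monotone_of_deriv_nonneg (fun θ => (h θ).differentiableAt) fun θ => ?_
  change 0 ≤ deriv (ellipticF k - id) θ
  rw [(h θ).deriv, sub_nonneg, le_div_iff₀ (sqrt_pos.2 (one_sub_mul_sin_sq_pos hk θ)), one_mul,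
    Real.sqrt_le_iff, one_pow]
  exact ⟨zero_le_one, by linarith [mul_nonneg (sq_nonneg k) (sq_nonneg (sin θ))]⟩

theorem surjective_ellipticF (hk : k ^ 2 < 1) : Function.Surjective (ellipticF k) := by
  have hm := monotone_ellipticF_sub hk
  have h0 := ellipticF_zero k
  refine Continuous.surjective (continuous_iff_continuousAt.2 fun θ =>
    (hasDerivAt_ellipticF hk θ).continuousAt) ?_ ?_
  · refine tendsto_atTop_mono' _ ?_ tendsto_id
    filter_upwards [eventually_ge_atTop 0] with θ hθ
    have := hm hθ
    simp only [h0] at this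
    simp only [id]
    linarith
  · refine tendsto_atBot_mono' _ ?_ tendsto_id
    filter_upwards [eventually_le_atBot 0] with θ hθ
    have := hm hθ
    simp only [h0] at this
    simp only [id]
    linarith

theorem ellipticF_jacobiAm (hk : k ^ 2 < 1) (x : ℝ) : ellipticF k (jacobiAm k x) = x :=
  Function.invFun_eq (surjective_ellipticF hk x)

theorem ellipticF_neg (hk : k ^ 2 < 1) (θ : ℝ) : ellipticF k (-θ) = -ellipticF k θ := by
  have h : ∀ θ, HasDerivAt (fun t => ellipticF k (-t) + ellipticF k t) 0 θ := fun θ => by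
    refine (((hasDerivAt_ellipticF hk (-θ)).comp θ (hasDerivAt_neg θ)).add
      (hasDerivAt_ellipticF hk θ)).congr_deriv ?_
    rw [sin_neg, neg_sq]
    ring
  have h3 := is_const_of_deriv_eq_zero (fun θ => (h θ).differentiableAt) (fun θ => (h θ).deriv) θ 0
  simp only [neg_zero, ellipticF_zero] at h3
  linarith

/-- The integrand has period π, so the increment is constant; at θ = -π/2 oddness evaluates it as
2K. This is the source of the period 2K of cn² and dn. -/
theorem ellipticF_add_pi (hk : k ^ 2 < 1) (θ : ℝ) :
    ellipticF k (θ + π) = ellipticF k θ + 2 * ellipticK k := by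
  have h : ∀ θ, HasDerivAt (fun t => ellipticF k (t + π) - ellipticF k t) 0 θ := fun θ => by
    refine (((hasDerivAt_ellipticF hk (θ + π)).comp_add_const θ π).sub
      (hasDerivAt_ellipticF hk θ)).congr_deriv ?_
    rw [sin_add_pi, neg_sq, sub_self]
  have h3 := is_const_of_deriv_eq_zero (fun θ => (h θ).differentiableAt) (fun θ => (h θ).deriv) θ
    (-(π / 2))
  simp only [show -(π / 2) + π = π / 2 by ring, ellipticF_neg hk] at h3
  rw [ellipticK]
  linarith

theorem ellipticK_pos (hk : k ^ 2 < 1) : 0 < ellipticK k := by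
  have h := strictMono_ellipticF hk pi_div_two_pos
  rwa [ellipticF_zero] at h

theorem jacobiAm_add (hk : k ^ 2 < 1) (x : ℝ) :
    jacobiAm k (x + 2 * ellipticK k) = jacobiAm k x + π :=
  (strictMono_ellipticF hk).injective (by
    rw [ellipticF_add_pi hk, ellipticF_jacobiAm hk, ellipticF_jacobiAm hk])

theorem continuous_jacobiAm (hk : k ^ 2 < 1) : Continuous (jacobiAm k) := by
  set e := (strictMono_ellipticF hk).orderIsoOfSurjective _ (surjective_ellipticF hk) with he
  have h : jacobiAm k = e.symm := funext fun x => by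
    rw [OrderIso.eq_symm_apply]
    exact ellipticF_jacobiAm hk x
  rw [h]
  exact e.symm.continuous

theorem jacobiDn_pos (hk : k ^ 2 < 1) (x : ℝ) : 0 < jacobiDn k x :=
  sqrt_pos.2 (one_sub_mul_sin_sq_pos hk _)

theorem jacobiDn_sq (hk : k ^ 2 < 1) (x : ℝ) : jacobiDn k x ^ 2 = 1 - k ^ 2 * jacobiSn k x ^ 2 :=
  sq_sqrt (one_sub_mul_sin_sq_pos hk _).le

theorem jacobiSn_sq_add_jacobiCn_sq (k x : ℝ) : jacobiSn k x ^ 2 + jacobiCn k x ^ 2 = 1 :=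
  sin_sq_add_cos_sq _

theorem hasDerivAt_jacobiAm (hk : k ^ 2 < 1) (x : ℝ) :
    HasDerivAt (jacobiAm k) (jacobiDn k x) x := by
  have h := HasDerivAt.of_local_left_inverse (continuous_jacobiAm hk).continuousAt
    (hasDerivAt_ellipticF hk (jacobiAm k x))
    (one_div_pos.2 (sqrt_pos.2 (one_sub_mul_sin_sq_pos hk _))).ne'
    (Eventually.of_forall (ellipticF_jacobiAm hk))
  rwa [one_div, inv_inv] at h

theorem hasDerivAt_jacobiSn (hk : k ^ 2 < 1) (x : ℝ) :
    HasDerivAt (jacobiSn k) (jacobiCn k x * jacobiDn k x) x :=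
  (hasDerivAt_jacobiAm hk x).sin

theorem hasDerivAt_jacobiCn (hk : k ^ 2 < 1) (x : ℝ) :
    HasDerivAt (jacobiCn k) (-jacobiSn k x * jacobiDn k x) x :=
  (hasDerivAt_jacobiAm hk x).cos

theorem hasDerivAt_jacobiDn (hk : k ^ 2 < 1) (x : ℝ) :
    HasDerivAt (jacobiDn k) (-(k ^ 2 * jacobiSn k x * jacobiCn k x)) x := by
  have h := ((((hasDerivAt_jacobiSn hk x).pow 2).const_mul (k ^ 2)).const_sub 1).sqrt
    (one_sub_mul_sin_sq_pos hk _).ne'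
  refine h.congr_deriv ?_
  change _ / (2 * jacobiDn k x) = _
  have := (jacobiDn_pos hk x).ne'
  push_cast
  field_simp

theorem jacobiSn_add (hk : k ^ 2 < 1) (x : ℝ) :
    jacobiSn k (x + 2 * ellipticK k) = -jacobiSn k x := by
  rw [jacobiSn, jacobiAm_add hk, sin_add_pi, jacobiSn]

theorem jacobiCn_add (hk : k ^ 2 < 1) (x : ℝ) :
    jacobiCn k (x + 2 * ellipticK k) = -jacobiCn k x := by
  rw [jacobiCn, jacobiAm_add hk, cos_add_pi, jacobiCn]

theorem jacobiDn_add (hk : k ^ 2 < 1) (x : ℝ) :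
    jacobiDn k (x + 2 * ellipticK k) = jacobiDn k x := by
  rw [jacobiDn, jacobiSn_add hk, neg_sq, jacobiDn]

end Jacobi

/-! ### Cnoidal and dnoidal profiles -/

section Profiles

variable {ω c φ₀ φ₁ α κ : ℝ}

theorem sq_lt_one_of_mem_Ioo (h : κ ∈ Ioo (0 : ℝ) 1) : κ ^ 2 < 1 := by
  nlinarith [h.1, h.2]

/-- The third root of the cubic is determined by the positive ones. -/
theorem CnoidalParams.root_relation (h : CnoidalParams ω c φ₀ φ₁ α κ) :
    2 * (φ₀ ^ 2 + φ₀ * φ₁ + φ₁ ^ 2) = 3 * ω * (φ₀ + φ₁) := by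
  have h1 : φ₀ - φ₁ ≠ 0 := (sub_pos.2 h.phi_one_lt).ne'
  refine mul_left_cancel₀ h1 ?_
  linear_combination 3 * h.root_zero - 3 * h.root_one

/-- With the third root ρ = 3ω/2 - φ₀ - φ₁ one has α² = (φ₀ - ρ)/6 and κ² = (φ₀ - φ₁)/(φ₀ - ρ), and
the product loses ρ. -/
theorem CnoidalParams.alpha_kappa (h : CnoidalParams ω c φ₀ φ₁ α κ) :
    α ^ 2 * κ ^ 2 = (φ₀ - φ₁) / 6 := by
  have h1 : 4 * φ₀ + 2 * φ₁ - 3 * ω ≠ 0 := fun h0 => by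
    have h2 := h.alpha_sq
    rw [h0, zero_div] at h2
    exact (pow_pos h.alpha_pos 2).ne' h2
  rw [h.alpha_sq, h.kappa_sq]
  field_simp
  ring

theorem CnoidalParams.isGroundState (h : CnoidalParams ω c φ₀ φ₁ α κ) :
    IsGroundState (2 * ellipticK κ / α) (fun x => ω - cnoidal φ₀ φ₁ α κ x) (cnoidal φ₀ φ₁ α κ)
      (fun x => -(2 * α * (φ₀ - φ₁)) * (jacobiSn κ (α * x) * jacobiCn κ (α * x)
        * jacobiDn κ (α * x))) := by
  have hk := sq_lt_one_of_mem_Ioo h.kappa_mem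
  have hlin : ∀ x : ℝ, HasDerivAt (fun r => α * r) α x := fun x => by
    simpa using (hasDerivAt_id x).const_mul α
  have hs := fun x : ℝ => (hasDerivAt_jacobiSn hk (α * x)).comp x (hlin x)
  have hc := fun x : ℝ => (hasDerivAt_jacobiCn hk (α * x)).comp x (hlin x)
  have hd := fun x : ℝ => (hasDerivAt_jacobiDn hk (α * x)).comp x (hlin x)
  have hper : ∀ x, α * (x + 2 * ellipticK κ / α) = α * x + 2 * ellipticK κ := fun x => by
    rw [mul_add, mul_div_cancel₀ _ h.alpha_pos.ne']
  have hder : ∀ x, HasDerivAt (cnoidal φ₀ φ₁ α κ) (-(2 * α * (φ₀ - φ₁)) * (jacobiSn κ (α * x)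
      * jacobiCn κ (α * x) * jacobiDn κ (α * x))) x := fun x => by
    refine ((((hc x).pow 2).const_mul (φ₀ - φ₁)).const_add φ₁).congr_deriv ?_
    simp only [Function.comp_apply]
    push_cast
    ring
  refine ⟨hder, fun x => ?_, fun x => ?_, fun x => ?_, fun x => ?_, ?_⟩
  · refine ((((hs x).mul (hc x)).mul (hd x)).const_mul (-(2 * α * (φ₀ - φ₁)))).congr_deriv ?_
    have h1 := jacobiDn_sq hk (α * x)
    have h2 := jacobiSn_sq_add_jacobiCn_sq κ (α * x)
    have h3 := h.alpha_sq
    have h4 := h.alpha_kappa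
    have h5 := h.root_relation
    simp only [Function.comp_apply, Pi.mul_apply, cnoidal]
    generalize jacobiSn κ (α * x) = s at *
    generalize jacobiCn κ (α * x) = C at *
    generalize jacobiDn κ (α * x) = d at *
    have h6 : s ^ 2 = 1 - C ^ 2 := by linarith
    have h7 : d ^ 2 = 1 - κ ^ 2 * (1 - C ^ 2) := by rw [h1, h6]
    -- After sn² and dn² are eliminated, the profile equation is a polynomial identity in C = cn,
    -- and it holds by the relation between the roots.
    have h8 : (φ₀ - φ₁) * (-2 * (α ^ 2 * (2 * C ^ 2 - 1)
        + α ^ 2 * κ ^ 2 * (3 * C ^ 4 - 4 * C ^ 2 + 1)))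
        = (ω - (φ₁ + (φ₀ - φ₁) * C ^ 2)) * (φ₁ + (φ₀ - φ₁) * C ^ 2) := by
      rw [h4, h3]
      linear_combination (1 / 6) * h5
    rw [← h8]
    have h9 : (C ^ 2 * d ^ 2 - s ^ 2 * d ^ 2 - κ ^ 2 * s ^ 2 * C ^ 2)
        = (2 * C ^ 2 - 1) + κ ^ 2 * (3 * C ^ 4 - 4 * C ^ 2 + 1) := by
      rw [h6, h7]
      ring
    linear_combination (-2 * α ^ 2 * (φ₀ - φ₁)) * h9
  · have h1 := mul_nonneg (sub_pos.2 h.phi_one_lt).le (sq_nonneg (jacobiCn κ (α * x)))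
    have h2 := h.phi_one_pos
    simp only [cnoidal]
    linarith
  · simp only [cnoidal]
    rw [hper, jacobiCn_add hk, neg_sq]
  · rw [hper, jacobiCn_add hk, jacobiSn_add hk, jacobiDn_add hk, neg_mul_neg]
  · have := continuous_iff_continuousAt.2 fun x => (hder x).continuousAt
    fun_prop

theorem CnoidalParams.exists_of_pos (hω : 0 < ω) (hc : c ∈ Ioo (-(ω ^ 3) / 3) 0)
    (h₁ : 0 < φ₁) (h₁ω : φ₁ < ω) (hω₀ : ω < φ₀) (hr₀ : 2 / 3 * φ₀ ^ 3 - ω * φ₀ ^ 2 - c = 0)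
    (hr₁ : 2 / 3 * φ₁ ^ 3 - ω * φ₁ ^ 2 - c = 0) : ∃ α κ : ℝ, CnoidalParams ω c φ₀ φ₁ α κ := by
  have hd : 0 < φ₀ - φ₁ := by linarith
  have hpos : 0 < 4 * φ₀ + 2 * φ₁ - 3 * ω := by linarith
  -- The second factor is twice the distance from φ₁ to the third root. Its positivity, which is
  -- exactly κ² < 1, follows from 0 < φ₁ < ω.
  have hrel : (φ₀ - φ₁) * (2 * φ₀ + 4 * φ₁ - 3 * ω) = 6 * φ₁ * (ω - φ₁) := by
    have h1 : 2 * (φ₀ ^ 2 + φ₀ * φ₁ + φ₁ ^ 2) = 3 * ω * (φ₀ + φ₁) := by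
      refine mul_left_cancel₀ hd.ne' ?_
      linear_combination 3 * hr₀ - 3 * hr₁
    linear_combination h1
  have hlt : 0 < 2 * φ₀ + 4 * φ₁ - 3 * ω := by
    refine pos_of_mul_pos_right (hrel.symm ▸ ?_) hd.le
    exact mul_pos (by positivity) (sub_pos.2 h₁ω)
  have hq : 0 < (2 * φ₀ - 2 * φ₁) / (4 * φ₀ + 2 * φ₁ - 3 * ω) := div_pos (by linarith) hpos
  refine ⟨√((4 * φ₀ + 2 * φ₁ - 3 * ω) / 12),
    √((2 * φ₀ - 2 * φ₁) / (4 * φ₀ + 2 * φ₁ - 3 * ω)), hω, hc, h₁, by linarith, hr₀, hr₁,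
    sqrt_pos.2 (by positivity), sq_sqrt (by positivity), ⟨sqrt_pos.2 hq, ?_⟩, sq_sqrt hq.le⟩
  rw [sqrt_lt' one_pos, one_pow, div_lt_one hpos]
  linarith

theorem exists_cnoidalParams (hω : 0 < ω) (hc : c ∈ Ioo (-(ω ^ 3) / 3) 0) :
    ∃ φ₀ φ₁ α κ : ℝ, CnoidalParams ω c φ₀ φ₁ α κ := by
  -- The cubic takes the values 0, -ω³/3, 0 at 0, ω, 3ω/2, which puts one root on each side of ω.
  have hcont : Continuous fun ρ : ℝ => 2 / 3 * ρ ^ 3 - ω * ρ ^ 2 := by fun_prop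
  have e1 : 2 / 3 * ω ^ 3 - ω * ω ^ 2 = -(ω ^ 3) / 3 := by ring
  have e2 : 2 / 3 * (3 / 2 * ω) ^ 3 - ω * (3 / 2 * ω) ^ 2 = 0 := by ring
  have e3 : 2 / 3 * (0 : ℝ) ^ 3 - ω * (0 : ℝ) ^ 2 = 0 := by ring
  obtain ⟨φ₁, h₁, hr₁⟩ := intermediate_value_Ioo' hω.le hcont.continuousOn
    (show c ∈ Ioo (2 / 3 * ω ^ 3 - ω * ω ^ 2) (2 / 3 * (0 : ℝ) ^ 3 - ω * (0 : ℝ) ^ 2) by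
      rwa [e1, e3])
  obtain ⟨φ₀, h₀, hr₀⟩ := intermediate_value_Ioo (show ω ≤ 3 / 2 * ω by linarith)
    hcont.continuousOn
    (show c ∈ Ioo (2 / 3 * ω ^ 3 - ω * ω ^ 2) (2 / 3 * (3 / 2 * ω) ^ 3 - ω * (3 / 2 * ω) ^ 2) by
      rwa [e1, e2])
  obtain ⟨α, κ, h⟩ := CnoidalParams.exists_of_pos hω hc h₁.1 h₁.2 h₀.1 (sub_eq_zero.2 hr₀)
    (sub_eq_zero.2 hr₁)
  exact ⟨φ₀, φ₁, α, κ, h⟩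

theorem exists_cnoidalParams_of_modulus (hω : 0 < ω) (hκ : κ ∈ Ioo (0 : ℝ) 1) :
    ∃ c φ₀ φ₁ α : ℝ, CnoidalParams ω c φ₀ φ₁ α κ := by
  have hk1 := sq_lt_one_of_mem_Ioo hκ
  have hk0 : 0 < κ ^ 2 := pow_pos hκ.1 2
  have hrad : 0 < 1 - κ ^ 2 + (κ ^ 2) ^ 2 := by nlinarith
  set q := κ ^ 2 with hq
  obtain ⟨r, hr0, hr⟩ : ∃ r : ℝ, 0 < r ∧ r ^ 2 = 1 - q + q ^ 2 :=
    -- With A = α² and q = κ², the root gaps are 6Aq and 6A, and the roots sum to 3ω/2. Writing ω =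
    -- 4Ar gives the formulas for φ₀ and φ₁ below; the missing linear term of the cubic then forces
    -- r² = 1 - q + q².
    ⟨_, sqrt_pos.2 hrad, sq_sqrt hrad.le⟩
  obtain ⟨A, hA0, hA⟩ : ∃ A : ℝ, 0 < A ∧ ω = 4 * A * r :=
    ⟨ω / (4 * r), by positivity, by field_simp⟩
  -- The three bounds on r mean φ₁ > 0, φ₀ > ω and φ₀ < 3ω/2; the last two place c in its interval.
  have hr1 : 2 * q - 1 < r := lt_of_pow_lt_pow_left₀ 2 hr0.le (by nlinarith)
  have hr2 : r < 1 + q := lt_of_pow_lt_pow_left₀ 2 (by positivity) (by nlinarith)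
  have hr3 : 1 + q < 2 * r :=
    lt_of_pow_lt_pow_left₀ 2 (by positivity) (by nlinarith [sq_nonneg (1 - q), mul_pos (sub_pos.2 hk1) (sub_pos.2 hk1)])
  obtain ⟨φ₀, h₀⟩ : ∃ φ₀, φ₀ = 2 * A * (r + (1 + q)) := ⟨_, rfl⟩
  obtain ⟨φ₁, h₁⟩ : ∃ φ₁, φ₁ = 2 * A * (r + (1 - 2 * q)) := ⟨_, rfl⟩
  have hφ₁ : 0 < φ₁ := by rw [h₁]; exact mul_pos (by positivity) (by linarith)
  have hd : φ₀ - φ₁ = 6 * A * q := by rw [h₀, h₁]; ring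
  have hωφ : 0 < φ₀ - ω := by
    rw [h₀, hA, show 2 * A * (r + (1 + q)) - 4 * A * r = 2 * A * (1 + q - r) by ring]
    exact mul_pos (by positivity) (by linarith)
  have hωφ' : 0 < 3 * ω - 2 * φ₀ := by
    rw [h₀, hA, show 3 * (4 * A * r) - 2 * (2 * A * (r + (1 + q))) = 4 * A * (2 * r - (1 + q)) by ring]
    exact mul_pos (by positivity) (by linarith)
  have hφ₀ : 0 < φ₀ := by linarith
  have hden : 4 * φ₀ + 2 * φ₁ - 3 * ω = 12 * A := by rw [h₀, h₁, hA]; ring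
  refine ⟨2 / 3 * φ₀ ^ 3 - ω * φ₀ ^ 2, φ₀, φ₁, √A, hω, ⟨?_, ?_⟩, hφ₁, ?_, sub_self _, ?_,
    sqrt_pos.2 hA0, ?_, hκ, ?_⟩
  · have h1 : 2 / 3 * φ₀ ^ 3 - ω * φ₀ ^ 2 - -(ω ^ 3) / 3 = (φ₀ - ω) ^ 2 * (2 * φ₀ + ω) / 3 := by ring
    have h2 : 0 < (φ₀ - ω) ^ 2 * (2 * φ₀ + ω) / 3 := by positivity
    linarith
  · have h1 : 2 / 3 * φ₀ ^ 3 - ω * φ₀ ^ 2 = -(φ₀ ^ 2 * (3 * ω - 2 * φ₀) / 3) := by ring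
    have h2 : 0 < φ₀ ^ 2 * (3 * ω - 2 * φ₀) / 3 := by positivity
    linarith
  · have : 0 < 6 * A * q := by positivity
    linarith
  · have h1 : 2 * (φ₀ ^ 2 + φ₀ * φ₁ + φ₁ ^ 2) = 3 * ω * (φ₀ + φ₁) := by
      rw [h₀, h₁, hA]
      linear_combination (-24 * A ^ 2) * hr
    linear_combination (-(φ₀ - φ₁) / 3) * h1
  · rw [sq_sqrt hA0.le, hden]
    ring
  · rw [hden, show 2 * φ₀ - 2 * φ₁ = 12 * A * q by linarith]
    field_simp
    exact hq.symm

theorem DnoidalParams.root_relation (h : DnoidalParams ω c φ₀ φ₁ α κ) :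
    φ₀ ^ 2 + φ₁ ^ 2 = 2 * ω := by
  have h1 : φ₀ ^ 2 - φ₁ ^ 2 ≠ 0 :=
    (sub_pos.2 (pow_lt_pow_left₀ h.phi_one_lt h.phi_one_pos.le two_ne_zero)).ne'
  refine mul_left_cancel₀ h1 ?_
  linear_combination 2 * h.root_zero - 2 * h.root_one

theorem DnoidalParams.phi_zero_pos (h : DnoidalParams ω c φ₀ φ₁ α κ) : 0 < φ₀ :=
  h.phi_one_pos.trans h.phi_one_lt

theorem DnoidalParams.isGroundState (h : DnoidalParams ω c φ₀ φ₁ α κ) :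
    IsGroundState (2 * ellipticK κ / α) (fun x => ω - dnoidal φ₀ α κ x ^ 2) (dnoidal φ₀ α κ)
      (fun x => -(φ₀ * α * κ ^ 2) * (jacobiSn κ (α * x) * jacobiCn κ (α * x))) := by
  have hk := sq_lt_one_of_mem_Ioo h.kappa_mem
  have hα : α ^ 2 = φ₀ ^ 2 / 2 := by rw [h.alpha_eq, div_pow, sq_sqrt zero_le_two]
  have hα0 : α ≠ 0 := fun h0 => by
    rw [h0] at hα
    have := pow_pos h.phi_zero_pos 2
    linarith
  have hακ : α ^ 2 * κ ^ 2 = (φ₀ ^ 2 - φ₁ ^ 2) / 2 := by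
    have := h.phi_zero_pos.ne'
    rw [hα, h.kappa_sq]
    field_simp
  have hlin : ∀ x : ℝ, HasDerivAt (fun r => α * r) α x := fun x => by
    simpa using (hasDerivAt_id x).const_mul α
  have hs := fun x : ℝ => (hasDerivAt_jacobiSn hk (α * x)).comp x (hlin x)
  have hc := fun x : ℝ => (hasDerivAt_jacobiCn hk (α * x)).comp x (hlin x)
  have hd := fun x : ℝ => (hasDerivAt_jacobiDn hk (α * x)).comp x (hlin x)
  have hper : ∀ x, α * (x + 2 * ellipticK κ / α) = α * x + 2 * ellipticK κ := fun x => by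
    rw [mul_add, mul_div_cancel₀ _ hα0]
  have hder : ∀ x, HasDerivAt (dnoidal φ₀ α κ) (-(φ₀ * α * κ ^ 2) * (jacobiSn κ (α * x)
      * jacobiCn κ (α * x))) x := fun x => by
    refine ((hd x).const_mul φ₀).congr_deriv ?_
    ring
  refine ⟨hder, fun x => ?_, fun x => ?_, fun x => ?_, fun x => ?_, ?_⟩
  · refine (((hs x).mul (hc x)).const_mul (-(φ₀ * α * κ ^ 2))).congr_deriv ?_
    have h1 := jacobiDn_sq hk (α * x)
    have h2 := jacobiSn_sq_add_jacobiCn_sq κ (α * x)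
    have h5 := h.root_relation
    simp only [Function.comp_apply, dnoidal]
    generalize jacobiSn κ (α * x) = s at *
    generalize jacobiCn κ (α * x) = C at *
    generalize jacobiDn κ (α * x) = d at *
    linear_combination (-(φ₀ * α ^ 2 * κ ^ 2 * d)) * h2 + (2 * φ₀ * α ^ 2 * d) * h1
      - φ₀ * d * hακ + (2 * φ₀ * d * (1 - d ^ 2)) * hα + (φ₀ * d / 2) * h5
  · exact mul_pos h.phi_zero_pos (jacobiDn_pos hk _)
  · simp only [dnoidal]
    rw [hper, jacobiDn_add hk]
  · rw [hper, jacobiCn_add hk, jacobiSn_add hk, neg_mul_neg]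
  · have := continuous_iff_continuousAt.2 fun x => (hder x).continuousAt
    fun_prop

theorem exists_dnoidalParams (hω : 0 < ω) (hc : c ∈ Ioo (-(ω ^ 2) / 2) 0) :
    ∃ φ₀ φ₁ α κ : ℝ, DnoidalParams ω c φ₀ φ₁ α κ := by
  have hdisc : 0 < ω ^ 2 + 2 * c := by linarith [hc.1]
  -- In ρ² the quartic is quadratic, with roots ω ± d.
  obtain ⟨d, hd0, hd⟩ : ∃ d : ℝ, 0 < d ∧ d ^ 2 = ω ^ 2 + 2 * c :=
    ⟨_, sqrt_pos.2 hdisc, sq_sqrt hdisc.le⟩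
  have hdω : d < ω := lt_of_pow_lt_pow_left₀ 2 hω.le (by linarith [hc.2])
  have h0 : 0 < ω + d := by positivity
  have h1 : 0 < ω - d := sub_pos.2 hdω
  have hs0 := sq_sqrt h0.le
  have hs1 := sq_sqrt h1.le
  have hq : 0 < (ω + d - (ω - d)) / (ω + d) := div_pos (by linarith) h0
  refine ⟨√(ω + d), √(ω - d), √(ω + d) / √2, √((ω + d - (ω - d)) / (ω + d)), hω, hc, sqrt_pos.2 h1,
    sqrt_lt_sqrt h1.le (by linarith), ?_, ?_, rfl, ⟨sqrt_pos.2 hq, ?_⟩, ?_⟩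
  · rw [show √(ω + d) ^ 4 = (√(ω + d) ^ 2) ^ 2 by ring, hs0]
    linear_combination hd / 2
  · rw [show √(ω - d) ^ 4 = (√(ω - d) ^ 2) ^ 2 by ring, hs1]
    linear_combination hd / 2
  · rw [sqrt_lt' one_pos, one_pow, div_lt_one h0]
    linarith
  · rw [sq_sqrt hq.le, hs0, hs1]

theorem exists_dnoidalParams_of_modulus (hω : 0 < ω) (hκ : κ ∈ Ioo (0 : ℝ) 1) :
    ∃ c φ₀ φ₁ α : ℝ, DnoidalParams ω c φ₀ φ₁ α κ := by
  have hk1 := sq_lt_one_of_mem_Ioo hκ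
  have hk0 : 0 < κ ^ 2 := pow_pos hκ.1 2
  set q := κ ^ 2 with hq
  have h2q : 0 < 2 - q := by linarith
  -- Here a = φ₀². The modulus forces φ₁² = (1 - q)a, and the squares of the roots must sum to 2ω.
  obtain ⟨a, ha0, ha⟩ : ∃ a : ℝ, 0 < a ∧ a * (2 - q) = 2 * ω :=
    ⟨2 * ω / (2 - q), by positivity, by field_simp⟩
  have hb0 : 0 < (1 - q) * a := mul_pos (by linarith) ha0
  have hba : (1 - q) * a < a := by nlinarith
  have hs0 := sq_sqrt ha0.le
  have hs1 := sq_sqrt hb0.le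
  have hω' : ω = a * (2 - q) / 2 := by linarith
  refine ⟨1 / 2 * a ^ 2 - ω * a, √a, √((1 - q) * a), √a / √2, hω, ⟨?_, ?_⟩, sqrt_pos.2 hb0,
    sqrt_lt_sqrt hb0.le hba, ?_, ?_, rfl, hκ, ?_⟩
  · have h1 : 1 / 2 * a ^ 2 - ω * a - -(ω ^ 2) / 2 = (a * q) ^ 2 / 8 := by rw [hω']; ring
    have h2 : 0 < (a * q) ^ 2 / 8 := by positivity
    linarith
  · have h1 : 1 / 2 * a ^ 2 - ω * a = -(a * ((1 - q) * a) / 2) := by rw [hω']; ring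
    have h2 : 0 < a * ((1 - q) * a) / 2 := by positivity
    linarith
  · rw [show √a ^ 4 = (√a ^ 2) ^ 2 by ring, hs0]
    ring
  · rw [show √((1 - q) * a) ^ 4 = (√((1 - q) * a) ^ 2) ^ 2 by ring, hs1, hω']
    ring
  · rw [hs0, hs1]
    field_simp
    ring

end Profiles

/-! ### Standing waves and their instability -/

section StandingWaves

theorem contDiff_two_of_hasDerivAt {φ φ' φ'' : ℝ → ℝ} (h : ∀ x, HasDerivAt φ (φ' x) x)
    (h' : ∀ x, HasDerivAt φ' (φ'' x) x) (hc : Continuous φ'') : ContDiff ℝ 2 φ := by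
  have e : deriv φ = φ' := funext fun x => (h x).deriv
  have e' : deriv φ' = φ'' := funext fun x => (h' x).deriv
  rw [show (2 : WithTop ℕ∞) = 1 + 1 by norm_num, contDiff_succ_iff_deriv, e, contDiff_one_iff_deriv,
    e']
  exact ⟨fun x => (h x).differentiableAt, by simp, fun x => (h' x).differentiableAt, hc⟩

theorem solvesNLS_standingWave {f φ φ' : ℝ → ℝ} {ω K₁ : ℝ} (K₂ : ℝ)
    (h : ∀ x, HasDerivAt φ (φ' x) x)
    (h' : ∀ x, HasDerivAt φ' (potentialPlus f ω φ x * φ x) x)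
    (hc : Continuous (potentialPlus f ω φ)) (hp : ∀ x, φ (x + K₁) = φ x) :
    SolvesNLS f K₁ K₂ (standingWave ω φ) := by
  have hφ : Continuous φ := continuous_iff_continuousAt.2 fun x => (h x).continuousAt
  refine ⟨?_, fun t x y => ?_, fun t x y => rfl, fun t x y => ?_⟩
  · have h2 : ContDiff ℝ 2 φ := contDiff_two_of_hasDerivAt h h' (hc.mul hφ)
    have h3 : ContDiff ℝ 2 fun r : ℝ => (r : ℂ) := Complex.ofRealCLM.contDiff
    exact ((contDiff_const.mul (h3.comp contDiff_fst)).cexp).mul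
      (h3.comp (h2.comp (contDiff_fst.comp contDiff_snd)))
  · simp only [standingWave, hp]
  · set E := Complex.exp (-Complex.I * ω * t) with hE
    have ht : deriv (fun s => standingWave ω φ s x y) t = -Complex.I * ω * E * φ x := by
      have h3 := (((hasDerivAt_id t).ofReal_comp.const_mul (-Complex.I * (ω : ℂ))).cexp).mul_const
        (φ x : ℂ)
      refine (h3.congr_deriv ?_).deriv
      simp only [id, Complex.ofReal_one, hE]
      ring
    have hx : iteratedDeriv 2 (fun r => standingWave ω φ t r y) x
        = E * ((potentialPlus f ω φ x * φ x : ℝ) : ℂ) := by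
      have h3 : deriv (fun r => standingWave ω φ t r y) = fun r => E * (φ' r : ℂ) :=
        funext fun r => ((h r).ofReal_comp.const_mul E).deriv
      rw [iteratedDeriv_succ, iteratedDeriv_one, h3]
      exact ((h' x).ofReal_comp.const_mul E).deriv
    have hy : iteratedDeriv 2 (fun r => standingWave ω φ t x r) y = 0 := by
      rw [iteratedDeriv_succ, iteratedDeriv_one]
      simp [standingWave]
    have hn : ‖standingWave ω φ t x y‖ ^ 2 = φ x ^ 2 := by
      rw [standingWave, norm_mul, Complex.norm_exp, Complex.norm_real, Real.norm_eq_abs]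
      simp
    rw [ht, hx, hy, hn]
    simp only [standingWave, potentialPlus, ← hE]
    push_cast
    linear_combination (-(ω : ℂ) * E * φ x) * Complex.I_sq

/-- The profile enters only through its square, so both signs share one linearization and only the
positive profile has to be analysed. -/
theorem potentialPlus_congr {φ ψ : ℝ → ℝ} (f : ℝ → ℝ) (ω : ℝ) (h : φ = ψ ∨ φ = -ψ) :
    potentialPlus f ω φ = potentialPlus f ω ψ := by
  rcases h with rfl | rfl
  · rfl
  · funext x
    simp [potentialPlus]

theorem potentialMinus_congr {φ ψ : ℝ → ℝ} (f : ℝ → ℝ) (ω : ℝ) (h : φ = ψ ∨ φ = -ψ) :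
    potentialMinus f ω φ = potentialMinus f ω ψ := by
  rcases h with rfl | rfl
  · rfl
  · funext x
    simp [potentialMinus]

/-- The waves with profiles `± ψ`, where `ψ` is positive, solve the equation and are unstable. -/
theorem IsGroundState.standingWave_unstable {f φ ψ ψ' W : ℝ → ℝ} {ω K₁ : ℝ} (h₁ : 0 < K₁)
    (hψ : IsGroundState K₁ (potentialPlus f ω ψ) ψ ψ') (hW : Continuous W) (hpos : ∀ x, 0 < W x)
    (hM : ∀ x, potentialMinus f ω ψ x = potentialPlus f ω ψ x - W x) (hφ : φ = ψ ∨ φ = -ψ) :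
    (∀ K₂ : ℝ, 0 < K₂ → SolvesNLS f K₁ K₂ (standingWave ω φ)) ∧
      ∃ K₂ : ℝ, 0 < K₂ ∧ SpectrallyAndLinearlyUnstable f ω φ K₁ K₂ := by
  have e1 := potentialPlus_congr f ω hφ
  have e2 := potentialMinus_congr f ω hφ
  refine ⟨fun K₂ _ => ?_, ?_⟩
  · rcases hφ with rfl | rfl
    · exact solvesNLS_standingWave K₂ hψ.hasDerivAt hψ.hasDerivAt' hψ.continuous_potential
        hψ.periodic
    · refine solvesNLS_standingWave (φ' := -ψ') K₂ (fun x => (hψ.hasDerivAt x).neg) (fun x => ?_)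
        (e1 ▸ hψ.continuous_potential) fun x => ?_
      · rw [e1, Pi.neg_apply, mul_neg]
        exact (hψ.hasDerivAt' x).neg
      · rw [Pi.neg_apply, Pi.neg_apply, hψ.periodic]
  · refine IsGroundState.exists_unstable_period (ψ := ψ) (ψ' := ψ') h₁ (e1 ▸ hψ) hW hpos fun x => ?_
    rw [e1, e2, hM]

/-- For the positive profile ψ, f(ψ²) = ψ and 2f'(ψ²)ψ² = ψ, so the gap W between the two potentials
is the ground state itself. Positivity also keeps the square root away from its singularity at 0. -/
theorem cnoidal_wave {ω c φ₀ φ₁ α κ : ℝ} (h : CnoidalParams ω c φ₀ φ₁ α κ) {φ : ℝ → ℝ}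
    (hφ : φ = cnoidal φ₀ φ₁ α κ ∨ φ = -cnoidal φ₀ φ₁ α κ) :
    (∀ K₂ : ℝ, 0 < K₂ →
      SolvesNLS (fun z => √z) (2 * ellipticK κ / α) K₂ (standingWave ω φ)) ∧
    ∃ K₂ : ℝ, 0 < K₂ ∧
      SpectrallyAndLinearlyUnstable (fun z => √z) ω φ (2 * ellipticK κ / α) K₂ := by
  have hg := h.isGroundState
  have e1 : potentialPlus (fun z => √z) ω (cnoidal φ₀ φ₁ α κ)
      = fun x => ω - cnoidal φ₀ φ₁ α κ x := funext fun x => by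
    rw [potentialPlus, sqrt_sq (hg.pos x).le]
  have hK := ellipticK_pos (sq_lt_one_of_mem_Ioo h.kappa_mem)
  refine IsGroundState.standingWave_unstable (div_pos (by positivity) h.alpha_pos) (e1 ▸ hg)
    hg.continuous hg.pos (fun x => ?_) hφ
  have hx := hg.pos x
  rw [potentialMinus, potentialPlus, (hasDerivAt_sqrt (pow_pos hx 2).ne').deriv, sqrt_sq hx.le]
  field_simp

theorem dnoidal_wave {ω c φ₀ φ₁ α κ : ℝ} (h : DnoidalParams ω c φ₀ φ₁ α κ) {φ : ℝ → ℝ}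
    (hφ : φ = dnoidal φ₀ α κ ∨ φ = -dnoidal φ₀ α κ) :
    (∀ K₂ : ℝ, 0 < K₂ →
      SolvesNLS (fun z => z) (2 * ellipticK κ / α) K₂ (standingWave ω φ)) ∧
    ∃ K₂ : ℝ, 0 < K₂ ∧
      SpectrallyAndLinearlyUnstable (fun z => z) ω φ (2 * ellipticK κ / α) K₂ := by
  have hg := h.isGroundState
  have hK := ellipticK_pos (sq_lt_one_of_mem_Ioo h.kappa_mem)
  have hα : 0 < α := by
    rw [h.alpha_eq]
    exact div_pos h.phi_zero_pos (sqrt_pos.2 two_pos)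
  refine IsGroundState.standingWave_unstable (W := fun x => 2 * dnoidal φ₀ α κ x ^ 2)
    (div_pos (by positivity) hα) hg ((hg.continuous.pow 2).const_mul 2)
    (fun x => mul_pos two_pos (pow_pos (hg.pos x) 2)) (fun x => ?_) hφ
  rw [potentialMinus, potentialPlus, show deriv (fun z : ℝ => z) (dnoidal φ₀ α κ x ^ 2) = 1 from
    deriv_id _, mul_one]

end StandingWaves

end

theorem theorem4 :
    -- quadratic equation, `f(z) = √z`
    ((∀ ω c : ℝ, 0 < ω → c ∈ Ioo (-(ω ^ 3) / 3) 0 →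
        ∃ φ₀ φ₁ α κ : ℝ, CnoidalParams ω c φ₀ φ₁ α κ) ∧
      (∀ ω κ : ℝ, 0 < ω → κ ∈ Ioo (0 : ℝ) 1 →
        ∃ c φ₀ φ₁ α : ℝ, CnoidalParams ω c φ₀ φ₁ α κ) ∧
      (∀ ω c φ₀ φ₁ α κ : ℝ, CnoidalParams ω c φ₀ φ₁ α κ →
        ∀ φ : ℝ → ℝ, (φ = cnoidal φ₀ φ₁ α κ ∨ φ = -cnoidal φ₀ φ₁ α κ) →
          (∀ K₂ : ℝ, 0 < K₂ →
            SolvesNLS (fun z => √z) (2 * ellipticK κ / α) K₂ (standingWave ω φ)) ∧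
          ∃ K₂ : ℝ, 0 < K₂ ∧
            SpectrallyAndLinearlyUnstable (fun z => √z) ω φ (2 * ellipticK κ / α) K₂)) ∧
    -- cubic equation, `f(z) = z`
    ((∀ ω c : ℝ, 0 < ω → c ∈ Ioo (-(ω ^ 2) / 2) 0 →
        ∃ φ₀ φ₁ α κ : ℝ, DnoidalParams ω c φ₀ φ₁ α κ) ∧
      (∀ ω κ : ℝ, 0 < ω → κ ∈ Ioo (0 : ℝ) 1 →
        ∃ c φ₀ φ₁ α : ℝ, DnoidalParams ω c φ₀ φ₁ α κ) ∧
      (∀ ω c φ₀ φ₁ α κ : ℝ, DnoidalParams ω c φ₀ φ₁ α κ →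
        ∀ φ : ℝ → ℝ, (φ = dnoidal φ₀ α κ ∨ φ = -dnoidal φ₀ α κ) →
          (∀ K₂ : ℝ, 0 < K₂ →
            SolvesNLS (fun z => z) (2 * ellipticK κ / α) K₂ (standingWave ω φ)) ∧
          ∃ K₂ : ℝ, 0 < K₂ ∧
            SpectrallyAndLinearlyUnstable (fun z => z) ω φ (2 * ellipticK κ / α) K₂)) :=
  ⟨⟨fun _ _ => exists_cnoidalParams, fun _ _ => exists_cnoidalParams_of_modulus,
    fun _ _ _ _ _ _ h _ => cnoidal_wave h⟩,
  ⟨fun _ _ => exists_dnoidalParams, fun _ _ => exists_dnoidalParams_of_modulus,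
    fun _ _ _ _ _ _ h _ => dnoidal_wave h⟩⟩
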